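/- Let $d,p\ge 1$ be integers, with $p\le 2$ if $d=1$. Let $s\ge 0$ be an integer, $0<\gamma\le 1$, $\alpha=s+\gamma$, and let $L>0$, $B_0,\dots,B_s>0$, $\overline C>1$, $C>0$ be constants. Let $\Lambda^{s,\gamma}(L)$ be the set of all $s$ times differentiable functions $\lambda:\mathbb{R}\to\mathbb{R}$ with $|\lambda^{(s)}(z_1)-\lambda^{(s)}(z_2)|\le L|z_1-z_2|^{\gamma}$ for all $z_1,z_2\in\mathbb{R}$ and $\sup_{z}|\lambda^{(k)}(z)|\le B_k$ for $0\le k\le s$. Let $\mathcal{U}$ be the class of functions $$\mu(x)=\sum_{i=1}^p\lambda_i(\beta_{(i)}^Tx),\qquad x\in[0,1]^d,$$ where $\beta_{(1)},\dots,\beta_{(p)}\in\mathbb{R}^d$ are distinct with $\|\beta_{(i)}\|_2=1$, and $\lambda_1,\dots,\lambda_p\in\Lambda^{s,\gamma}(L)$ are non-constant. Let $\Sigma=\{\exp(\sum_{i=1}^dc_ix_i):\max_i|c_i|\le C\}$, and let $\mathcal{H}$ be the class of probability densities $h$ on $[0,1]^d$ with $1/\overline C\le h\le\overline C$. One observes i.i.d.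 pairs $(X_i,Y_i)$, $1\le i\le n$, with $$Y_i=\mu(X_i)+\sigma(X_i)\epsilon_i,$$ where $X_i$ has density $h\in\mathcal{H}$, $\mu\in\mathcal{U}$, $\sigma\in\Sigma$, and $\epsilon_i$ is independent of $X_i$ with known Lebesgue density $\frac1{\sigma_0}f_0(\frac{y-\eta_0}{\sigma_0})$; here $\eta_0\in\mathbb{R}$ and $\sigma_0>0$ are fixed (in particular $\eta_0=0$, $\sigma_0=1$ is allowed) and $f_0$ is one of the following densities, where $\rho_\tau(y)=y(\tau-I(y<0))$ and $\Gamma(t,k)=\int_k^\infty x^{t-1}e^{-x}dx$: 1. asymmetric Laplace: $\tau(1-\tau)e^{-\rho_\tau(y)}$, $0<\tau<1$; 2. asymmetric connected double truncated gamma: $\frac{\tau(1-\tau)}{\Gamma(a+1,a)}[a+\rho_\tau(y)]^ae^{-[a+\rho_\tau(y)]}$, $a\ge 0$, $0<\tau<1$; 3. connected normal-Laplace: $\frac{2\tau}{\sqrt{2\pi}}e^{-y^2/2}I(y\le 0)+\frac{1-\tau}{b}e^{-y/b}I(y>0)$, $0<\tau<1$, $b>0$, $\frac{1-\tau}{b}=\frac{2\tau}{\sqrt{2\pi}}$;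 4. Cauchy: $\frac1{\pi(1+y^2)}$; 5. asymmetric normal: $\frac{2}{\sqrt\pi}\frac{\sqrt{\phi(1-\phi)}}{\sqrt\phi+\sqrt{1-\phi}}\exp[-\phi y^2I(y\ge 0)-(1-\phi)y^2I(y<0)]$, $0<\phi<1$. Then the minimax risk under the squared $L_2(h)$ loss is of order $n^{-2\alpha/(2\alpha+1)}$: there are constants $c_1,c_2>0$, not depending on $n$, such that for all $n\ge 1$ $$c_1\,n^{-\frac{2\alpha}{2\alpha+1}}\le\inf_{\hat\mu}\ \sup_{\mu\in\mathcal{U},\,\sigma\in\Sigma,\,h\in\mathcal{H}}\mathbb{E}\int_{[0,1]^d}(\mu(x)-\hat\mu(x))^2h(x)\,dx\le c_2\,n^{-\frac{2\alpha}{2\alpha+1}},$$ where the infimum is over all estimators $\hat\mu$ that are measurable functions of the data and of $x$. -/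

import Mathlib

open MeasureTheory Set
open scoped ENNReal

noncomputable section

namespace LocationScale

/-! ### Error densities -/

/-- The check loss `ρ_τ(y) = y (τ - 1{y < 0})`. -/
def checkLoss (τ y : ℝ) : ℝ := y * (τ - if y < 0 then 1 else 0)

/-- The standard asymmetric Laplace density. -/
def aldDensity (τ y : ℝ) : ℝ := τ * (1 - τ) * Real.exp (-checkLoss τ y)

/-- The upper incomplete gamma function `Γ(t, k) = ∫_k^∞ x^(t-1) e^(-x) dx`. -/
def upperGamma (t k : ℝ) : ℝ := ∫ x in Ioi k, x ^ (t - 1) * Real.exp (-x)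

/-- The standard asymmetric connected double truncated gamma density with shape `a`. -/
def acdtgDensity (a τ y : ℝ) : ℝ :=
  τ * (1 - τ) / upperGamma (a + 1) a * (a + checkLoss τ y) ^ a *
    Real.exp (-(a + checkLoss τ y))

/-- The standard connected normal-Laplace density: half-normal on the left of `0`,
exponential with scale `b` on the right. -/
def cnlDensity (τ b y : ℝ) : ℝ :=
  if y ≤ 0 then 2 * τ / √(2 * Real.pi) * Real.exp (-(y ^ 2 / 2))
  else (1 - τ) / b * Real.exp (-(y / b))

/-- The standard asymmetric normal density. -/
def asymNormalDensity (φ y : ℝ) : ℝ :=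
  2 / √Real.pi * (√(φ * (1 - φ)) / (√φ + √(1 - φ))) *
    Real.exp (-((if 0 ≤ y then φ else 1 - φ) * y ^ 2))

/-- The list of admissible error densities, with location `0` and scale `1`. -/
inductive IsStandardErrorDensity : (ℝ → ℝ) → Prop
  | asymmetricLaplace (τ : ℝ) (h0 : 0 < τ) (h1 : τ < 1) :
      IsStandardErrorDensity (aldDensity τ)
  | connectedGamma (a τ : ℝ) (ha : 0 ≤ a) (h0 : 0 < τ) (h1 : τ < 1) :
      IsStandardErrorDensity (acdtgDensity a τ)
  | connectedNormalLaplace (τ b : ℝ) (h0 : 0 < τ) (h1 : τ < 1) (hb : 0 < b)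
      (hcont : (1 - τ) / b = 2 * τ / √(2 * Real.pi)) :
      IsStandardErrorDensity (cnlDensity τ b)
  | cauchy : IsStandardErrorDensity (ProbabilityTheory.cauchyPDFReal 0 1)
  | asymmetricNormal (φ : ℝ) (h0 : 0 < φ) (h1 : φ < 1) :
      IsStandardErrorDensity (asymNormalDensity φ)

/-- The member `(1/σ) f((y - η)/σ)` of the location-scale family generated by `f`. -/
def locScale (f : ℝ → ℝ) (η σ y : ℝ) : ℝ := 1 / σ * f ((y - η) / σ)

/-! ### The regression model and its minimax risk -/

/-- The cube `[0,1]^d`. -/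
def cube (d : ℕ) : Set (Fin d → ℝ) := Icc 0 1

/-- The law of the covariate: density `h` on the cube. -/
def covariateLaw {d : ℕ} (h : (Fin d → ℝ) → ℝ) : Measure (Fin d → ℝ) :=
  (volume.restrict (cube d)).withDensity fun x => ENNReal.ofReal (h x)

/-- The law of the error: Lebesgue density `f`. -/
def errorLaw (f : ℝ → ℝ) : Measure ℝ := volume.withDensity fun y => ENNReal.ofReal (f y)

/-- The law of `(X, Y)`, where `Y = μ(X) + σ(X) ε` with `X` and `ε` independent. -/
def observationLaw {d : ℕ} (f : ℝ → ℝ) (μ σ h : (Fin d → ℝ) → ℝ) :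
    Measure ((Fin d → ℝ) × ℝ) :=
  ((covariateLaw h).prod (errorLaw f)).map fun z => (z.1, μ z.1 + σ z.1 * z.2)

/-- The law of `n` independent observations. -/
def sampleLaw {d : ℕ} (n : ℕ) (f : ℝ → ℝ) (μ σ h : (Fin d → ℝ) → ℝ) :
    Measure (Fin n → (Fin d → ℝ) × ℝ) :=
  Measure.pi fun _ => observationLaw f μ σ h

/-- The risk `𝔼 ‖μ - μ̂‖²_{2,h}` of an estimator `μ̂`, a function of the sample and of the
point `x`. -/
def risk {d n : ℕ} (f : ℝ → ℝ) (μ σ h : (Fin d → ℝ) → ℝ)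
    (est : (Fin n → (Fin d → ℝ) × ℝ) → (Fin d → ℝ) → ℝ) : ℝ≥0∞ :=
  ∫⁻ D, ∫⁻ x, ENNReal.ofReal ((μ x - est D x) ^ 2) ∂(covariateLaw h) ∂(sampleLaw n f μ σ h)

/-- The minimax risk: infimum over all (jointly measurable) estimators of the worst-case risk
over regression functions in `U`, scale functions in `S` and covariate densities in `H`. -/
def minimaxRisk {d : ℕ} (n : ℕ) (f : ℝ → ℝ) (U S H : Set ((Fin d → ℝ) → ℝ)) : ℝ≥0∞ :=
  ⨅ (est : (Fin n → (Fin d → ℝ) × ℝ) → (Fin d → ℝ) → ℝ)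
    (_ : Measurable (Function.uncurry est)),
    ⨆ (μ ∈ U) (σ ∈ S) (h ∈ H), risk f μ σ h est

/-! ### The function classes -/

/-- Probability densities on the cube with values in `[1/K, K]`. -/
def densityClass (d : ℕ) (K : ℝ) : Set ((Fin d → ℝ) → ℝ) :=
  {h | Measurable h ∧ (∀ x ∈ cube d, 1 / K ≤ h x ∧ h x ≤ K) ∧ ∫ x in cube d, h x = 1}

/-- The log-linear scale functions `exp(∑ c_i x_i)` with `max |c_i| ≤ C`. -/
def scaleClass (d : ℕ) (C : ℝ) : Set ((Fin d → ℝ) → ℝ) :=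
  {σ | ∃ c : Fin d → ℝ, (∀ i, |c i| ≤ C) ∧ σ = fun x => Real.exp (∑ i, c i * x i)}

/-- The Hölder class: `s` times continuously differentiable functions on `ℝ` whose `s`-th
derivative is `γ`-Hölder with constant `L` and whose `k`-th derivative is bounded in absolute
value by `B k`, for all `k ≤ s`. -/
def holderClass (s : ℕ) (γ L : ℝ) (B : ℕ → ℝ) : Set (ℝ → ℝ) :=
  {g | ContDiff ℝ s g ∧
    (∀ z₁ z₂, |iteratedDeriv s g z₁ - iteratedDeriv s g z₂| ≤ L * |z₁ - z₂| ^ γ) ∧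
    ∀ k ≤ s, ∀ z, |iteratedDeriv k g z| ≤ B k}

/-- The multiple index class: sums of `p` ridge functions `g_i(β_i^T x)` with distinct unit
directions `β_i` and non-constant profiles `g_i` in the Hölder class. -/
def multipleIndexClass (d p s : ℕ) (γ L : ℝ) (B : ℕ → ℝ) : Set ((Fin d → ℝ) → ℝ) :=
  {μ | ∃ (g : Fin p → ℝ → ℝ) (β : Fin p → EuclideanSpace ℝ (Fin d)),
    (∀ i, g i ∈ holderClass s γ L B ∧ ∃ z₁ z₂, g i z₁ ≠ g i z₂) ∧
    (∀ i, ‖β i‖ = 1) ∧ Function.Injective β ∧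
    μ = fun x => ∑ i, g i (∑ j, β i j * x j)}

end LocationScale

end

/-
The model enters only through the Hellinger distance. Each error density is smooth or Laplace-like,
so its location-scale family is locally Lipschitz in the Hellinger distance. Conversely, every
member gives the half-line to the left of its location the same mass, so that two members have a
Hellinger distance at least of the order of the difference of their locations. Hence the Hellinger
distance of two regression models dominates the `L²` distance of their regression functions, and is
dominated by the sum of the `L²` distances of the regression and of the scale functions.

Upper bound: the values and derivatives of a function of smoothness `α` on a grid of mesh `δ`,
rounded at the precision of the Taylor expansion, change by boundedly many units from one point to
the next, so that `exp (A / δ)` codes determine the model up to `δ ^ α`. Tests based on a bounded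
version of the square root of the likelihood ratio select a member of the resulting net whose
error exceeds `δ ^ (2 α)` only with probability `exp (A / δ - c n δ ^ (2 α))`. Taking
`δ = n ^ (-1 / (2 α + 1))` up to constants balances the two terms.

Lower bound: adding or omitting `m` disjoint bumps of width `1 / m` and height of order `m ^ (-α)`
in a profile of the first direction gives a hypercube of models. With `m` of the order of
`n ^ (1 / (2 α + 1))` neighbours cannot be told apart by `n` observations, and Assouad's lemma
gives a risk of the order of `m ^ (-2 α)`.
-/

noncomputable section

namespace LocationScale

section Product

theorem lintegral_pi_prod_eq_prod {n : ℕ} {X : Fin n → Type*} [∀ i, MeasurableSpace (X i)]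
    {κ : ∀ i, Measure (X i)} [∀ i, SigmaFinite (κ i)] {F : ∀ i, X i → ℝ≥0∞}
    (hF : ∀ i, Measurable (F i)) :
    ∫⁻ x, ∏ i, F i (x i) ∂(Measure.pi κ) = ∏ i, ∫⁻ x, F i x ∂(κ i) := by
  induction n with
  | zero => simp
  | succ n ih =>
    rw [← (measurePreserving_piFinSuccAbove κ 0).symm.lintegral_comp]
    · simp only [MeasurableEquiv.piFinSuccAbove_symm_apply, Fin.insertNthEquiv,
        Fin.prod_univ_succ, Fin.insertNth_zero, Equiv.coe_fn_mk, Fin.cons_zero, Fin.cons_succ]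
      rw [← ih fun i => hF i.succ, ← lintegral_prod_mul (hF 0).aemeasurable
        (Finset.measurable_prod _ fun i _ =>
          (hF i.succ).comp (measurable_pi_apply i)).aemeasurable]
      rfl
    · exact Finset.measurable_prod _ fun i _ => (hF i).comp (measurable_pi_apply i)

theorem pi_withDensity_eq_withDensity_prod {n : ℕ} {X : Fin n → Type*}
    [∀ i, MeasurableSpace (X i)] {κ : ∀ i, Measure (X i)} [∀ i, SigmaFinite (κ i)]
    {p : ∀ i, X i → ℝ≥0∞} (hp : ∀ i, Measurable (p i))
    [∀ i, SigmaFinite ((κ i).withDensity (p i))] :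
    Measure.pi (fun i => (κ i).withDensity (p i)) =
      (Measure.pi κ).withDensity fun x => ∏ i, p i (x i) := by
  refine Measure.pi_eq fun s hs => ?_
  have indicator_prod : (univ.pi s).indicator (fun x => ∏ i, p i (x i)) =
      fun x => ∏ i, (s i).indicator (p i) (x i) := by
    ext x
    by_cases hx : x ∈ univ.pi s
    · rw [indicator_of_mem hx]
      exact Finset.prod_congr rfl fun i _ => (indicator_of_mem (hx i (mem_univ i)) _).symm
    · obtain ⟨i, hi⟩ : ∃ i, x i ∉ s i := by simpa only [mem_univ_pi, not_forall] using hx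
      rw [indicator_of_notMem hx,
        Finset.prod_eq_zero (Finset.mem_univ i) (indicator_of_notMem hi _)]
  rw [withDensity_apply _ (MeasurableSet.univ_pi hs),
    ← lintegral_indicator (MeasurableSet.univ_pi hs), indicator_prod,
    lintegral_pi_prod_eq_prod fun i => (hp i).indicator (hs i)]
  exact Finset.prod_congr rfl fun i _ => by
    rw [lintegral_indicator (hs i), withDensity_apply _ (hs i)]

end Product

section Affinity

variable {X : Type*} [MeasurableSpace X] {κ : Measure X}

/-- The Hellinger affinity `∫ √(p q)` of two densities with respect to `κ`. It measures how hard
it is to tell the two laws apart, and it multiplies over independent samples. -/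
def hellingerAffinity (κ : Measure X) (p q : X → ℝ≥0∞) : ℝ≥0∞ :=
  ∫⁻ x, p x ^ (1 / 2 : ℝ) * q x ^ (1 / 2 : ℝ) ∂κ

theorem hellingerAffinity_pi {n : ℕ} [SigmaFinite κ] {p q : X → ℝ≥0∞} (hp : Measurable p)
    (hq : Measurable q) :
    hellingerAffinity (Measure.pi fun _ : Fin n => κ) (fun x => ∏ i, p (x i))
      (fun x => ∏ i, q (x i)) = hellingerAffinity κ p q ^ n := by
  have prod_eq : ∀ x : Fin n → X, (∏ i, p (x i)) ^ (1 / 2 : ℝ) * (∏ i, q (x i)) ^ (1 / 2 : ℝ) =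
      ∏ i, p (x i) ^ (1 / 2 : ℝ) * q (x i) ^ (1 / 2 : ℝ) := fun x => by
    rw [Finset.prod_mul_distrib, ENNReal.prod_rpow_of_nonneg (by norm_num),
      ENNReal.prod_rpow_of_nonneg (by norm_num)]
  simp_rw [hellingerAffinity, prod_eq]
  rw [lintegral_pi_prod_eq_prod (F := fun _ x => p x ^ (1 / 2 : ℝ) * q x ^ (1 / 2 : ℝ))
    fun _ => by fun_prop]
  simp

theorem lintegral_sqrt_mul_sqrt_le {u v : X → ℝ≥0∞} (hu : AEMeasurable u κ)
    (hv : AEMeasurable v κ) (hv1 : ∫⁻ x, v x ∂κ = 1) :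
    ∫⁻ x, u x ^ (1 / 2 : ℝ) * v x ^ (1 / 2 : ℝ) ∂κ ≤ (∫⁻ x, u x ∂κ) ^ (1 / 2 : ℝ) := by
  simpa [hv1] using ENNReal.lintegral_mul_norm_pow_le hu hv (p := 1 / 2) (q := 1 / 2)
    (by norm_num) (by norm_num) (by norm_num)

/-- Le Cam's two-point inequality: if two losses add up to at least `Δ`, their expectations under
two laws cannot both be small unless the affinity of the laws is small. -/
theorem mul_hellingerAffinity_sq_le {p q a b : X → ℝ≥0∞} (hp : Measurable p) (hq : Measurable q)
    (ha : Measurable a) (hb : Measurable b) [IsProbabilityMeasure (κ.withDensity p)]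
    [IsProbabilityMeasure (κ.withDensity q)] {Δ : ℝ≥0∞} (h : ∀ x, Δ ≤ a x + b x) :
    Δ * hellingerAffinity κ p q ^ 2 ≤
      2 * (∫⁻ x, a x ∂(κ.withDensity p) + ∫⁻ x, b x ∂(κ.withDensity q)) := by
  have lintegral_eq_one (r : X → ℝ≥0∞) [IsProbabilityMeasure (κ.withDensity r)] :
      ∫⁻ x, r x ∂κ = 1 := by
    have h := measure_univ (μ := κ.withDensity r)
    rwa [withDensity_apply _ .univ, setLIntegral_univ] at h
  set A := ∫⁻ x, p x * a x ∂κ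
  set B := ∫⁻ x, q x * b x ∂κ
  have sqrt_bound : Δ ^ (1 / 2 : ℝ) * hellingerAffinity κ p q ≤
      A ^ (1 / 2 : ℝ) + B ^ (1 / 2 : ℝ) := by
    calc Δ ^ (1 / 2 : ℝ) * hellingerAffinity κ p q
        = ∫⁻ x, Δ ^ (1 / 2 : ℝ) * (p x ^ (1 / 2 : ℝ) * q x ^ (1 / 2 : ℝ)) ∂κ :=
          (lintegral_const_mul _ (by fun_prop)).symm
      _ ≤ ∫⁻ x, ((p x * a x) ^ (1 / 2 : ℝ) * q x ^ (1 / 2 : ℝ) +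
            (q x * b x) ^ (1 / 2 : ℝ) * p x ^ (1 / 2 : ℝ)) ∂κ := by
          refine lintegral_mono fun x => ?_
          have sqrt_Δ_le : Δ ^ (1 / 2 : ℝ) ≤ a x ^ (1 / 2 : ℝ) + b x ^ (1 / 2 : ℝ) :=
            (ENNReal.rpow_le_rpow (h x) (by norm_num)).trans
              (ENNReal.rpow_add_le_add_rpow _ _ (by norm_num) (by norm_num))
          refine (mul_le_mul_left sqrt_Δ_le _).trans_eq ?_
          rw [ENNReal.mul_rpow_of_nonneg _ _ (by norm_num),
            ENNReal.mul_rpow_of_nonneg _ _ (by norm_num)]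
          ring
      _ ≤ A ^ (1 / 2 : ℝ) + B ^ (1 / 2 : ℝ) := by
          rw [lintegral_add_left (by fun_prop)]
          gcongr
          · exact lintegral_sqrt_mul_sqrt_le (by fun_prop) (by fun_prop) (lintegral_eq_one q)
          · exact lintegral_sqrt_mul_sqrt_le (by fun_prop) (by fun_prop) (lintegral_eq_one p)
  have sq_sqrt (t : ℝ≥0∞) : (t ^ (1 / 2 : ℝ)) ^ (2 : ℝ) = t := by
    rw [← ENNReal.rpow_mul]
    norm_num
  rw [lintegral_withDensity_eq_lintegral_mul _ hp ha,
    lintegral_withDensity_eq_lintegral_mul _ hq hb]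
  calc Δ * hellingerAffinity κ p q ^ 2
      = (Δ ^ (1 / 2 : ℝ) * hellingerAffinity κ p q) ^ (2 : ℝ) := by
        rw [ENNReal.mul_rpow_of_nonneg _ _ zero_le_two, sq_sqrt, ENNReal.rpow_two]
    _ ≤ (A ^ (1 / 2 : ℝ) + B ^ (1 / 2 : ℝ)) ^ (2 : ℝ) := by gcongr
    _ ≤ 2 * (A + B) := by
        have h := ENNReal.rpow_add_le_mul_rpow_add_rpow (A ^ (1 / 2 : ℝ)) (B ^ (1 / 2 : ℝ))
          one_le_two
        rwa [sq_sqrt, sq_sqrt, show (2 : ℝ) - 1 = 1 by norm_num, ENNReal.rpow_one] at h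

end Affinity

section Hellinger

variable {Y : Type*} [MeasurableSpace Y] {ν : Measure Y}

/-- A real-valued probability density with respect to `ν`. The Bochner integral of a
non-integrable function is `0`, so the normalization forces integrability. -/
structure IsProbDensity (ν : Measure Y) (p : Y → ℝ) : Prop where
  nonneg : ∀ y, 0 ≤ p y
  integral_eq_one : ∫ y, p y ∂ν = 1

/-- The squared Hellinger distance `∫ (√p - √q)²` of two densities with respect to `ν`, the
distance in which regression models are compared. -/
def hellingerSq (ν : Measure Y) (p q : Y → ℝ) : ℝ := ∫ y, (√(p y) - √(q y)) ^ 2 ∂ν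

variable {p q : Y → ℝ}

theorem hellingerSq_nonneg : 0 ≤ hellingerSq ν p q :=
  integral_nonneg fun _ => sq_nonneg _

namespace IsProbDensity

theorem integrable (hp : IsProbDensity ν p) : Integrable p ν :=
  integrable_of_integral_eq_one hp.integral_eq_one

theorem aestronglyMeasurable_sqrt (hp : IsProbDensity ν p) :
    AEStronglyMeasurable (fun y => √(p y)) ν :=
  Real.continuous_sqrt.comp_aestronglyMeasurable hp.integrable.1

theorem memLp_sqrt (hp : IsProbDensity ν p) : MemLp (fun y => √(p y)) 2 ν := by
  rw [memLp_two_iff_integrable_sq hp.aestronglyMeasurable_sqrt]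
  simpa only [Real.sq_sqrt (hp.nonneg _)] using hp.integrable

theorem integrable_sqrt_sub_sq (hp : IsProbDensity ν p) (hq : IsProbDensity ν q) :
    Integrable (fun y => (√(p y) - √(q y)) ^ 2) ν :=
  (hp.memLp_sqrt.sub hq.memLp_sqrt).integrable_sq

theorem lintegral_eq_one (hp : IsProbDensity ν p) : ∫⁻ y, ENNReal.ofReal (p y) ∂ν = 1 := by
  rw [← ofReal_integral_eq_lintegral_ofReal hp.integrable (ae_of_all _ hp.nonneg),
    hp.integral_eq_one, ENNReal.ofReal_one]

theorem hellingerAffinity_eq (hp : IsProbDensity ν p) (hq : IsProbDensity ν q) :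
    hellingerAffinity ν (fun y => ENNReal.ofReal (p y)) (fun y => ENNReal.ofReal (q y)) =
      ENNReal.ofReal (1 - hellingerSq ν p q / 2) := by
  have hmul : Integrable (fun y => √(p y) * √(q y)) ν := hp.memLp_sqrt.integrable_mul hq.memLp_sqrt
  have polarization : hellingerSq ν p q = 2 - 2 * ∫ y, √(p y) * √(q y) ∂ν := by
    have expand : ∀ y, (√(p y) - √(q y)) ^ 2 = p y + q y - 2 * (√(p y) * √(q y)) := fun y => by
      rw [sub_sq, Real.sq_sqrt (hp.nonneg y), Real.sq_sqrt (hq.nonneg y)]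
      ring
    have hsum : Integrable (fun y => p y + q y) ν := hp.integrable.add hq.integrable
    simp_rw [hellingerSq, expand]
    rw [integral_sub hsum (hmul.const_mul 2),
      integral_add hp.integrable hq.integrable, integral_const_mul, hp.integral_eq_one,
      hq.integral_eq_one, one_add_one_eq_two]
  have sqrt_mul_eq : 1 - hellingerSq ν p q / 2 = ∫ y, √(p y) * √(q y) ∂ν := by
    linarith
  rw [sqrt_mul_eq, ofReal_integral_eq_lintegral_ofReal hmul (ae_of_all _ fun y => by positivity)]
  refine lintegral_congr fun y => ?_
  rw [ENNReal.ofReal_mul (Real.sqrt_nonneg _), Real.sqrt_eq_rpow, Real.sqrt_eq_rpow,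
    ENNReal.ofReal_rpow_of_nonneg (hp.nonneg y) (by norm_num),
    ENNReal.ofReal_rpow_of_nonneg (hq.nonneg y) (by norm_num)]

theorem hellingerSq_le_two (hp : IsProbDensity ν p) (hq : IsProbDensity ν q) :
    hellingerSq ν p q ≤ 2 := by
  calc hellingerSq ν p q ≤ ∫ y, (p y + q y) ∂ν := by
        refine integral_mono (hp.integrable_sqrt_sub_sq hq) (hp.integrable.add hq.integrable)
          fun y => ?_
        have := mul_nonneg (Real.sqrt_nonneg (p y)) (Real.sqrt_nonneg (q y))
        simp only [sub_sq, Real.sq_sqrt (hp.nonneg y), Real.sq_sqrt (hq.nonneg y)]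
        linarith
    _ = 2 := by
        rw [integral_add hp.integrable hq.integrable, hp.integral_eq_one, hq.integral_eq_one,
          one_add_one_eq_two]

theorem sq_integral_abs_sub_le (hp : IsProbDensity ν p) (hq : IsProbDensity ν q) :
    (∫ y, |p y - q y| ∂ν) ^ 2 ≤ 4 * hellingerSq ν p q := by
  have factor : ∀ y, |p y - q y| = |√(p y) - √(q y)| * (√(p y) + √(q y)) := fun y => by
    rw [← abs_of_nonneg (add_nonneg (Real.sqrt_nonneg (p y)) (Real.sqrt_nonneg (q y))), ← abs_mul,
      mul_comm, ← sq_sub_sq, Real.sq_sqrt (hp.nonneg y), Real.sq_sqrt (hq.nonneg y)]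
  have sum_sq_le : ∫ y, (√(p y) + √(q y)) ^ 2 ∂ν ≤ 4 := by
    calc ∫ y, (√(p y) + √(q y)) ^ 2 ∂ν ≤ ∫ y, 2 * (p y + q y) ∂ν :=
          integral_mono (hp.memLp_sqrt.add hq.memLp_sqrt).integrable_sq
            ((hp.integrable.add hq.integrable).const_mul 2) fun y => by
              simpa only [Real.sq_sqrt (hp.nonneg y), Real.sq_sqrt (hq.nonneg y)] using
                add_sq_le (a := √(p y)) (b := √(q y))
      _ = 4 := by
          rw [integral_const_mul, integral_add hp.integrable hq.integrable, hp.integral_eq_one,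
            hq.integral_eq_one]
          norm_num
  have cauchy_schwarz := integral_mul_le_Lp_mul_Lq_of_nonneg (μ := ν)
    (f := fun y => |√(p y) - √(q y)|) (g := fun y => √(p y) + √(q y)) Real.HolderConjugate.two_two
    (ae_of_all _ fun y => abs_nonneg _) (ae_of_all _ fun y => by positivity)
    (by simpa using (hp.memLp_sqrt.sub hq.memLp_sqrt).norm)
    (by rw [ENNReal.ofReal_ofNat]; exact hp.memLp_sqrt.add hq.memLp_sqrt)
  simp only [Real.rpow_two, sq_abs, ← factor, ← Real.sqrt_eq_rpow] at cauchy_schwarz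
  calc (∫ y, |p y - q y| ∂ν) ^ 2
      ≤ (√(hellingerSq ν p q) * √(∫ y, (√(p y) + √(q y)) ^ 2 ∂ν)) ^ 2 := by
        gcongr
        exact cauchy_schwarz
    _ = (∫ y, (√(p y) + √(q y)) ^ 2 ∂ν) * hellingerSq ν p q := by
        rw [mul_pow, Real.sq_sqrt (integral_nonneg fun _ => sq_nonneg _),
          Real.sq_sqrt hellingerSq_nonneg, mul_comm]
    _ ≤ 4 * hellingerSq ν p q := by
        gcongr
        exact hellingerSq_nonneg

end IsProbDensity

end Hellinger

section TestRatio

/-- A bounded surrogate of the likelihood ratio `√(q / p)`, increasing in `q / p` with values in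
`[1/3, 3]`. Boundedness makes the resulting tests robust against misspecification. -/
def testRatio (p q : ℝ) : ℝ := (√p + 3 * √q) / (3 * √p + √q)

theorem testRatio_nonneg (p q : ℝ) : 0 ≤ testRatio p q := by
  unfold testRatio
  positivity

theorem testRatio_le_three (p q : ℝ) : testRatio p q ≤ 3 :=
  div_le_of_le_mul₀ (by positivity) zero_le_three
    (by linarith [Real.sqrt_nonneg p, Real.sqrt_nonneg q])

theorem testRatio_mul_testRatio {p q : ℝ} (hp : 0 < p) (hq : 0 < q) :
    testRatio p q * testRatio q p = 1 := by
  have := Real.sqrt_pos.2 hp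
  have := Real.sqrt_pos.2 hq
  unfold testRatio
  field_simp
  ring

theorem div_mul_sq_le {a b : ℝ} (ha : 0 ≤ a) (hb : 0 ≤ b) (c : ℝ) :
    (a + 3 * b) / (3 * a + b) * c ^ 2 ≤
      c ^ 2 - (a - b) ^ 2 / 8 + (b ^ 2 - a ^ 2) / 4 + 6 * (c - a) ^ 2 := by
  rcases (by positivity : 0 ≤ 3 * a + b).eq_or_lt with h | hpos
  · have ha0 : a = 0 := by linarith
    have hb0 : b = 0 := by linarith
    rw [ha0, hb0]
    norm_num
    positivity
  have hne : 3 * a + b ≠ 0 := hpos.ne'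
  obtain ⟨w, hw⟩ : ∃ w, w = 2 * (b - a) / (3 * a + b) := ⟨_, rfl⟩
  have w_mul : w * (3 * a + b) = 2 * (b - a) := by rw [hw, div_mul_cancel₀ _ hne]
  have ratio_eq : (a + 3 * b) / (3 * a + b) = 1 + w := by
    rw [div_eq_iff hne]
    linarith
  have w_le : w ≤ 2 := by
    rw [hw, div_le_iff₀ hpos]
    linarith
  have sq_mul_w_le : a ^ 2 * w ≤ (b ^ 2 - a ^ 2) / 4 - (b - a) ^ 2 / 4 := by
    have : 0 ≤ a * w ^ 2 * (3 * a + b) := by positivity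
    linear_combination this / 8 + (a * w / 8 + a / 4) * w_mul
  have mul_w_sq_le : (a * w) ^ 2 ≤ (b - a) ^ 2 / 2 := by
    have : (a * w) ^ 2 = (2 * a / (3 * a + b)) ^ 2 * (b - a) ^ 2 := by
      rw [hw]
      field_simp
    have ratio_le : 2 * a / (3 * a + b) ≤ 2 / 3 := by
      rw [div_le_iff₀ hpos]
      linarith
    have ratio_sq_le : (2 * a / (3 * a + b)) ^ 2 ≤ (2 / 3) ^ 2 := by gcongr
    nlinarith [sq_nonneg (b - a)]
  have young : 2 * (c - a) * (a * w) ≤ 4 * (c - a) ^ 2 + (a * w) ^ 2 / 4 := by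
    linarith [sq_nonneg (2 * (c - a) - a * w / 2)]
  have remainder_le : (c - a) ^ 2 * w ≤ (c - a) ^ 2 * 2 := by gcongr
  calc (a + 3 * b) / (3 * a + b) * c ^ 2
      = c ^ 2 + a ^ 2 * w + 2 * (c - a) * (a * w) + (c - a) ^ 2 * w := by
        rw [ratio_eq]
        ring
    _ ≤ _ := by linarith

theorem testRatio_mul_le {p q r : ℝ} (hp : 0 ≤ p) (hq : 0 ≤ q) (hr : 0 ≤ r) :
    testRatio p q * r ≤ r - (√p - √q) ^ 2 / 8 + (q - p) / 4 + 6 * (√r - √p) ^ 2 := by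
  simpa only [testRatio, Real.sq_sqrt hp, Real.sq_sqrt hq, Real.sq_sqrt hr] using
    div_mul_sq_le (Real.sqrt_nonneg p) (Real.sqrt_nonneg q) √r

theorem IsProbDensity.lintegral_testRatio_le {Y : Type*} [MeasurableSpace Y] {ν : Measure Y}
    {p q r : Y → ℝ} (hp : IsProbDensity ν p) (hq : IsProbDensity ν q) (hr : IsProbDensity ν r) :
    ∫⁻ y, ENNReal.ofReal (testRatio (p y) (q y)) * ENNReal.ofReal (r y) ∂ν ≤
      ENNReal.ofReal (1 - hellingerSq ν p q / 8 + 6 * hellingerSq ν r p) := by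
  have hpq := (hp.integrable_sqrt_sub_sq hq).div_const 8
  have hrp := (hr.integrable_sqrt_sub_sq hp).const_mul 6
  have hqp : Integrable (fun y => (q y - p y) / 4) ν :=
    (hq.integrable.sub hp.integrable).div_const 4
  have hdiff : Integrable (fun y => r y - (√(p y) - √(q y)) ^ 2 / 8) ν := hr.integrable.sub hpq
  have hsum : Integrable (fun y => r y - (√(p y) - √(q y)) ^ 2 / 8 + (q y - p y) / 4) ν :=
    hdiff.add hqp
  have hmeas : AEStronglyMeasurable (fun y => testRatio (p y) (q y)) ν := by
    have := hp.aestronglyMeasurable_sqrt.aemeasurable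
    have := hq.aestronglyMeasurable_sqrt.aemeasurable
    unfold testRatio
    exact AEMeasurable.aestronglyMeasurable (by fun_prop)
  have htest : Integrable (fun y => testRatio (p y) (q y) * r y) ν := by
    refine hr.integrable.bdd_mul (c := 3) hmeas (ae_of_all _ fun y => ?_)
    rw [Real.norm_of_nonneg (testRatio_nonneg _ _)]
    exact testRatio_le_three _ _
  simp_rw [← ENNReal.ofReal_mul (testRatio_nonneg _ _)]
  rw [← ofReal_integral_eq_lintegral_ofReal htest
    (ae_of_all _ fun y => mul_nonneg (testRatio_nonneg _ _) (hr.nonneg y))]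
  refine ENNReal.ofReal_le_ofReal ?_
  calc ∫ y, testRatio (p y) (q y) * r y ∂ν
      ≤ ∫ y, (r y - (√(p y) - √(q y)) ^ 2 / 8 + (q y - p y) / 4 + 6 * (√(r y) - √(p y)) ^ 2) ∂ν :=
        integral_mono htest (hsum.add hrp) fun y =>
          testRatio_mul_le (hp.nonneg y) (hq.nonneg y) (hr.nonneg y)
    _ = 1 - hellingerSq ν p q / 8 + 6 * hellingerSq ν r p := by
        rw [integral_add hsum hrp, integral_add hdiff hqp,
          integral_sub hr.integrable hpq, integral_div, integral_div,
          integral_sub hq.integrable hp.integrable, integral_const_mul, hp.integral_eq_one,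
          hq.integral_eq_one, hr.integral_eq_one, sub_self, zero_div, add_zero]
        rfl

end TestRatio

section LocScale

theorem locScale_add_mul (f : ℝ → ℝ) (m : ℝ) {σ : ℝ} (hσ : σ ≠ 0) (z : ℝ) :
    locScale f m σ (m + σ * z) = 1 / σ * f z := by
  rw [locScale, add_sub_cancel_left, mul_div_cancel_left₀ z hσ]

theorem locScale_locScale {f : ℝ → ℝ} {η₀ σ₀ η σ : ℝ} (hσ₀ : σ₀ ≠ 0) (hσ : σ ≠ 0) :
    locScale (locScale f η₀ σ₀) η σ = locScale f (η + σ * η₀) (σ * σ₀) := by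
  ext y
  have arg_eq : ((y - η) / σ - η₀) / σ₀ = (y - (η + σ * η₀)) / (σ * σ₀) := by
    field_simp
    ring
  simp only [locScale, arg_eq, ← mul_assoc, one_div_mul_one_div]

theorem integral_mul_locScale (f F : ℝ → ℝ) (m : ℝ) {σ : ℝ} (hσ : 0 < σ) :
    ∫ y, F y * locScale f m σ y = ∫ z, F (m + σ * z) * f z := by
  calc ∫ y, F y * locScale f m σ y = ∫ y, F (m + y) * locScale f m σ (m + y) :=
        (integral_add_left_eq_self _ m).symm
    _ = σ * ∫ z, F (m + σ * z) * locScale f m σ (m + σ * z) := by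
        rw [Measure.integral_comp_mul_left (fun y => F (m + y) * locScale f m σ (m + y)) σ,
          abs_of_pos (inv_pos.2 hσ), smul_eq_mul, mul_inv_cancel_left₀ hσ.ne']
    _ = ∫ z, F (m + σ * z) * f z := by
        rw [← integral_const_mul]
        refine integral_congr_ae (ae_of_all _ fun z => ?_)
        simp only [locScale_add_mul f m hσ.ne']
        field_simp

theorem lintegral_mul_locScale (f : ℝ → ℝ) (F : ℝ → ℝ≥0∞) (m : ℝ) {σ : ℝ} (hσ : 0 < σ) :
    ∫⁻ y, F y * ENNReal.ofReal (locScale f m σ y) =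
      ∫⁻ z, F (m + σ * z) * ENNReal.ofReal (f z) := by
  have image_eq : (fun z => m + σ * z) '' univ = univ :=
    image_univ_of_surjective fun y => ⟨(y - m) / σ, by field_simp; ring⟩
  have change_of_variables := lintegral_image_eq_lintegral_abs_deriv_mul (s := univ)
    (f := fun z => m + σ * z) (f' := fun _ => σ) .univ
    (fun x _ => (((hasDerivAt_id x).const_mul σ).const_add m).hasDerivWithinAt.congr_deriv
      (mul_one σ))
    (fun x _ y _ hxy => by simpa [hσ.ne'] using hxy)
    (fun y => F y * ENNReal.ofReal (locScale f m σ y))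
  rw [image_eq, setLIntegral_univ, setLIntegral_univ] at change_of_variables
  rw [change_of_variables]
  refine lintegral_congr fun z => ?_
  rw [abs_of_pos hσ, locScale_add_mul f m hσ.ne', mul_left_comm, ← ENNReal.ofReal_mul hσ.le,
    ← mul_assoc, mul_one_div_cancel hσ.ne', one_mul]

theorem setIntegral_Iic_locScale (f : ℝ → ℝ) (m t : ℝ) {σ : ℝ} (hσ : 0 < σ) :
    ∫ y in Iic t, locScale f m σ y = ∫ z in Iic ((t - m) / σ), f z := by
  have mem_iff (z : ℝ) : m + σ * z ∈ Iic t ↔ z ∈ Iic ((t - m) / σ) := by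
    rw [mem_Iic, mem_Iic, le_div_iff₀ hσ, le_sub_iff_add_le', mul_comm z]
  rw [← integral_indicator measurableSet_Iic, ← integral_indicator measurableSet_Iic]
  simpa only [indicator_apply, Pi.one_apply, mem_iff, ite_mul, one_mul, zero_mul] using
    integral_mul_locScale f ((Iic t).indicator 1) m hσ

theorem IsProbDensity.locScale {f : ℝ → ℝ} (hf : IsProbDensity volume f) (m : ℝ) {σ : ℝ}
    (hσ : 0 < σ) : IsProbDensity volume (locScale f m σ) where
  nonneg _ := mul_nonneg (one_div_nonneg.2 hσ.le) (hf.nonneg _)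
  integral_eq_one := by
    simpa only [one_mul, hf.integral_eq_one] using integral_mul_locScale f (fun _ => 1) m hσ

theorem mul_abs_sub_le_abs_integral {f : ℝ → ℝ} {a b l : ℝ} (hf : IntervalIntegrable f volume a b)
    (hl : ∀ y ∈ uIcc a b, l ≤ f y) : l * |b - a| ≤ |∫ y in a..b, f y| := by
  wlog hab : a ≤ b generalizing a b
  · rw [abs_sub_comm, intervalIntegral.integral_symm, abs_neg]
    exact this hf.symm (uIcc_comm a b ▸ hl) (le_of_not_ge hab)
  rw [uIcc_of_le hab] at hl
  calc l * |b - a| = ∫ _ in a..b, l := by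
        rw [intervalIntegral.integral_const, abs_of_nonneg (sub_nonneg.2 hab), smul_eq_mul,
          mul_comm]
    _ ≤ ∫ y in a..b, f y := intervalIntegral.integral_mono_on hab (by simp) hf hl
    _ ≤ |∫ y in a..b, f y| := le_abs_self _

/-- The two densities give the half-line `(-∞, m]` masses that differ by the left-hand side. -/
theorem abs_integral_le_integral_abs_locScale_sub {f : ℝ → ℝ} (hf : IsProbDensity volume f)
    (m m' : ℝ) {σ σ' : ℝ} (hσ : 0 < σ) (hσ' : 0 < σ') :
    |∫ y in (0 : ℝ)..(m - m') / σ', f y| ≤ ∫ y, |locScale f m σ y - locScale f m' σ' y| := by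
  have hp := (hf.locScale m hσ).integrable
  have hq := (hf.locScale m' hσ').integrable
  have mass : ∫ y in Iic m, locScale f m σ y = ∫ z in Iic 0, f z := by
    rw [setIntegral_Iic_locScale f m m hσ, sub_self, zero_div]
  rw [← intervalIntegral.integral_Iic_sub_Iic hf.integrable.integrableOn
    hf.integrable.integrableOn, ← mass, ← setIntegral_Iic_locScale f m' m hσ', abs_sub_comm,
    ← integral_sub hp.integrableOn hq.integrableOn]
  exact abs_integral_le_integral_abs.trans
    (setIntegral_le_integral (hp.sub hq).abs (ae_of_all _ fun y => abs_nonneg _))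

end LocScale

section RegularDensity

/-- Error densities to which the minimax theory applies: they are bounded below on compact sets,
and their location-scale family is locally Lipschitz in the Hellinger distance. -/
structure RegularDensity (f : ℝ → ℝ) : Prop where
  measurable : Measurable f
  integral_eq_one : ∫ y, f y = 1
  lower : ∀ M : ℝ, ∃ l > 0, ∀ y, |y| ≤ M → l ≤ f y
  hellinger : ∀ M a b : ℝ, 0 < a → ∃ A > 0, ∀ m m' σ σ', |m| ≤ M → |m'| ≤ M →
    σ ∈ Icc a b → σ' ∈ Icc a b →
    hellingerSq volume (locScale f m σ) (locScale f m' σ') ≤ A * ((m - m') ^ 2 + (σ - σ') ^ 2)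

namespace RegularDensity

variable {f : ℝ → ℝ}

theorem pos (hf : RegularDensity f) (y : ℝ) : 0 < f y :=
  let ⟨_, hl, h⟩ := hf.lower |y|
  hl.trans_le (h y le_rfl)

theorem isProbDensity (hf : RegularDensity f) : IsProbDensity volume f :=
  ⟨fun y => (hf.pos y).le, hf.integral_eq_one⟩

theorem isProbDensity_locScale (hf : RegularDensity f) (m : ℝ) {σ : ℝ} (hσ : 0 < σ) :
    IsProbDensity volume (LocationScale.locScale f m σ) :=
  hf.isProbDensity.locScale m hσ

theorem locScale_pos (hf : RegularDensity f) (m : ℝ) {σ : ℝ} (hσ : 0 < σ) (y : ℝ) :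
    0 < LocationScale.locScale f m σ y :=
  mul_pos (one_div_pos.2 hσ) (hf.pos _)

theorem sq_sub_le_hellingerSq (hf : RegularDensity f) (M : ℝ) {a b : ℝ} (ha : 0 < a) (hb : 0 < b) :
    ∃ c > 0, ∀ m m' σ σ', |m| ≤ M → |m'| ≤ M → σ ∈ Icc a b → σ' ∈ Icc a b →
      c * (m - m') ^ 2 ≤
        hellingerSq volume (LocationScale.locScale f m σ) (LocationScale.locScale f m' σ') := by
  obtain ⟨l, hl, hlf⟩ := hf.lower (2 * M / a)
  refine ⟨l ^ 2 / (4 * b ^ 2), by positivity, fun m m' σ σ' hm hm' hσ hσ' => ?_⟩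
  have hσ0 : 0 < σ := ha.trans_le hσ.1
  have hσ0' : 0 < σ' := ha.trans_le hσ'.1
  set p := LocationScale.locScale f m σ
  set q := LocationScale.locScale f m' σ'
  set z := (m - m') / σ' with hz
  have abs_z : |z| = |m - m'| / σ' := by rw [hz, abs_div, abs_of_pos hσ0']
  have z_le : |z| ≤ 2 * M / a := by
    have : |m - m'| ≤ 2 * M := (abs_sub _ _).trans (by linarith)
    rw [abs_z]
    exact div_le_div₀ ((abs_nonneg _).trans this) this ha hσ'.1
  have mass_le : l * (|m - m'| / b) ≤ ∫ y, |p y - q y| := by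
    calc l * (|m - m'| / b) ≤ l * |z - 0| := by
          rw [sub_zero, abs_z]
          gcongr
          exact hσ'.2
      _ ≤ |∫ y in (0 : ℝ)..z, f y| := by
          refine mul_abs_sub_le_abs_integral hf.isProbDensity.integrable.intervalIntegrable
            fun y hy => hlf y (le_trans ?_ z_le)
          simpa using abs_sub_left_of_mem_uIcc hy
      _ ≤ ∫ y, |p y - q y| :=
          abs_integral_le_integral_abs_locScale_sub hf.isProbDensity m m' hσ0 hσ0'
  have mass_sq_le := pow_le_pow_left₀ (by positivity) mass_le 2
  have hellinger_ge := (hf.isProbDensity_locScale m hσ0).sq_integral_abs_sub_le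
    (hf.isProbDensity_locScale m' hσ0')
  calc l ^ 2 / (4 * b ^ 2) * (m - m') ^ 2 = (l * (|m - m'| / b)) ^ 2 / 4 := by
        rw [mul_pow, div_pow, sq_abs]
        field_simp
    _ ≤ hellingerSq volume p q := by linarith

protected theorem locScale (hf : RegularDensity f) (η₀ : ℝ) {σ₀ : ℝ} (hσ₀ : 0 < σ₀) :
    RegularDensity (locScale f η₀ σ₀) where
  measurable := by
    have := hf.measurable
    unfold LocationScale.locScale
    fun_prop
  integral_eq_one := (hf.isProbDensity_locScale η₀ hσ₀).integral_eq_one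
  lower M := by
    obtain ⟨l, hl, h⟩ := hf.lower ((M + |η₀|) / σ₀)
    refine ⟨1 / σ₀ * l, by positivity, fun y hy => ?_⟩
    refine mul_le_mul_of_nonneg_left (h _ ?_) (by positivity)
    rw [abs_div, abs_of_pos hσ₀]
    gcongr
    exact (abs_sub _ _).trans (by gcongr)
  hellinger M a b ha := by
    obtain ⟨A, hA, h⟩ := hf.hellinger (M + b * |η₀|) (a * σ₀) (b * σ₀) (by positivity)
    refine ⟨A * (2 + 2 * η₀ ^ 2 + σ₀ ^ 2), by positivity, fun m m' σ σ' hm hm' hσ hσ' => ?_⟩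
    have location_le : ∀ {m σ}, |m| ≤ M → σ ∈ Icc a b → |m + σ * η₀| ≤ M + b * |η₀| :=
      fun {m σ} hm hσ => (abs_add_le _ _).trans (by
        rw [abs_mul, abs_of_pos (ha.trans_le hσ.1)]
        gcongr
        exact hσ.2)
    have scale_mem : ∀ {σ}, σ ∈ Icc a b → σ * σ₀ ∈ Icc (a * σ₀) (b * σ₀) := fun hσ =>
      ⟨mul_le_mul_of_nonneg_right hσ.1 hσ₀.le, mul_le_mul_of_nonneg_right hσ.2 hσ₀.le⟩
    have location_sq_le : (m + σ * η₀ - (m' + σ' * η₀)) ^ 2 ≤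
        2 * ((m - m') ^ 2 + η₀ ^ 2 * (σ - σ') ^ 2) := by
      calc _ = ((m - m') + η₀ * (σ - σ')) ^ 2 := by ring
        _ ≤ _ := add_sq_le.trans_eq (by ring)
    rw [locScale_locScale hσ₀.ne' (ha.trans_le hσ.1).ne',
      locScale_locScale hσ₀.ne' (ha.trans_le hσ'.1).ne']
    refine (h _ _ _ _ (location_le hm hσ) (location_le hm' hσ') (scale_mem hσ)
      (scale_mem hσ')).trans ?_
    rw [mul_assoc, ← sub_mul, mul_pow]
    gcongr
    have : 0 ≤ η₀ ^ 2 * (m - m') ^ 2 := by positivity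
    have : 0 ≤ σ₀ ^ 2 * (m - m') ^ 2 := by positivity
    linarith [sq_nonneg (σ - σ')]

end RegularDensity

end RegularDensity

section Observation

variable {d : ℕ}

theorem measurableSet_cube (d : ℕ) : MeasurableSet (cube d) := measurableSet_Icc

theorem volume_cube (d : ℕ) : volume (cube d) = 1 := by
  simp [cube, Real.volume_Icc_pi]

theorem isProbabilityMeasure_covariateLaw {K : ℝ} (hK : 0 ≤ K) {h : (Fin d → ℝ) → ℝ}
    (hh : h ∈ densityClass d K) : IsProbabilityMeasure (covariateLaw h) := by
  obtain ⟨-, hbounds, hone⟩ := hh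
  have integrable_h : Integrable h (volume.restrict (cube d)) := integrable_of_integral_eq_one hone
  have hnonneg : 0 ≤ᵐ[volume.restrict (cube d)] h :=
    ae_restrict_of_forall_mem (measurableSet_cube d) fun x hx =>
      (one_div_nonneg.2 hK).trans (hbounds x hx).1
  refine ⟨?_⟩
  rw [covariateLaw, withDensity_apply _ .univ, setLIntegral_univ,
    ← ofReal_integral_eq_lintegral_ofReal integrable_h hnonneg, hone, ENNReal.ofReal_one]

/-- The conditional density of the response given the covariate, as a function of the pair. It is
the density of an observation with respect to `covariateLaw h × volume`. -/
def responseDensity {X : Type*} (f : ℝ → ℝ) (μ σ : X → ℝ) (z : X × ℝ) : ℝ≥0∞ :=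
  ENNReal.ofReal (locScale f (μ z.1) (σ z.1) z.2)

theorem measurable_responseDensity {X : Type*} [MeasurableSpace X] {f : ℝ → ℝ} {μ σ : X → ℝ}
    (hf : Measurable f) (hμ : Measurable μ) (hσ : Measurable σ) :
    Measurable (responseDensity f μ σ) := by
  unfold responseDensity locScale
  fun_prop

theorem observationLaw_eq_withDensity {f : ℝ → ℝ} (hf : Measurable f) {μ σ h : (Fin d → ℝ) → ℝ}
    (hμ : Measurable μ) (hσ : Measurable σ) (hσ0 : ∀ x, 0 < σ x) :
    observationLaw f μ σ h =
      ((covariateLaw h).prod volume).withDensity (responseDensity f μ σ) := by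
  have hmap : Measurable fun z : (Fin d → ℝ) × ℝ => (z.1, μ z.1 + σ z.1 * z.2) := by fun_prop
  have : SFinite (covariateLaw h) := by unfold covariateLaw; infer_instance
  have : SFinite (errorLaw f) := by unfold errorLaw; infer_instance
  refine Measure.ext_of_lintegral _ fun F hF => ?_
  rw [observationLaw, lintegral_map hF hmap,
    lintegral_prod (fun z => F (z.1, μ z.1 + σ z.1 * z.2)) (hF.comp hmap).aemeasurable,
    lintegral_withDensity_eq_lintegral_mul _ (measurable_responseDensity hf hμ hσ) hF,
    lintegral_prod _ ((measurable_responseDensity hf hμ hσ).mul hF).aemeasurable]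
  refine lintegral_congr fun x => ?_
  rw [errorLaw, lintegral_withDensity_eq_lintegral_mul _ hf.ennreal_ofReal (by fun_prop)]
  simpa only [Pi.mul_apply, responseDensity, mul_comm] using
    (lintegral_mul_locScale f (fun y => F (x, y)) (μ x) (hσ0 x)).symm

end Observation

section LogDensity

theorem abs_log_sub_log_le {A B c : ℝ} (hc : 0 < c) (hA : c ≤ A) (hB : c ≤ B) :
    |Real.log A - Real.log B| ≤ |A - B| / c := by
  wlog h : B ≤ A generalizing A B
  · rw [abs_sub_comm, abs_sub_comm A]
    exact this hB hA (le_of_not_ge h)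
  have hB0 := hc.trans_le hB
  have hA0 := hc.trans_le hA
  rw [abs_of_nonneg (sub_nonneg.2 (Real.log_le_log hB0 h)), abs_of_nonneg (sub_nonneg.2 h),
    ← Real.log_div hA0.ne' hB0.ne']
  refine (Real.log_le_sub_one_of_pos (div_pos hA0 hB0)).trans ?_
  rw [div_sub_one hB0.ne']
  exact div_le_div_of_nonneg_left (sub_nonneg.2 h) hc hB

theorem sq_sqrt_sub_sqrt_le {p q : ℝ} (hp : 0 < p) (hq : 0 < q) :
    (√p - √q) ^ 2 ≤ (Real.log p - Real.log q) ^ 2 * p + (Real.log p - Real.log q) ^ 2 * q := by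
  wlog h : q ≤ p generalizing p q
  · linarith [this hq hp (le_of_not_ge h)]
  have hsp := Real.sqrt_pos.2 hp
  have log_nonneg : 0 ≤ Real.log p - Real.log q := sub_nonneg.2 (Real.log_le_log hq h)
  have sub_le : √p - √q ≤ (Real.log p - Real.log q) * √p := by
    have log_le := Real.log_le_sub_one_of_pos (div_pos (Real.sqrt_pos.2 hq) hsp)
    rw [Real.log_div (Real.sqrt_pos.2 hq).ne' hsp.ne', Real.log_sqrt hq.le, Real.log_sqrt hp.le,
      div_sub_one hsp.ne', le_div_iff₀ hsp] at log_le
    linarith [mul_nonneg log_nonneg hsp.le]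
  calc (√p - √q) ^ 2 ≤ ((Real.log p - Real.log q) * √p) ^ 2 :=
        pow_le_pow_left₀ (sub_nonneg.2 (Real.sqrt_le_sqrt h)) sub_le 2
    _ = (Real.log p - Real.log q) ^ 2 * p := by rw [mul_pow, Real.sq_sqrt hp.le]
    _ ≤ _ := le_add_of_nonneg_right (by positivity)

theorem hellingerSq_le_of_abs_log_sub_le {Y : Type*} [MeasurableSpace Y] {ν : Measure Y}
    {p q u v : Y → ℝ} (hp : ∀ y, 0 < p y) (hq : ∀ y, 0 < q y)
    (hu : ∀ y, |Real.log (p y) - Real.log (q y)| ≤ u y)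
    (hv : ∀ y, |Real.log (p y) - Real.log (q y)| ≤ v y)
    (hup : Integrable (fun y => u y ^ 2 * p y) ν) (hvq : Integrable (fun y => v y ^ 2 * q y) ν) :
    hellingerSq ν p q ≤ (∫ y, u y ^ 2 * p y ∂ν) + ∫ y, v y ^ 2 * q y ∂ν := by
  rw [← integral_add hup hvq]
  refine integral_mono_of_nonneg (ae_of_all _ fun y => sq_nonneg _) (hup.add hvq)
    (ae_of_all _ fun y => (sq_sqrt_sub_sqrt_le (hp y) (hq y)).trans (add_le_add ?_ ?_))
  · exact mul_le_mul_of_nonneg_right (sq_le_sq.2 ((hu y).trans (le_abs_self _))) (hp y).le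
  · exact mul_le_mul_of_nonneg_right (sq_le_sq.2 ((hv y).trans (le_abs_self _))) (hq y).le

theorem one_add_abs_div_le {M a b m m' σ σ' : ℝ} (ha : 0 < a) (hm : |m| ≤ M) (hm' : |m'| ≤ M)
    (hσ : σ ∈ Icc a b) (hσ' : a ≤ σ') (y : ℝ) :
    1 + |(y - m') / σ'| ≤ (1 + (2 * M + b) / a) * (1 + |(y - m) / σ|) := by
  have hσ0 : 0 < σ := ha.trans_le hσ.1
  have hσ0' : 0 < σ' := ha.trans_le hσ'
  have hM : 0 ≤ M := (abs_nonneg m).trans hm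
  have hb : 0 ≤ b := hσ0.le.trans hσ.2
  have numerator_eq : y - m' = (m - m') + σ * ((y - m) / σ) := by field_simp; ring
  set z := (y - m) / σ
  have numerator_le : |y - m'| ≤ (2 * M + b) * (1 + |z|) := by
    calc |y - m'| ≤ |m - m'| + |σ * z| := numerator_eq ▸ abs_add_le _ _
      _ ≤ (M + M) + b * |z| := by
          rw [abs_mul, abs_of_pos hσ0]
          exact add_le_add ((abs_sub _ _).trans (add_le_add hm hm'))
            (mul_le_mul_of_nonneg_right hσ.2 (abs_nonneg z))
      _ ≤ (2 * M + b) * (1 + |z|) := by linarith [mul_nonneg hM (abs_nonneg z)]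
  have quotient_le : |(y - m') / σ'| ≤ (2 * M + b) / a * (1 + |z|) := by
    rw [abs_div, abs_of_pos hσ0', div_mul_eq_mul_div]
    exact div_le_div₀ (by positivity) numerator_le ha hσ'
  linarith [abs_nonneg z]

theorem abs_div_sub_div_le {a m m' σ σ' : ℝ} (ha : 0 < a) (hσ : 0 < σ) (hσ' : a ≤ σ') (y : ℝ) :
    |(y - m) / σ - (y - m') / σ'| ≤
      (|m - m'| + |σ - σ'|) / a * (1 + |(y - m) / σ|) := by
  have hσ0' : 0 < σ' := ha.trans_le hσ'
  have sub_eq : (y - m) / σ - (y - m') / σ' =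
      ((σ' - σ) * ((y - m) / σ) - (m - m')) / σ' := by field_simp; ring
  rw [sub_eq]
  set z := (y - m) / σ
  rw [abs_div, abs_of_pos hσ0', div_mul_eq_mul_div]
  refine div_le_div₀ (by positivity) ((abs_sub _ _).trans ?_) ha hσ'
  rw [abs_mul, abs_sub_comm σ' σ]
  linarith [mul_nonneg (abs_nonneg (m - m')) (abs_nonneg z), abs_nonneg (σ - σ')]

theorem log_locScale {f : ℝ → ℝ} (hf : ∀ y, 0 < f y) (m : ℝ) {σ : ℝ} (hσ : 0 < σ) (y : ℝ) :
    Real.log (locScale f m σ y) = Real.log (f ((y - m) / σ)) - Real.log σ := by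
  rw [locScale, Real.log_mul (by positivity) (hf _).ne', one_div, Real.log_inv, neg_add_eq_sub]

theorem integrable_comp_mul_locScale {f g : ℝ → ℝ} (h : Integrable fun z => g z * f z) (m : ℝ)
    {σ : ℝ} (hσ : 0 < σ) : Integrable fun y => g ((y - m) / σ) * locScale f m σ y := by
  refine (((h.comp_div hσ.ne').comp_sub_right m).const_mul (1 / σ)).congr
    (ae_of_all _ fun y => ?_)
  simp only [locScale]
  ring

theorem integral_comp_mul_locScale (f g : ℝ → ℝ) (m : ℝ) {σ : ℝ} (hσ : 0 < σ) :
    ∫ y, g ((y - m) / σ) * locScale f m σ y = ∫ z, g z * f z := by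
  simp_rw [integral_mul_locScale f (fun y => g ((y - m) / σ)) m hσ, add_sub_cancel_left,
    mul_div_cancel_left₀ _ hσ.ne']

/-- Positive densities `f` whose log-density varies at speed of order at most `G y / (1 + |y|)`
near `y`, for a weight `G` which is square integrable under `f`. Only points of comparable size
are compared, since a bounded change of location and scale moves a point to one of comparable
size. -/
structure LogLipschitzDensity (f G : ℝ → ℝ) : Prop where
  measurable : Measurable f
  pos : ∀ y, 0 < f y
  integral_eq_one : ∫ y, f y = 1
  measurable_weight : Measurable G
  weight_nonneg : ∀ y, 0 ≤ G y
  integrable_weight : Integrable fun y => G y ^ 2 * f y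
  log_lipschitz : ∀ R, 1 ≤ R → ∃ A ≥ 0, ∀ y z, 1 + |y| ≤ R * (1 + |z|) →
    1 + |z| ≤ R * (1 + |y|) → (1 + |y|) * |Real.log (f y) - Real.log (f z)| ≤ A * |y - z| * G y

namespace LogLipschitzDensity

variable {f G : ℝ → ℝ}

theorem integrable_weight_sq (hf : LogLipschitzDensity f G) (A : ℝ) :
    Integrable fun y => (A * G y + 1) ^ 2 * f y := by
  have := hf.measurable
  have := hf.measurable_weight
  have integrable_f := integrable_of_integral_eq_one hf.integral_eq_one
  refine ((hf.integrable_weight.const_mul (2 * A ^ 2)).add (integrable_f.const_mul 2)).mono'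
    (by fun_prop) (ae_of_all _ fun y => ?_)
  have hfy := (hf.pos y).le
  rw [Real.norm_of_nonneg (by positivity)]
  calc (A * G y + 1) ^ 2 * f y ≤ (2 * ((A * G y) ^ 2 + 1 ^ 2)) * f y :=
        mul_le_mul_of_nonneg_right add_sq_le hfy
    _ = 2 * A ^ 2 * (G y ^ 2 * f y) + 2 * f y := by ring

theorem exists_pos_le (hf : LogLipschitzDensity f G) (M : ℝ) :
    ∃ l > 0, ∀ y, |y| ≤ M → l ≤ f y := by
  obtain ⟨A, hA, hlog⟩ := hf.log_lipschitz (1 + |M|) (le_add_of_nonneg_right (abs_nonneg M))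
  refine ⟨f 0 * Real.exp (-(A * |M| * G 0)), mul_pos (hf.pos 0) (Real.exp_pos _), fun y hy => ?_⟩
  have hyM : |y| ≤ |M| := hy.trans (le_abs_self M)
  have hlogy := hlog 0 y
    (by rw [abs_zero]; nlinarith [abs_nonneg M, abs_nonneg y]) (by rw [abs_zero]; linarith)
  rw [abs_zero, add_zero, one_mul, zero_sub, abs_neg] at hlogy
  have : A * |y| * G 0 ≤ A * |M| * G 0 := by
    have := hf.weight_nonneg 0
    gcongr
  rw [← Real.log_le_log_iff (mul_pos (hf.pos 0) (Real.exp_pos _)) (hf.pos y),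
    Real.log_mul (hf.pos 0).ne' (Real.exp_pos _).ne', Real.log_exp]
  linarith [le_abs_self (Real.log (f 0) - Real.log (f y))]

theorem exists_abs_log_locScale_sub_le (hf : LogLipschitzDensity f G) (M : ℝ) {a : ℝ} (b : ℝ)
    (ha : 0 < a) : ∃ A ≥ 0, ∀ m m' σ σ', |m| ≤ M → |m'| ≤ M → σ ∈ Icc a b → σ' ∈ Icc a b → ∀ y,
      |Real.log (locScale f m σ y) - Real.log (locScale f m' σ' y)| ≤
        (|m - m'| + |σ - σ'|) / a * (A * G ((y - m) / σ) + 1) := by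
  obtain ⟨A, hA, hlog⟩ := hf.log_lipschitz (1 + (2 * |M| + |b|) / a)
    (le_add_of_nonneg_right (by positivity))
  refine ⟨A, hA, fun m m' σ σ' hm hm' hσ hσ' y => ?_⟩
  have hσ0 : 0 < σ := ha.trans_le hσ.1
  have hM := le_abs_self M
  have hb := le_abs_self b
  have hlogz := hlog ((y - m) / σ) ((y - m') / σ')
    (one_add_abs_div_le ha (hm'.trans hM) (hm.trans hM) ⟨hσ'.1, hσ'.2.trans hb⟩ hσ.1 y)
    (one_add_abs_div_le ha (hm.trans hM) (hm'.trans hM) ⟨hσ.1, hσ.2.trans hb⟩ hσ'.1 y)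
  have abs_sub_le := abs_div_sub_div_le ha hσ0 hσ'.1 y (m := m) (m' := m')
  rw [log_locScale hf.pos m hσ0, log_locScale hf.pos m' (ha.trans_le hσ'.1),
    sub_sub_sub_comm]
  set z := (y - m) / σ
  set z' := (y - m') / σ'
  set D := (|m - m'| + |σ - σ'|) / a with hD
  have density_le : |Real.log (f z) - Real.log (f z')| ≤ D * (A * G z) := by
    refine le_of_mul_le_mul_left (hlogz.trans ?_) (by positivity : 0 < 1 + |z|)
    calc A * |z - z'| * G z ≤ A * (D * (1 + |z|)) * G z := by
          have := hf.weight_nonneg z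
          gcongr
      _ = (1 + |z|) * (D * (A * G z)) := by ring
  have scale_le : |Real.log σ - Real.log σ'| ≤ D := by
    refine (abs_log_sub_log_le ha hσ.1 hσ'.1).trans ?_
    rw [hD]
    gcongr
    exact le_add_of_nonneg_left (abs_nonneg _)
  exact (abs_sub _ _).trans ((add_le_add density_le scale_le).trans_eq (by ring))

theorem exists_hellingerSq_le (hf : LogLipschitzDensity f G) (M a b : ℝ) (ha : 0 < a) :
    ∃ A > 0, ∀ m m' σ σ', |m| ≤ M → |m'| ≤ M → σ ∈ Icc a b → σ' ∈ Icc a b →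
      hellingerSq volume (locScale f m σ) (locScale f m' σ') ≤
        A * ((m - m') ^ 2 + (σ - σ') ^ 2) := by
  obtain ⟨A, -, hlog⟩ := hf.exists_abs_log_locScale_sub_le M b ha
  set J := ∫ z, (A * G z + 1) ^ 2 * f z with hJ
  have hJ0 : 0 ≤ J := integral_nonneg fun z => mul_nonneg (sq_nonneg _) (hf.pos z).le
  refine ⟨4 * J / a ^ 2 + 1, by positivity, fun m m' σ σ' hm hm' hσ hσ' => ?_⟩
  have hpos : ∀ {m σ}, σ ∈ Icc a b → ∀ y, 0 < locScale f m σ y := fun hσ y =>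
    mul_pos (one_div_pos.2 (ha.trans_le hσ.1)) (hf.pos _)
  set D := (|m - m'| + |σ - σ'|) / a with hD
  have integrable_sq : Integrable fun z => (D * (A * G z + 1)) ^ 2 * f z := by
    simpa only [mul_pow, mul_assoc] using (hf.integrable_weight_sq A).const_mul (D ^ 2)
  have integral_eq : ∫ z, (D * (A * G z + 1)) ^ 2 * f z = D ^ 2 * J := by
    simp only [mul_pow, mul_assoc, integral_const_mul, hJ]
  have hellinger_le := hellingerSq_le_of_abs_log_sub_le (hpos hσ) (hpos hσ')
    (hlog m m' σ σ' hm hm' hσ hσ')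
    (fun y => by
      simpa only [abs_sub_comm m', abs_sub_comm σ', abs_sub_comm (Real.log (locScale f m' σ' y))]
        using hlog m' m σ' σ hm' hm hσ' hσ y)
    (integrable_comp_mul_locScale integrable_sq m (ha.trans_le hσ.1))
    (integrable_comp_mul_locScale integrable_sq m' (ha.trans_le hσ'.1))
  rw [integral_comp_mul_locScale f (fun z => (D * (A * G z + 1)) ^ 2) m (ha.trans_le hσ.1),
    integral_comp_mul_locScale f (fun z => (D * (A * G z + 1)) ^ 2) m' (ha.trans_le hσ'.1),
    integral_eq] at hellinger_le
  have D_sq_le : D ^ 2 ≤ 2 * ((m - m') ^ 2 + (σ - σ') ^ 2) / a ^ 2 := by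
    rw [hD, div_pow]
    gcongr
    simpa only [sq_abs] using add_sq_le (a := |m - m'|) (b := |σ - σ'|)
  calc _ ≤ D ^ 2 * J + D ^ 2 * J := hellinger_le
    _ ≤ 2 * (2 * ((m - m') ^ 2 + (σ - σ') ^ 2) / a ^ 2 * J) := by
        linarith [mul_le_mul_of_nonneg_right D_sq_le hJ0]
    _ = 4 * J / a ^ 2 * ((m - m') ^ 2 + (σ - σ') ^ 2) := by ring
    _ ≤ _ := mul_le_mul_of_nonneg_right (le_add_of_nonneg_right zero_le_one) (by positivity)

theorem regularDensity (hf : LogLipschitzDensity f G) : RegularDensity f where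
  measurable := hf.measurable
  integral_eq_one := hf.integral_eq_one
  lower := hf.exists_pos_le
  hellinger := hf.exists_hellingerSq_le

end LogLipschitzDensity

end LogDensity

section ExponentialTail

theorem integrable_exp_neg_mul_abs {c : ℝ} (hc : 0 < c) :
    Integrable fun y : ℝ => Real.exp (-(c * |y|)) := by
  rw [← integrableOn_univ, ← Iic_union_Ioi (a := (0 : ℝ))]
  refine IntegrableOn.union ?_ ?_
  · refine (integrableOn_exp_mul_Iic hc 0).congr_fun (fun y hy => ?_) measurableSet_Iic
    simp only [abs_of_nonpos (mem_Iic.1 hy), mul_neg, neg_neg]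
  · refine (exp_neg_integrableOn_Ioi 0 hc).congr_fun (fun y hy => ?_) measurableSet_Ioi
    simp only [abs_of_pos (mem_Ioi.1 hy), neg_mul]

theorem integrable_one_add_abs_pow_mul_exp {c : ℝ} (hc : 0 < c) (n : ℕ) :
    Integrable fun y : ℝ => (1 + |y|) ^ n * Real.exp (-(c * |y|)) := by
  refine ((integrable_exp_neg_mul_abs (half_pos hc)).const_mul
    (n.factorial / (c / 2) ^ n * Real.exp (c / 2))).mono' (by fun_prop)
    (ae_of_all _ fun y => ?_)
  have pow_le := Real.pow_div_factorial_le_exp (c / 2 * (1 + |y|)) (by positivity) n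
  rw [mul_pow, div_le_iff₀' (by positivity), ← le_div_iff₀' (by positivity)] at pow_le
  rw [Real.norm_of_nonneg (by positivity)]
  calc (1 + |y|) ^ n * Real.exp (-(c * |y|)) ≤
        n.factorial * Real.exp (c / 2 * (1 + |y|)) / (c / 2) ^ n * Real.exp (-(c * |y|)) := by
        gcongr
    _ = n.factorial / (c / 2) ^ n * Real.exp (c / 2 * (1 + |y|) + -(c * |y|)) := by
        rw [Real.exp_add]
        ring
    _ = n.factorial / (c / 2) ^ n * Real.exp (c / 2) * Real.exp (-(c / 2 * |y|)) := by
        rw [mul_assoc _ (Real.exp _), ← Real.exp_add]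
        ring_nf

/-- Locally Lipschitz functions on `s` whose local Lipschitz constant grows at most linearly. This
covers the exponents of Laplace-type and of normal-type tails. -/
def LinearGrowthLipschitzOn (A : ℝ) (V : ℝ → ℝ) (s : Set ℝ) : Prop :=
  ∀ y ∈ s, ∀ z ∈ s, |V y - V z| ≤ A * |y - z| * (1 + |y| + |z|)

theorem LinearGrowthLipschitzOn.continuous {A : ℝ} {V : ℝ → ℝ}
    (hV : LinearGrowthLipschitzOn A V univ) : Continuous V := by
  refine continuous_iff_continuousAt.2 fun y => tendsto_iff_dist_tendsto_zero.2
    (squeeze_zero (fun _ => dist_nonneg) (fun z => hV z trivial y trivial) ?_)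
  have : Continuous fun z => A * |z - y| * (1 + |z| + |y|) := by fun_prop
  simpa using this.tendsto y

theorem linearGrowthLipschitzOn_univ_of_halfLines {A : ℝ} {V : ℝ → ℝ} (hA : 0 ≤ A)
    (hpos : LinearGrowthLipschitzOn A V (Ici 0))
    (hneg : LinearGrowthLipschitzOn A (fun y => V (-y)) (Ici 0)) :
    LinearGrowthLipschitzOn A V univ := by
  have opposite : ∀ y z : ℝ, 0 ≤ y → 0 ≤ z →
      |V y - V (-z)| ≤ A * |y - -z| * (1 + |y| + |-z|) := by
    intro y z hy hz
    have right_le := hpos y hy 0 self_mem_Ici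
    have left_le : |V (-z) - V (-0)| ≤ A * |z - 0| * (1 + |z| + |0|) := hneg z hz 0 self_mem_Ici
    rw [sub_zero, abs_zero, add_zero, abs_of_nonneg hy] at right_le
    rw [neg_zero, sub_zero, abs_zero, add_zero, abs_of_nonneg hz, abs_sub_comm] at left_le
    rw [sub_neg_eq_add, abs_neg, abs_of_nonneg hy, abs_of_nonneg hz,
      abs_of_nonneg (add_nonneg hy hz)]
    linarith [abs_sub_le (V y) (V 0) (V (-z)), mul_nonneg hA (mul_nonneg hy hz)]
  intro y _ z _
  rcases le_total 0 y with hy | hy <;> rcases le_total 0 z with hz | hz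
  · exact hpos y hy z hz
  · simpa only [neg_neg] using opposite y (-z) hy (neg_nonneg.2 hz)
  · rw [abs_sub_comm, abs_sub_comm y, add_right_comm]
    simpa only [neg_neg] using opposite z (-y) hz (neg_nonneg.2 hy)
  · have h := hneg (-y) (neg_nonneg.2 hy) (-z) (neg_nonneg.2 hz)
    simpa only [neg_neg, abs_neg, neg_sub_neg, abs_sub_comm z] using h

theorem LinearGrowthLipschitzOn.measurable_of_log {f : ℝ → ℝ} {A : ℝ} (hf : ∀ y, 0 < f y)
    (hlog : LinearGrowthLipschitzOn A (fun y => Real.log (f y)) univ) : Measurable f := by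
  have hexp : f = fun y => Real.exp (Real.log (f y)) := funext fun y => (Real.exp_log (hf y)).symm
  rw [hexp]
  exact (Real.continuous_exp.comp hlog.continuous).measurable

theorem logLipschitzDensity_of_exp_tail {f : ℝ → ℝ} (hf : ∀ y, 0 < f y) {A c k : ℝ} (hA : 0 ≤ A)
    (hc : 0 < c) (hlog : LinearGrowthLipschitzOn A (fun y => Real.log (f y)) univ)
    (htail : ∀ y, f y ≤ k * Real.exp (-(c * |y|))) (hone : ∫ y, f y = 1) :
    LogLipschitzDensity f fun y => (1 + |y|) ^ 2 := by
  have hmeas : Measurable f := hlog.measurable_of_log hf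
  refine ⟨hmeas, hf, hone, by fun_prop, fun y => by positivity, ?_, fun R hR =>
    ⟨A * (1 + R), by positivity, fun y z _ hz => ?_⟩⟩
  · refine ((integrable_one_add_abs_pow_mul_exp hc 4).const_mul k).mono' (by fun_prop)
      (ae_of_all _ fun y => ?_)
    have hfy := (hf y).le
    rw [Real.norm_of_nonneg (by positivity), ← pow_mul, mul_left_comm]
    exact mul_le_mul_of_nonneg_left (htail y) (by positivity)
  · calc (1 + |y|) * |Real.log (f y) - Real.log (f z)| ≤
          (1 + |y|) * (A * |y - z| * (1 + |y| + |z|)) := by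
          gcongr
          exact hlog y trivial z trivial
      _ ≤ (1 + |y|) * (A * |y - z| * ((1 + |y|) + R * (1 + |y|))) := by
          gcongr
          linarith
      _ = _ := by ring

/-- Exponents `V` on the half-line `[0, ∞)` for which the tail `exp (-V y)` decays exponentially
and has a log-derivative of at most linear growth. The values on `(-∞, 0)` are irrelevant. -/
structure TailExponent (V : ℝ → ℝ) : Prop where
  lipschitz : ∃ A ≥ 0, LinearGrowthLipschitzOn A V (Ici 0)
  growth : ∃ c > 0, ∃ D, ∀ y, 0 ≤ y → c * y ≤ V y + D

theorem tailExponent_id : TailExponent fun y => y where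
  lipschitz := ⟨1, zero_le_one, fun y _ z _ => by
    rw [one_mul]
    exact le_mul_of_one_le_right (abs_nonneg _) (by linarith [abs_nonneg y, abs_nonneg z])⟩
  growth := ⟨1, one_pos, 0, fun y _ => by linarith⟩

theorem tailExponent_sq : TailExponent fun y => y ^ 2 where
  lipschitz := ⟨1, zero_le_one, fun y _ z _ => by
    rw [one_mul, sq_sub_sq, abs_mul, mul_comm]
    gcongr
    linarith [abs_add_le y z]⟩
  growth := ⟨1, one_pos, 1, fun y _ => by linarith [sq_nonneg (y - 1), sq_nonneg y]⟩

theorem tailExponent_sub_mul_log {a : ℝ} (ha : 0 ≤ a) :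
    TailExponent fun r => a + r - a * Real.log (a + r) := by
  rcases ha.eq_or_lt with rfl | ha
  · simpa only [zero_add, zero_mul, sub_zero] using tailExponent_id
  refine ⟨⟨2, zero_le_two, fun r hr t ht => ?_⟩, 1 / 2, by norm_num, a * Real.log (2 * a),
    fun r hr => ?_⟩
  · have log_le : a * |Real.log (a + r) - Real.log (a + t)| ≤ |r - t| := by
      have := abs_log_sub_log_le ha (le_add_of_nonneg_right hr) (le_add_of_nonneg_right ht)
      rwa [add_sub_add_left_eq_sub, le_div_iff₀' ha] at this
    calc _ = |(r - t) - a * (Real.log (a + r) - Real.log (a + t))| := by ring_nf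
      _ ≤ |r - t| + |r - t| := (abs_sub _ _).trans (by
          rw [abs_mul, abs_of_pos ha]
          gcongr)
      _ ≤ 2 * |r - t| * (1 + |r| + |t|) := by
          rw [← two_mul]
          exact le_mul_of_one_le_right (by positivity) (by linarith [abs_nonneg r, abs_nonneg t])
  · have log_le := Real.log_le_sub_one_of_pos (x := (a + r) / (2 * a)) (by positivity)
    rw [Real.log_div (by positivity) (by positivity), le_sub_iff_add_le,
      le_div_iff₀' (by positivity)] at log_le
    linarith

theorem TailExponent.comp_mul {V : ℝ → ℝ} (hV : TailExponent V) {τ : ℝ} (hτ : 0 < τ) :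
    TailExponent fun y => V (τ * y) := by
  obtain ⟨⟨A, hA, hlip⟩, c, hc, D, hgrowth⟩ := hV
  refine ⟨⟨A * τ * (1 + τ), by positivity, fun y hy z hz => ?_⟩, c * τ, by positivity, D,
    fun y hy => ?_⟩
  · calc |V (τ * y) - V (τ * z)| ≤ A * |τ * y - τ * z| * (1 + |τ * y| + |τ * z|) :=
          hlip _ (mul_nonneg hτ.le hy) _ (mul_nonneg hτ.le hz)
      _ = A * τ * |y - z| * (1 + τ * |y| + τ * |z|) := by
          rw [← mul_sub, abs_mul, abs_mul, abs_mul, abs_of_pos hτ]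
          ring
      _ ≤ A * τ * |y - z| * ((1 + τ) * (1 + |y| + |z|)) := by
          gcongr
          linarith [abs_nonneg y, abs_nonneg z]
      _ = _ := by ring
  · linarith [hgrowth (τ * y) (mul_nonneg hτ.le hy)]

theorem integral_eq_integral_Ioi_neg_add {f : ℝ → ℝ} (hf : Integrable f) :
    ∫ y, f y = (∫ y in Ioi 0, f (-y)) + ∫ y in Ioi 0, f y := by
  rw [integral_comp_neg_Ioi 0 f, neg_zero,
    intervalIntegral.integral_Iic_add_Ioi hf.integrableOn hf.integrableOn]

theorem forall_of_halfLines {P : ℝ → Prop} (hpos : ∀ y, 0 ≤ y → P y)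
    (hneg : ∀ y, 0 ≤ y → P (-y)) (y : ℝ) : P y :=
  (le_total 0 y).elim (hpos y) fun hy => neg_neg y ▸ hneg (-y) (neg_nonneg.2 hy)

theorem regularDensity_of_tailExponent {f V W : ℝ → ℝ} {k : ℝ} (hV : TailExponent V)
    (hW : TailExponent W) (hk : 0 < k) (hright : ∀ y, 0 ≤ y → f y = k * Real.exp (-V y))
    (hleft : ∀ y, 0 ≤ y → f (-y) = k * Real.exp (-W y))
    (hone : k * ((∫ y in Ioi 0, Real.exp (-W y)) + ∫ y in Ioi 0, Real.exp (-V y)) = 1) :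
    RegularDensity f := by
  obtain ⟨⟨A, hA, hVlip⟩, c, hc, D, hVgrowth⟩ := hV
  obtain ⟨⟨A', hA', hWlip⟩, c', hc', D', hWgrowth⟩ := hW
  have hpos : ∀ y, 0 < f y := forall_of_halfLines
    (fun y hy => by rw [hright y hy]; positivity) (fun y hy => by rw [hleft y hy]; positivity)
  have log_eq : ∀ t, Real.log (k * Real.exp (-t)) = Real.log k - t := fun t => by
    rw [Real.log_mul hk.ne' (Real.exp_pos _).ne', Real.log_exp, sub_eq_add_neg]
  have hlog : LinearGrowthLipschitzOn (A + A') (fun y => Real.log (f y)) univ := by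
    refine linearGrowthLipschitzOn_univ_of_halfLines (by positivity)
      (fun y hy z hz => ?_) (fun y hy z hz => ?_)
    · simp only [hright y hy, hright z hz, log_eq, sub_sub_sub_cancel_left]
      rw [abs_sub_comm]
      exact (hVlip y hy z hz).trans (by gcongr; exact le_add_of_nonneg_right hA')
    · simp only [hleft y hy, hleft z hz, log_eq, sub_sub_sub_cancel_left]
      rw [abs_sub_comm]
      exact (hWlip y hy z hz).trans (by gcongr; exact le_add_of_nonneg_left hA)
  have htail : ∀ y, f y ≤ k * Real.exp (max D D') * Real.exp (-(min c c' * |y|)) := by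
    refine forall_of_halfLines (fun y hy => ?_) (fun y hy => ?_)
    · rw [hright y hy, mul_assoc, ← Real.exp_add, abs_of_nonneg hy]
      gcongr
      linarith [hVgrowth y hy, le_max_left D D', mul_le_mul_of_nonneg_right (min_le_left c c') hy]
    · rw [hleft y hy, mul_assoc, ← Real.exp_add, abs_neg, abs_of_nonneg hy]
      gcongr
      linarith [hWgrowth y hy, le_max_right D D', mul_le_mul_of_nonneg_right (min_le_right c c') hy]
  have integrable_f : Integrable f :=
    ((integrable_exp_neg_mul_abs (lt_min hc hc')).const_mul _).mono'
      (hlog.measurable_of_log hpos).aestronglyMeasurable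
      (ae_of_all _ fun y => (Real.norm_of_nonneg (hpos y).le).trans_le (htail y))
  refine (logLipschitzDensity_of_exp_tail hpos (by positivity) (lt_min hc hc') hlog htail
    ?_).regularDensity
  rw [← hone, mul_add, ← integral_const_mul, ← integral_const_mul,
    integral_eq_integral_Ioi_neg_add integrable_f]
  congr 1
  · exact setIntegral_congr_fun measurableSet_Ioi fun y hy => hleft y (mem_Ioi.1 hy).le
  · exact setIntegral_congr_fun measurableSet_Ioi fun y hy => hright y (mem_Ioi.1 hy).le

end ExponentialTail

section StandardDensities

theorem TailExponent.const_mul {V : ℝ → ℝ} (hV : TailExponent V) {c : ℝ} (hc : 0 < c) :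
    TailExponent fun y => c * V y := by
  obtain ⟨⟨A, hA, hlip⟩, b, hb, D, hgrowth⟩ := hV
  refine ⟨⟨c * A, by positivity, fun y hy z hz => ?_⟩, c * b, by positivity, c * D,
    fun y hy => ?_⟩
  · rw [← mul_sub, abs_mul, abs_of_pos hc, mul_assoc, mul_assoc, ← mul_assoc A]
    exact mul_le_mul_of_nonneg_left (hlip y hy z hz) hc.le
  · rw [mul_assoc, ← mul_add]
    exact mul_le_mul_of_nonneg_left (hgrowth y hy) hc.le

theorem regularDensity_asymNormalDensity {φ : ℝ} (h₀ : 0 < φ) (h₁ : φ < 1) :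
    RegularDensity (asymNormalDensity φ) := by
  have h₁' : 0 < 1 - φ := sub_pos.2 h₁
  refine regularDensity_of_tailExponent (tailExponent_sq.const_mul h₀)
    (tailExponent_sq.const_mul h₁')
    (k := 2 / √Real.pi * (√(φ * (1 - φ)) / (√φ + √(1 - φ)))) (by positivity)
    (fun y hy => by rw [asymNormalDensity, if_pos hy]) (fun y hy => ?_) ?_
  · rcases hy.eq_or_lt with rfl | hy
    · simp [asymNormalDensity]
    · rw [asymNormalDensity, if_neg (by simpa using hy), neg_sq]
  · simp only [← neg_mul, integral_gaussian_Ioi]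
    rw [Real.sqrt_div Real.pi_pos.le, Real.sqrt_div Real.pi_pos.le, Real.sqrt_mul h₀.le]
    field_simp

theorem regularDensity_cnlDensity {τ b : ℝ} (h₀ : 0 < τ) (hb : 0 < b)
    (hcont : (1 - τ) / b = 2 * τ / √(2 * Real.pi)) : RegularDensity (cnlDensity τ b) := by
  refine regularDensity_of_tailExponent (tailExponent_id.const_mul (inv_pos.2 hb))
    (tailExponent_sq.const_mul (one_half_pos (α := ℝ))) (k := 2 * τ / √(2 * Real.pi))
    (by positivity) (fun y hy => ?_) (fun y hy => ?_) ?_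
  · rcases hy.eq_or_lt with rfl | hy
    · simp [cnlDensity]
    · rw [cnlDensity, if_neg hy.not_ge, hcont, div_eq_inv_mul y]
  · rw [cnlDensity, if_pos (neg_nonpos.2 hy), neg_sq, one_div, div_eq_inv_mul (y ^ 2)]
  · have right_mass : ∫ y in Ioi (0 : ℝ), Real.exp (-b⁻¹ * y) = b := by
      rw [integral_exp_mul_Ioi (neg_lt_zero.2 (inv_pos.2 hb))]
      simp
    have left_mass : ∫ y in Ioi (0 : ℝ), Real.exp (-(1 / 2) * y ^ 2) = √(2 * Real.pi) / 2 := by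
      rw [integral_gaussian_Ioi, div_div_eq_mul_div, div_one, mul_comm]
    simp only [← neg_mul, right_mass, left_mass]
    rw [mul_add, ← hcont, div_mul_cancel₀ _ hb.ne', hcont]
    field_simp
    ring

theorem checkLoss_of_nonneg (τ : ℝ) {y : ℝ} (hy : 0 ≤ y) : checkLoss τ y = τ * y := by
  rw [checkLoss, if_neg hy.not_gt, sub_zero, mul_comm]

theorem checkLoss_neg_of_nonneg (τ : ℝ) {y : ℝ} (hy : 0 ≤ y) :
    checkLoss τ (-y) = (1 - τ) * y := by
  rcases hy.eq_or_lt with rfl | hy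
  · simp [checkLoss]
  · rw [checkLoss, if_pos (neg_lt_zero.2 hy)]
    ring

theorem exp_neg_sub_mul_log {a r : ℝ} (ha : 0 ≤ a) (hr : 0 ≤ r) :
    Real.exp (-(a + r - a * Real.log (a + r))) = (a + r) ^ a * Real.exp (-(a + r)) := by
  rcases ha.eq_or_lt with rfl | ha
  · simp
  · rw [Real.rpow_def_of_pos (by positivity), ← Real.exp_add]
    ring_nf

theorem integral_Ioi_exp_neg_sub_mul_log {a : ℝ} (ha : 0 ≤ a) :
    ∫ r in Ioi 0, Real.exp (-(a + r - a * Real.log (a + r))) = upperGamma (a + 1) a := by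
  have shift := (measurePreserving_add_left volume a).setIntegral_preimage_emb
    (measurableEmbedding_addLeft a) (fun x : ℝ => x ^ a * Real.exp (-x)) (Ioi a)
  rw [preimage_const_add_Ioi, sub_self] at shift
  rw [upperGamma, add_sub_cancel_right, ← shift]
  exact setIntegral_congr_fun measurableSet_Ioi fun r hr =>
    exp_neg_sub_mul_log ha (mem_Ioi.1 hr).le

theorem upperGamma_pos {a : ℝ} (ha : 0 ≤ a) : 0 < upperGamma (a + 1) a := by
  have hpos : ∀ x ∈ Ioi a, 0 < x ^ a * Real.exp (-x) := fun x hx =>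
    mul_pos (Real.rpow_pos_of_pos (ha.trans_lt hx) _) (Real.exp_pos _)
  have integrable_integrand : IntegrableOn (fun x : ℝ => x ^ a * Real.exp (-x)) (Ioi a) := by
    simpa only [add_sub_cancel_right, mul_comm] using
      (Real.GammaIntegral_convergent (s := a + 1) (by positivity)).mono_set (Ioi_subset_Ioi ha)
  rw [upperGamma, add_sub_cancel_right, setIntegral_pos_iff_support_of_nonneg_ae
    (ae_restrict_of_forall_mem measurableSet_Ioi fun x hx => (hpos x hx).le) integrable_integrand]
  refine lt_of_lt_of_le ?_ (measure_mono (s := Ioi a) fun x hx => ⟨(hpos x hx).ne', hx⟩)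
  simp only [Real.volume_Ioi, ENNReal.zero_lt_top]

theorem regularDensity_acdtgDensity {a τ : ℝ} (ha : 0 ≤ a) (h₀ : 0 < τ) (h₁ : τ < 1) :
    RegularDensity (acdtgDensity a τ) := by
  have h₁' : 0 < 1 - τ := sub_pos.2 h₁
  have hΓ := upperGamma_pos ha
  have mass : ∀ c > 0, ∫ y in Ioi 0, Real.exp (-(a + c * y - a * Real.log (a + c * y))) =
      c⁻¹ * upperGamma (a + 1) a := fun c hc => by
    have := integral_comp_mul_left_Ioi
      (fun r => Real.exp (-(a + r - a * Real.log (a + r)))) 0 hc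
    rwa [mul_zero, integral_Ioi_exp_neg_sub_mul_log ha, smul_eq_mul] at this
  refine regularDensity_of_tailExponent ((tailExponent_sub_mul_log ha).comp_mul h₀)
    ((tailExponent_sub_mul_log ha).comp_mul h₁') (k := τ * (1 - τ) / upperGamma (a + 1) a)
    (by positivity) (fun y hy => ?_) (fun y hy => ?_) ?_
  · rw [acdtgDensity, checkLoss_of_nonneg τ hy, mul_assoc, exp_neg_sub_mul_log ha (by positivity)]
  · rw [acdtgDensity, checkLoss_neg_of_nonneg τ hy, mul_assoc,
      exp_neg_sub_mul_log ha (by positivity)]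
  · rw [mass τ h₀, mass (1 - τ) h₁']
    field_simp
    ring

theorem aldDensity_eq_acdtgDensity (τ : ℝ) : aldDensity τ = acdtgDensity 0 τ := by
  have hΓ : upperGamma (0 + 1) 0 = 1 := by
    simpa only [upperGamma, zero_add, sub_self, Real.rpow_zero, one_mul]
      using integral_exp_neg_Ioi_zero
  ext y
  rw [acdtgDensity, hΓ, div_one, Real.rpow_zero, mul_one, zero_add, aldDensity]

theorem cauchyPDFReal_zero_one (y : ℝ) :
    ProbabilityTheory.cauchyPDFReal 0 1 y = Real.pi⁻¹ * (1 + y ^ 2)⁻¹ := by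
  simp [ProbabilityTheory.cauchyPDFReal_def, add_comm]

theorem abs_log_one_add_sq_sub_le {R y z : ℝ} (hR : 1 ≤ R) (hyz : 1 + |y| ≤ R * (1 + |z|))
    (hzy : 1 + |z| ≤ R * (1 + |y|)) :
    (1 + |y|) * |Real.log (1 + y ^ 2) - Real.log (1 + z ^ 2)| ≤
      2 * R ^ 2 * (1 + R) * |y - z| := by
  have hy : 0 < 1 + |y| := by positivity
  have bound : ∀ w : ℝ, 1 + |y| ≤ R * (1 + |w|) → (1 + |y|) ^ 2 / (2 * R ^ 2) ≤ 1 + w ^ 2 := by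
    intro w hw
    rw [div_le_iff₀ (by positivity)]
    calc (1 + |y|) ^ 2 ≤ (R * (1 + |w|)) ^ 2 := by gcongr
      _ = R ^ 2 * (2 * (1 + |w| ^ 2) - (1 - |w|) ^ 2) := by ring
      _ ≤ R ^ 2 * (2 * (1 + |w| ^ 2)) := by
          gcongr
          exact sub_le_self _ (sq_nonneg _)
      _ = (1 + w ^ 2) * (2 * R ^ 2) := by
          rw [sq_abs]
          ring
  have sq_sub_le : |1 + y ^ 2 - (1 + z ^ 2)| ≤ (1 + R) * (1 + |y|) * |y - z| := by
    rw [add_sub_add_left_eq_sub, sq_sub_sq, abs_mul]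
    gcongr
    linarith [abs_add_le y z]
  calc _ ≤ (1 + |y|) * ((1 + R) * (1 + |y|) * |y - z| / ((1 + |y|) ^ 2 / (2 * R ^ 2))) := by
        gcongr
        exact (abs_log_sub_log_le (by positivity)
          (bound y (le_mul_of_one_le_left hy.le hR)) (bound z hyz)).trans (by gcongr)
    _ = _ := by field_simp

theorem regularDensity_cauchyPDFReal :
    RegularDensity (ProbabilityTheory.cauchyPDFReal 0 1) := by
  have log_eq : ∀ y, Real.log (ProbabilityTheory.cauchyPDFReal 0 1 y) =
      Real.log Real.pi⁻¹ - Real.log (1 + y ^ 2) := fun y => by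
    rw [cauchyPDFReal_zero_one, Real.log_mul (by positivity) (by positivity), Real.log_inv (1 + _),
      sub_eq_add_neg]
  refine LogLipschitzDensity.regularDensity (G := fun _ => 1)
    ⟨ProbabilityTheory.measurable_cauchyPDFReal 0 1,
      ProbabilityTheory.cauchyPDF_pos 0 one_ne_zero,
      ProbabilityTheory.integral_cauchyPDFReal_eq_one 0 one_ne_zero, measurable_const,
      fun _ => zero_le_one, ?_, fun R hR => ⟨2 * R ^ 2 * (1 + R), by positivity,
        fun y z hyz hzy => ?_⟩⟩
  · simpa only [one_pow, one_mul] using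
      ProbabilityTheory.integrable_cauchyPDFReal 0
  · rw [log_eq, log_eq, sub_sub_sub_cancel_left, abs_sub_comm (Real.log _), mul_one]
    exact abs_log_one_add_sq_sub_le hR hyz hzy

theorem IsStandardErrorDensity.regularDensity {f : ℝ → ℝ} (hf : IsStandardErrorDensity f) :
    RegularDensity f := by
  cases hf with
  | asymmetricLaplace τ h₀ h₁ =>
    exact aldDensity_eq_acdtgDensity τ ▸ regularDensity_acdtgDensity le_rfl h₀ h₁
  | connectedGamma a τ ha h₀ h₁ => exact regularDensity_acdtgDensity ha h₀ h₁
  | connectedNormalLaplace τ b h₀ _ hb hcont => exact regularDensity_cnlDensity h₀ hb hcont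
  | cauchy => exact regularDensity_cauchyPDFReal
  | asymmetricNormal φ h₀ h₁ => exact regularDensity_asymNormalDensity h₀ h₁

end StandardDensities

section Selection

theorem exists_measurable_selection {Ω ι : Type*} [MeasurableSpace Ω] [MeasurableSpace ι]
    [DiscreteMeasurableSpace ι] [Finite ι] [Nonempty ι] {far : ι → ι → Prop}
    (hfar : ∀ i j, far i j → far j i) {W : ι → ι → Ω → ℝ} (hW : ∀ i j, Measurable (W i j))
    (hmul : ∀ i j ω, W i j ω * W j i ω = 1) (hnonneg : ∀ i j ω, 0 ≤ W i j ω) :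
    ∃ sel : Ω → ι, Measurable sel ∧ ∀ ω i, far i (sel ω) → ∃ j, far i j ∧ 1 ≤ W i j ω := by
  classical
  set choice : (ι → ι → Prop) → ι := fun beats =>
    if h : ∃ i, ∀ j, far i j → beats i j then h.choose else Classical.arbitrary ι with hchoice
  set beats : Ω → ι → ι → Prop := fun ω i j => W i j ω < 1
  have beats_measurable : Measurable beats :=
    measurable_pi_lambda _ fun i => measurable_pi_lambda _ fun j =>
      measurableSet_setOfPred.1 (measurableSet_lt (hW i j) measurable_const)
  refine ⟨choice ∘ beats, (measurable_of_countable choice).comp beats_measurable,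
    fun ω i hi => ?_⟩
  by_contra! hwins
  have exists_winner : ∃ i, ∀ j, far i j → beats ω i j := ⟨i, hwins⟩
  have choice_wins : ∀ j, far (choice (beats ω)) j → beats ω (choice (beats ω)) j := by
    simpa only [hchoice, dif_pos exists_winner] using exists_winner.choose_spec
  have lt_one : W i (choice (beats ω)) ω < 1 := hwins _ hi
  have lt_one' : W (choice (beats ω)) i ω < 1 := choice_wins i (hfar _ _ hi)
  exact (mul_lt_one_of_nonneg_of_lt_one_left (hnonneg _ _ _) lt_one lt_one'.le).ne (hmul _ _ ω)

theorem lintegral_loss_selection_le {Ω ι : Type*} [MeasurableSpace Ω] {P : Measure Ω}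
    [IsProbabilityMeasure P] [Fintype ι] {far : ι → Prop} {W : ι → Ω → ℝ≥0∞}
    (hW : ∀ j, Measurable (W j)) {sel : Ω → ι}
    (hsel : ∀ ω, far (sel ω) → ∃ j, far j ∧ 1 ≤ W j ω) {loss : ι → ℝ≥0∞} {r R q : ℝ≥0∞}
    (hnear : ∀ j, ¬far j → loss j ≤ r) (hle : ∀ j, loss j ≤ R)
    (hq : ∀ j, far j → ∫⁻ ω, W j ω ∂P ≤ q) :
    ∫⁻ ω, loss (sel ω) ∂P ≤ r + R * (Fintype.card ι * q) := by
  classical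
  have pointwise : ∀ ω, loss (sel ω) ≤ r + R * ∑ j with far j, W j ω := by
    intro ω
    by_cases hfar : far (sel ω)
    · obtain ⟨j, hj, one_le⟩ := hsel ω hfar
      have one_le_sum : 1 ≤ ∑ j with far j, W j ω := one_le.trans
        (Finset.single_le_sum (f := fun j => W j ω) (fun _ _ => zero_le)
          (Finset.mem_filter.2 ⟨Finset.mem_univ j, hj⟩))
      exact (hle _).trans ((le_mul_of_one_le_right zero_le one_le_sum).trans le_add_self)
    · exact (hnear _ hfar).trans le_self_add
  calc ∫⁻ ω, loss (sel ω) ∂P ≤ ∫⁻ ω, (r + R * ∑ j with far j, W j ω) ∂P := lintegral_mono pointwise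
    _ = r + R * ∑ j with far j, ∫⁻ ω, W j ω ∂P := by
        rw [lintegral_add_left measurable_const, lintegral_const, measure_univ, mul_one,
          lintegral_const_mul _ (by fun_prop), lintegral_finsetSum _ fun j _ => hW j]
    _ ≤ r + R * ∑ _j : ι, q := by
        gcongr
        exact (Finset.sum_le_sum fun j hj => hq j (Finset.mem_filter.1 hj).2).trans
          (Finset.sum_le_sum_of_subset (Finset.filter_subset _ _))
    _ = r + R * (Fintype.card ι * q) := by
        rw [Finset.sum_const, nsmul_eq_mul, Finset.card_univ]

end Selection

section Design

variable {d : ℕ} {K : ℝ} {h : (Fin d → ℝ) → ℝ}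

instance isProbabilityMeasure_restrict_cube :
    IsProbabilityMeasure ((volume : Measure (Fin d → ℝ)).restrict (cube d)) :=
  ⟨by rw [Measure.restrict_apply_univ, volume_cube]⟩

theorem ae_covariateLaw_mem_cube (h : (Fin d → ℝ) → ℝ) : ∀ᵐ x ∂(covariateLaw h), x ∈ cube d :=
  (withDensity_absolutelyContinuous _ _).ae_le (ae_restrict_mem (measurableSet_cube d))

theorem covariateLaw_le (hh : h ∈ densityClass d K) :
    covariateLaw h ≤ ENNReal.ofReal K • volume.restrict (cube d) := by
  rw [covariateLaw, ← withDensity_const]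
  exact withDensity_mono (ae_restrict_of_forall_mem (measurableSet_cube d) fun x hx =>
    ENNReal.ofReal_le_ofReal (hh.2.1 x hx).2)

theorem le_covariateLaw (hh : h ∈ densityClass d K) :
    ENNReal.ofReal (1 / K) • volume.restrict (cube d) ≤ covariateLaw h := by
  rw [covariateLaw, ← withDensity_const]
  exact withDensity_mono (ae_restrict_of_forall_mem (measurableSet_cube d) fun x hx =>
    ENNReal.ofReal_le_ofReal (hh.2.1 x hx).1)

theorem isProbabilityMeasure_observationLaw {f : ℝ → ℝ} (hf : RegularDensity f) (hK : 0 ≤ K)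
    (hh : h ∈ densityClass d K) {μ σ : (Fin d → ℝ) → ℝ} (hμ : Measurable μ)
    (hσ : Measurable σ) : IsProbabilityMeasure (observationLaw f μ σ h) := by
  have := isProbabilityMeasure_covariateLaw hK hh
  have : IsProbabilityMeasure (errorLaw f) :=
    ⟨by rw [errorLaw, withDensity_apply _ .univ, setLIntegral_univ,
      hf.isProbDensity.lintegral_eq_one]⟩
  exact Measure.isProbabilityMeasure_map (by fun_prop)

/-- A measurable mean function bounded by `M`, and a measurable positive scale function with
values in `[a, b]`, on the cube. -/
structure Admissible (M a b : ℝ) (μ σ : (Fin d → ℝ) → ℝ) : Prop where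
  measurable_mean : Measurable μ
  measurable_scale : Measurable σ
  scale_pos : ∀ x, 0 < σ x
  abs_mean_le : ∀ x ∈ cube d, |μ x| ≤ M
  scale_mem : ∀ x ∈ cube d, σ x ∈ Icc a b

/-- The squared distance of two functions in `L²` of the cube. Selecting a regression function
compares candidates in this distance, since the covariate density is unknown. -/
def sqDist (μ μ' : (Fin d → ℝ) → ℝ) : ℝ := ∫ x in cube d, (μ x - μ' x) ^ 2

theorem sqDist_comm (μ μ' : (Fin d → ℝ) → ℝ) : sqDist μ μ' = sqDist μ' μ := by
  simp only [sqDist, sub_sq_comm]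

variable {M a b : ℝ} {μ σ μ' σ' : (Fin d → ℝ) → ℝ}

theorem Admissible.sq_sub_le (hμ : Admissible M a b μ σ) (hμ' : Admissible M a b μ' σ')
    {x : Fin d → ℝ} (hx : x ∈ cube d) : (μ x - μ' x) ^ 2 ≤ (2 * M) ^ 2 := by
  refine sq_le_sq.2 (((abs_sub _ _).trans ?_).trans (le_abs_self _))
  linarith [hμ.abs_mean_le x hx, hμ'.abs_mean_le x hx]

theorem Admissible.integrable_sq_sub (hμ : Admissible M a b μ σ) (hμ' : Admissible M a b μ' σ')
    {ν : Measure (Fin d → ℝ)} [IsFiniteMeasure ν] (hν : ∀ᵐ x ∂ν, x ∈ cube d) :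
    Integrable (fun x => (μ x - μ' x) ^ 2) ν := by
  refine Integrable.of_bound ((hμ.measurable_mean.sub
    hμ'.measurable_mean).pow_const 2).aestronglyMeasurable ((2 * M) ^ 2) ?_
  filter_upwards [hν] with x hx
  rw [Real.norm_of_nonneg (sq_nonneg _)]
  exact hμ.sq_sub_le hμ' hx

theorem Admissible.integrableOn_sq_sub (hμ : Admissible M a b μ σ) (hμ' : Admissible M a b μ' σ') :
    IntegrableOn (fun x => (μ x - μ' x) ^ 2) (cube d) :=
  hμ.integrable_sq_sub hμ' (ae_restrict_mem (measurableSet_cube d))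

theorem Admissible.sqDist_le (hμ : Admissible M a b μ σ) (hμ' : Admissible M a b μ' σ') :
    sqDist μ μ' ≤ (2 * M) ^ 2 := by
  have h := setIntegral_mono_on (hμ.integrableOn_sq_sub hμ') (integrable_const _)
    (measurableSet_cube d) fun x => hμ.sq_sub_le hμ'
  rwa [integral_const, probReal_univ, one_smul] at h

theorem Admissible.sqDist_le_of_abs_sub_le {μ₀ σ₀ : (Fin d → ℝ) → ℝ} {ε : ℝ}
    (hμ₀ : Admissible M a b μ₀ σ₀) (hμ : Admissible M a b μ σ) (hμ' : Admissible M a b μ' σ')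
    (hε : ∀ x ∈ cube d, |μ₀ x - μ x| ≤ ε) : sqDist μ₀ μ' ≤ 2 * (ε ^ 2 + sqDist μ μ') := by
  have h := setIntegral_mono_on (hμ₀.integrableOn_sq_sub hμ')
    (((integrable_const (ε ^ 2)).add (hμ.integrableOn_sq_sub hμ')).const_mul 2)
    (measurableSet_cube d) fun x hx => by
      calc (μ₀ x - μ' x) ^ 2 = ((μ₀ x - μ x) + (μ x - μ' x)) ^ 2 := by ring
        _ ≤ 2 * ((μ₀ x - μ x) ^ 2 + (μ x - μ' x) ^ 2) := add_sq_le
        _ ≤ 2 * (ε ^ 2 + (μ x - μ' x) ^ 2) := by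
            gcongr 2 * (?_ + _)
            exact sq_le_sq.2 ((hε x hx).trans (le_abs_self ε))
  simp only [Pi.add_apply] at h
  rwa [integral_const_mul, integral_add (integrable_const _) (hμ.integrableOn_sq_sub hμ'),
    integral_const, probReal_univ, one_smul] at h

theorem Admissible.lintegral_sq_sub_covariateLaw_le (hK : 0 ≤ K) (hh : h ∈ densityClass d K)
    (hμ : Admissible M a b μ σ) (hμ' : Admissible M a b μ' σ') :
    ∫⁻ x, ENNReal.ofReal ((μ x - μ' x) ^ 2) ∂(covariateLaw h) ≤
      ENNReal.ofReal (K * sqDist μ μ') := by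
  refine (lintegral_mono' (covariateLaw_le hh) le_rfl).trans_eq ?_
  rw [lintegral_smul_measure, ← ofReal_integral_eq_lintegral_ofReal (hμ.integrableOn_sq_sub hμ')
    (ae_of_all _ fun x => sq_nonneg _), smul_eq_mul, ← ENNReal.ofReal_mul hK, sqDist]

theorem Admissible.sqDist_div_le_integral_covariateLaw (hK : 0 ≤ K) (hh : h ∈ densityClass d K)
    (hμ : Admissible M a b μ σ) (hμ' : Admissible M a b μ' σ') :
    1 / K * sqDist μ μ' ≤ ∫ x, (μ x - μ' x) ^ 2 ∂(covariateLaw h) := by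
  have := isProbabilityMeasure_covariateLaw hK hh
  have mono := integral_mono_measure (le_covariateLaw hh) (ae_of_all _ fun x => sq_nonneg _)
    (hμ.integrable_sq_sub hμ' (ae_covariateLaw_mem_cube h))
  rwa [integral_smul_measure, ENNReal.toReal_ofReal (one_div_nonneg.2 hK)] at mono

theorem Admissible.lintegral_one_add_sub_sq_le (hK : 0 ≤ K) (hh : h ∈ densityClass d K)
    (hμ : Admissible M a b μ σ) (hμ' : Admissible M a b μ' σ') {c u : ℝ} (hc : 0 ≤ c)
    (hnonneg : ∀ x ∈ cube d, 0 ≤ 1 + u - c * (μ x - μ' x) ^ 2) :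
    ∫⁻ x, ENNReal.ofReal (1 + u - c * (μ x - μ' x) ^ 2) ∂(covariateLaw h) ≤
      ENNReal.ofReal (Real.exp (u - c * (1 / K) * sqDist μ μ')) := by
  have := isProbabilityMeasure_covariateLaw hK hh
  have hsq := (hμ.integrable_sq_sub hμ' (ae_covariateLaw_mem_cube h)).const_mul c
  have integrable_integrand : Integrable (fun x => 1 + u - c * (μ x - μ' x) ^ 2) (covariateLaw h) :=
    (integrable_const _).sub hsq
  have nonneg_ae : 0 ≤ᵐ[covariateLaw h] fun x => 1 + u - c * (μ x - μ' x) ^ 2 :=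
    (ae_covariateLaw_mem_cube h).mono hnonneg
  rw [← ofReal_integral_eq_lintegral_ofReal integrable_integrand nonneg_ae]
  refine ENNReal.ofReal_le_ofReal (le_trans ?_ (Real.add_one_le_exp _))
  rw [integral_sub (integrable_const _) hsq, integral_const_mul, integral_const,
    probReal_univ, one_smul]
  linarith [mul_le_mul_of_nonneg_left (hμ.sqDist_div_le_integral_covariateLaw hK hh hμ') hc]

end Design

section Testing

variable {d : ℕ} {f : ℝ → ℝ} {K : ℝ}

/-- The test ratio of two regression models at an observation. -/
def modelRatio {X : Type*} (f : ℝ → ℝ) (μ σ μ' σ' : X → ℝ) (z : X × ℝ) : ℝ :=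
  testRatio (locScale f (μ z.1) (σ z.1) z.2) (locScale f (μ' z.1) (σ' z.1) z.2)

theorem measurable_modelRatio {X : Type*} [MeasurableSpace X] (hf : Measurable f)
    {μ σ μ' σ' : X → ℝ} (hμ : Measurable μ) (hσ : Measurable σ) (hμ' : Measurable μ')
    (hσ' : Measurable σ') : Measurable (modelRatio f μ σ μ' σ') := by
  unfold modelRatio testRatio locScale
  fun_prop

theorem RegularDensity.exists_lintegral_testRatio_le (hf : RegularDensity f) (M : ℝ) {a b : ℝ}
    (ha : 0 < a) (hb : 0 < b) : ∃ A > 0, ∃ c > 0, ∀ m₀ m m' σ₀ σ σ' ε : ℝ,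
      |m₀| ≤ M → |m| ≤ M → |m'| ≤ M → σ₀ ∈ Icc a b → σ ∈ Icc a b → σ' ∈ Icc a b →
      |m₀ - m| ≤ ε → |σ₀ - σ| ≤ ε → c * (m - m') ^ 2 ≤ 1 ∧
      ∫⁻ y, ENNReal.ofReal (testRatio (LocationScale.locScale f m σ y)
          (LocationScale.locScale f m' σ' y)) *
        ENNReal.ofReal (LocationScale.locScale f m₀ σ₀ y) ≤
        ENNReal.ofReal (1 + A * ε ^ 2 - c * (m - m') ^ 2) := by
  obtain ⟨A, hA, hellinger_le⟩ := hf.hellinger M a b ha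
  obtain ⟨c, hc, le_hellinger⟩ := hf.sq_sub_le_hellingerSq M ha hb
  refine ⟨12 * A, by positivity, c / 8, by positivity, ?_⟩
  intro m₀ m m' σ₀ σ σ' ε hm₀ hm hm' hσ₀ hσ hσ' hmε hσε
  have hp := hf.isProbDensity_locScale m (ha.trans_le hσ.1)
  have hq := hf.isProbDensity_locScale m' (ha.trans_le hσ'.1)
  have hr := hf.isProbDensity_locScale m₀ (ha.trans_le hσ₀.1)
  have separated := le_hellinger m m' σ σ' hm hm' hσ hσ'
  have close : hellingerSq volume (LocationScale.locScale f m₀ σ₀)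
      (LocationScale.locScale f m σ) ≤ A * (ε ^ 2 + ε ^ 2) :=
    (hellinger_le m₀ m σ₀ σ hm₀ hm hσ₀ hσ).trans (by
      gcongr A * (?_ + ?_)
      · exact sq_le_sq.2 (hmε.trans (le_abs_self ε))
      · exact sq_le_sq.2 (hσε.trans (le_abs_self ε)))
  refine ⟨by linarith [hp.hellingerSq_le_two hq], (hp.lintegral_testRatio_le hq hr).trans ?_⟩
  exact ENNReal.ofReal_le_ofReal (by linarith)

theorem RegularDensity.exists_lintegral_modelRatio_le (hf : RegularDensity f) (hK : 0 < K) (M : ℝ)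
    {a b : ℝ} (ha : 0 < a) (hb : 0 < b) : ∃ A > 0, ∃ c > 0,
    ∀ (μ₀ σ₀ μ σ μ' σ' h : (Fin d → ℝ) → ℝ) (ε : ℝ),
      Admissible M a b μ₀ σ₀ → Admissible M a b μ σ → Admissible M a b μ' σ' →
      h ∈ densityClass d K → (∀ x ∈ cube d, |μ₀ x - μ x| ≤ ε ∧ |σ₀ x - σ x| ≤ ε) →
      ∫⁻ z, ENNReal.ofReal (modelRatio f μ σ μ' σ' z) ∂(observationLaw f μ₀ σ₀ h) ≤
        ENNReal.ofReal (Real.exp (A * ε ^ 2 - c * sqDist μ μ')) := by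
  obtain ⟨A, hA, c, hc, fiber_le⟩ := hf.exists_lintegral_testRatio_le M ha hb
  refine ⟨A, hA, c * (1 / K), by positivity, ?_⟩
  intro μ₀ σ₀ μ σ μ' σ' h ε h₀ h₁ h₂ hh hclose
  have density_measurable :=
    measurable_responseDensity hf.measurable h₀.measurable_mean h₀.measurable_scale
  have ratio_measurable := (measurable_modelRatio hf.measurable h₁.measurable_mean
    h₁.measurable_scale h₂.measurable_mean h₂.measurable_scale).ennreal_ofReal
  have fiber := fun x hx => fiber_le (μ₀ x) (μ x) (μ' x) (σ₀ x) (σ x) (σ' x) ε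
    (h₀.abs_mean_le x hx) (h₁.abs_mean_le x hx) (h₂.abs_mean_le x hx) (h₀.scale_mem x hx)
    (h₁.scale_mem x hx) (h₂.scale_mem x hx) (hclose x hx).1 (hclose x hx).2
  rw [observationLaw_eq_withDensity hf.measurable h₀.measurable_mean h₀.measurable_scale
    h₀.scale_pos, lintegral_withDensity_eq_lintegral_mul _ density_measurable ratio_measurable,
    lintegral_prod _ (density_measurable.mul ratio_measurable).aemeasurable]
  refine le_trans (lintegral_mono_ae ?_) (h₁.lintegral_one_add_sub_sq_le hK.le hh h₂ hc.le
    fun x hx => by nlinarith [(fiber x hx).1, mul_nonneg hA.le (sq_nonneg ε)])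
  filter_upwards [ae_covariateLaw_mem_cube h] with x hx
  simpa only [Pi.mul_apply, responseDensity, modelRatio, mul_comm] using (fiber x hx).2

theorem lintegral_prod_modelRatio_le {n : ℕ} {μ₀ σ₀ μ σ μ' σ' h : (Fin d → ℝ) → ℝ} {u : ℝ}
    [IsProbabilityMeasure (observationLaw f μ₀ σ₀ h)] (hm : Measurable (modelRatio f μ σ μ' σ'))
    (hu : ∫⁻ z, ENNReal.ofReal (modelRatio f μ σ μ' σ' z) ∂(observationLaw f μ₀ σ₀ h) ≤
      ENNReal.ofReal (Real.exp u)) :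
    ∫⁻ S, ENNReal.ofReal (∏ k, modelRatio f μ σ μ' σ' (S k)) ∂(sampleLaw n f μ₀ σ₀ h) ≤
      ENNReal.ofReal (Real.exp (n * u)) := by
  simp_rw [fun S : Fin n → (Fin d → ℝ) × ℝ => ENNReal.ofReal_prod_of_nonneg (s := Finset.univ)
    (f := fun k => modelRatio f μ σ μ' σ' (S k)) fun _ _ => testRatio_nonneg _ _]
  rw [sampleLaw, lintegral_pi_prod_eq_prod fun _ => hm.ennreal_ofReal, Finset.prod_const,
    Finset.card_univ, Fintype.card_fin, Real.exp_nat_mul, ENNReal.ofReal_pow (Real.exp_pos _).le]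
  gcongr

variable {ι : Type*} [Finite ι] [Nonempty ι] {M a b : ℝ} {μ σ : ι → (Fin d → ℝ) → ℝ}

theorem RegularDensity.exists_measurable_model_selection [MeasurableSpace ι]
    [DiscreteMeasurableSpace ι] (hf : RegularDensity f) (n : ℕ) (D : ℝ)
    (hμ : ∀ i, Admissible M a b (μ i) (σ i)) :
    ∃ sel : (Fin n → (Fin d → ℝ) × ℝ) → ι, Measurable sel ∧
      ∀ S i, D < sqDist (μ i) (μ (sel S)) → ∃ j, D < sqDist (μ i) (μ j) ∧
        1 ≤ ∏ k, modelRatio f (μ i) (σ i) (μ j) (σ j) (S k) := by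
  refine exists_measurable_selection (far := fun i j => D < sqDist (μ i) (μ j))
    (fun i j => by rw [sqDist_comm]; exact id)
    (fun i j => Finset.measurable_prod _ fun k _ => ?_) (fun i j S => ?_)
    fun i j S => Finset.prod_nonneg fun k _ => testRatio_nonneg _ _
  · exact (measurable_modelRatio hf.measurable (hμ i).measurable_mean (hμ i).measurable_scale
      (hμ j).measurable_mean (hμ j).measurable_scale).comp (measurable_pi_apply k)
  · rw [← Finset.prod_mul_distrib]
    exact Finset.prod_eq_one fun k _ => testRatio_mul_testRatio
      (hf.locScale_pos _ ((hμ i).scale_pos _) _) (hf.locScale_pos _ ((hμ j).scale_pos _) _)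

theorem RegularDensity.exists_estimator_risk_le (hf : RegularDensity f) (hK : 0 < K) (M : ℝ)
    {a b : ℝ} (ha : 0 < a) (hb : 0 < b) : ∃ A > 0, ∃ c > 0, ∀ {ι : Type} [Fintype ι]
      [Nonempty ι] {μ σ : ι → (Fin d → ℝ) → ℝ} (n : ℕ) (D ε : ℝ),
      (∀ i, Admissible M a b (μ i) (σ i)) →
    ∃ est : (Fin n → (Fin d → ℝ) × ℝ) → (Fin d → ℝ) → ℝ, Measurable (Function.uncurry est) ∧
      ∀ {μ₀ σ₀ h : (Fin d → ℝ) → ℝ}, Admissible M a b μ₀ σ₀ → h ∈ densityClass d K →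
        (∃ i, ∀ x ∈ cube d, |μ₀ x - μ i x| ≤ ε ∧ |σ₀ x - σ i x| ≤ ε) →
        risk f μ₀ σ₀ h est ≤ ENNReal.ofReal (K * (2 * (ε ^ 2 + D))) +
          ENNReal.ofReal (K * (2 * M) ^ 2) *
            (Fintype.card ι * ENNReal.ofReal (Real.exp (n * (A * ε ^ 2 - c * D)))) := by
  obtain ⟨A, hA, c, hc, ratio_le⟩ := hf.exists_lintegral_modelRatio_le (d := d) hK M ha hb
  refine ⟨A, hA, c, hc, ?_⟩
  intro ι _ _ μ σ n D ε hμ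
  let _ : MeasurableSpace ι := ⊤
  obtain ⟨sel, sel_measurable, hsel⟩ := hf.exists_measurable_model_selection n D hμ
  refine ⟨fun S => μ (sel S), ?_, ?_⟩
  · exact (measurable_from_prod_countable_right (f := Function.uncurry μ)
      fun i => (hμ i).measurable_mean).comp
      ((sel_measurable.comp measurable_fst).prodMk measurable_snd)
  intro μ₀ σ₀ h h₀ hh ⟨i, hi⟩
  have := isProbabilityMeasure_observationLaw hf hK.le hh h₀.measurable_mean h₀.measurable_scale
  have ratio_measurable : ∀ j, Measurable (modelRatio f (μ i) (σ i) (μ j) (σ j)) := fun j =>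
    measurable_modelRatio hf.measurable (hμ i).measurable_mean (hμ i).measurable_scale
      (hμ j).measurable_mean (hμ j).measurable_scale
  have : IsProbabilityMeasure (sampleLaw n f μ₀ σ₀ h) := by unfold sampleLaw; infer_instance
  refine lintegral_loss_selection_le (far := fun j => D < sqDist (μ i) (μ j))
    (W := fun j S => ENNReal.ofReal (∏ k, modelRatio f (μ i) (σ i) (μ j) (σ j) (S k)))
    (loss := fun j => ∫⁻ x, ENNReal.ofReal ((μ₀ x - μ j x) ^ 2) ∂(covariateLaw h))
    (fun j => ?_) (fun S hfar => ?_) (fun j hnear => ?_) (fun j => ?_) fun j hfar => ?_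
  · exact (Finset.measurable_prod _ fun k _ =>
      (ratio_measurable j).comp (measurable_pi_apply k)).ennreal_ofReal
  · simpa only [ENNReal.one_le_ofReal] using hsel S i hfar
  · refine (h₀.lintegral_sq_sub_covariateLaw_le hK.le hh (hμ j)).trans
      (ENNReal.ofReal_le_ofReal ?_)
    gcongr
    exact (h₀.sqDist_le_of_abs_sub_le (hμ i) (hμ j) fun x hx => (hi x hx).1).trans
      (by linarith [not_lt.1 hnear])
  · refine (h₀.lintegral_sq_sub_covariateLaw_le hK.le hh (hμ j)).trans
      (ENNReal.ofReal_le_ofReal ?_)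
    gcongr
    exact h₀.sqDist_le (hμ j)
  · refine (lintegral_prod_modelRatio_le (ratio_measurable j)
      (ratio_le _ _ _ _ _ _ h ε h₀ (hμ i) (hμ j) hh hi)).trans (ENNReal.ofReal_le_ofReal ?_)
    gcongr

end Testing

section Codes

/-- The members of `S` can be encoded by at most `N` labels such that members with the same label
are related by `R`. Unlike a covering number, this is stable under finite intersections of
relations, whether or not these come from a metric. -/
def Codable {Θ : Type*} (S : Set Θ) (R : Θ → Θ → Prop) (N : ℝ) : Prop :=
  ∃ (T : Type) (_ : Fintype T) (code : S → T), (Fintype.card T : ℝ) ≤ N ∧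
    ∀ θ θ' : S, code θ = code θ' → R θ θ'

variable {Θ : Type*} {S : Set Θ}

namespace Codable

variable {R R' : Θ → Θ → Prop} {N N' : ℝ}

theorem mono (h : Codable S R N) (hR : ∀ θ ∈ S, ∀ θ' ∈ S, R θ θ' → R' θ θ') (hN : N ≤ N') :
    Codable S R' N' := by
  obtain ⟨T, _, code, hcard, hcode⟩ := h
  exact ⟨T, _, code, hcard.trans hN, fun θ θ' e => hR θ θ.2 θ' θ'.2 (hcode θ θ' e)⟩

theorem comap {Θ' : Type*} {S' : Set Θ'} (h : Codable S R N) {φ : Θ' → Θ} (hφ : MapsTo φ S' S) :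
    Codable S' (fun θ θ' => R (φ θ) (φ θ')) N := by
  obtain ⟨T, _, code, hcard, hcode⟩ := h
  exact ⟨T, _, code ∘ hφ.restrict, hcard, fun θ θ' e => hcode _ _ e⟩

theorem and (h : Codable S R N) (h' : Codable S R' N') :
    Codable S (fun θ θ' => R θ θ' ∧ R' θ θ') (N * N') := by
  obtain ⟨T, _, code, hcard, hcode⟩ := h
  obtain ⟨T', _, code', hcard', hcode'⟩ := h'
  refine ⟨T × T', inferInstance, fun θ => (code θ, code' θ), ?_, fun θ θ' e =>
    ⟨hcode _ _ (congrArg Prod.fst e), hcode' _ _ (congrArg Prod.snd e)⟩⟩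
  rw [Fintype.card_prod, Nat.cast_mul]
  exact mul_le_mul hcard hcard' (Nat.cast_nonneg _) ((Nat.cast_nonneg _).trans hcard)

theorem pi {κ : Type} [Fintype κ] {R : κ → Θ → Θ → Prop} (h : ∀ i, Codable S (R i) N) :
    Codable S (fun θ θ' => ∀ i, R i θ θ') (N ^ Fintype.card κ) := by
  classical
  choose T _ code hcard hcode using h
  refine ⟨∀ i, T i, inferInstance, fun θ i => code i θ, ?_, fun θ θ' e i =>
    hcode i _ _ (congrFun e i)⟩
  rw [Fintype.card_pi, Nat.cast_prod, ← Finset.card_univ]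
  exact (Finset.prod_le_prod (fun _ _ => Nat.cast_nonneg _) fun i _ => hcard i).trans_eq
    (Finset.prod_const N)

theorem of_int {v : Θ → ℤ} {V : ℝ} (hV : 0 ≤ V) (hv : ∀ θ ∈ S, |(v θ : ℝ)| ≤ V) :
    Codable S (fun θ θ' => v θ = v θ') (2 * V + 1) := by
  have mem_Icc : ∀ θ : S, v θ ∈ Finset.Icc (-⌊V⌋) ⌊V⌋ := fun θ => by
    rw [Finset.mem_Icc, ← abs_le]
    exact Int.le_floor.2 (by exact_mod_cast hv θ θ.2)
  refine ⟨Finset.Icc (-⌊V⌋) ⌊V⌋, inferInstance, fun θ => ⟨v θ, mem_Icc θ⟩, ?_,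
    fun θ θ' e => congrArg Subtype.val e⟩
  have card_eq : ((Fintype.card (Finset.Icc (-⌊V⌋) ⌊V⌋) : ℕ) : ℤ) = 2 * ⌊V⌋ + 1 := by
    rw [Fintype.card_coe, Int.card_Icc]
    have := Int.floor_nonneg.2 hV
    omega
  have card_eq_real : ((Fintype.card (Finset.Icc (-⌊V⌋) ⌊V⌋) : ℕ) : ℝ) = 2 * ⌊V⌋ + 1 := by
    exact_mod_cast card_eq
  rw [card_eq_real]
  gcongr
  exact Int.floor_le V

theorem floor {v : Θ → ℝ} {V : ℝ} (hV : 0 ≤ V) (hv : ∀ θ ∈ S, |v θ| ≤ V) :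
    Codable S (fun θ θ' => ⌊v θ⌋ = ⌊v θ'⌋) (2 * V + 3) := by
  refine (of_int (V := V + 1) (by positivity) fun θ hθ => ?_).mono (fun _ _ _ _ e => e)
    (by linarith)
  have := abs_le.1 (hv θ hθ)
  rw [abs_le]
  constructor <;> linarith [Int.floor_le (v θ), Int.sub_one_lt_floor (v θ)]

theorem of_real {v : Θ → ℝ} {V η : ℝ} (hη : 0 < η) (hV : 0 ≤ V) (hv : ∀ θ ∈ S, |v θ| ≤ V) :
    Codable S (fun θ θ' => |v θ - v θ'| ≤ η) (2 * (V / η) + 3) := by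
  refine (floor (v := fun θ => v θ / η) (div_nonneg hV hη.le) fun θ hθ => ?_).mono
    (fun θ _ θ' _ e => ?_) le_rfl
  · rw [abs_div, abs_of_pos hη]
    exact div_le_div_of_nonneg_right (hv θ hθ) hη.le
  · have := Int.abs_sub_lt_one_of_floor_eq_floor e
    rw [← sub_div, abs_div, abs_of_pos hη, div_lt_one hη] at this
    exact this.le

theorem exists_net (h : Codable S R N) (hS : S.Nonempty) :
    ∃ (ι : Type) (_ : Fintype ι) (_ : Nonempty ι) (net : ι → Θ), (Fintype.card ι : ℝ) ≤ N ∧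
      (∀ i, net i ∈ S) ∧ ∀ θ ∈ S, ∃ i, R θ (net i) := by
  classical
  obtain ⟨T, _, code, hcard, hcode⟩ := h
  have := hS.to_subtype
  refine ⟨range code, inferInstance, inferInstance, fun t => (t.2.choose : S), ?_,
    fun t => t.2.choose.2, fun θ hθ => ⟨⟨code ⟨θ, hθ⟩, mem_range_self _⟩, ?_⟩⟩
  · exact le_trans (by exact_mod_cast Fintype.card_subtype_le _) hcard
  · exact hcode ⟨θ, hθ⟩ _ (mem_range_self (f := code) ⟨θ, hθ⟩).choose_spec.symm

/-- The difference of the integer parts of the state and of its predicted value is bounded, so it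
suffices to encode the initial integer parts and these differences. -/
theorem recursion {κ : Type} [Fintype κ] {u : Θ → ℕ → κ → ℝ} {W : κ → κ → ℝ} {A : ℝ}
    (hA : 0 ≤ A) (hW : ∀ k l, |W k l| ≤ 1)
    (hinit : ∀ k, Codable S (fun θ θ' => ⌊u θ 0 k⌋ = ⌊u θ' 0 k⌋) N)
    (hrec : ∀ θ ∈ S, ∀ j k, |u θ (j + 1) k - ∑ l, W k l * u θ j l| ≤ A) (m : ℕ) :
    Codable S (fun θ θ' => ∀ j ≤ m, ∀ k, ⌊u θ j k⌋ = ⌊u θ' j k⌋) (N ^ Fintype.card κ *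
      ((2 * (A + Fintype.card κ + 1) + 1) ^ Fintype.card κ) ^ m) := by
  set predicted : Θ → ℕ → κ → ℤ := fun θ j k => ⌊∑ l, W k l * (⌊u θ j l⌋ : ℝ)⌋ with hpredicted
  have rounding_le : ∀ θ j k,
      |∑ l, W k l * u θ j l - ∑ l, W k l * (⌊u θ j l⌋ : ℝ)| ≤ Fintype.card κ := by
    intro θ j k
    simp_rw [← Finset.sum_sub_distrib, ← mul_sub]
    refine (Finset.abs_sum_le_sum_abs _ _).trans
      ((Finset.sum_le_card_nsmul _ _ 1 fun l _ => ?_).trans_eq (nsmul_one _))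
    rw [abs_mul, Int.self_sub_floor, Int.abs_fract]
    exact mul_le_one₀ (hW k l) (Int.fract_nonneg _) (Int.fract_lt_one _).le
  have increment : ∀ (j : Fin m) k, Codable S (fun θ θ' => ⌊u θ (j + 1) k⌋ - predicted θ j k =
      ⌊u θ' (j + 1) k⌋ - predicted θ' j k) (2 * (A + Fintype.card κ + 1) + 1) := by
    refine fun j k => of_int (by positivity) fun θ hθ => ?_
    have hu := abs_le.1 (hrec θ hθ j k)
    have hround := abs_le.1 (rounding_le θ j k)
    rw [hpredicted, Int.cast_sub, abs_le]
    constructor <;> linarith [Int.floor_le (u θ (j + 1) k), Int.sub_one_lt_floor (u θ (j + 1) k),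
      Int.floor_le (∑ l, W k l * (⌊u θ j l⌋ : ℝ)),
      Int.sub_one_lt_floor (∑ l, W k l * (⌊u θ j l⌋ : ℝ))]
  have joint := (pi hinit).and (pi fun j => pi (increment j))
  rw [Fintype.card_fin] at joint
  refine joint.mono (fun θ _ θ' _ ⟨init, incr⟩ j => ?_) le_rfl
  induction j with
  | zero => exact fun _ => init
  | succ j ih =>
    intro hj k
    have predicted_eq : predicted θ j k = predicted θ' j k := by
      simp only [hpredicted, ih (by omega)]
    have := incr ⟨j, by omega⟩ k
    simp only [predicted_eq] at this
    exact sub_left_inj.1 this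

end Codable

/-- The relations `R δ` at scale `δ` can be encoded by `exp (A / δ)` labels, for some `A`. -/
def ExpCodable (S : Set Θ) (R : ℝ → Θ → Θ → Prop) : Prop :=
  ∃ A ≥ 0, ∀ δ, 0 < δ → δ ≤ 1 → Codable S (R δ) (Real.exp (A / δ))

theorem rpow_neg_le_exp {δ q : ℝ} (hδ : 0 < δ) (hq : 0 ≤ q) : δ ^ (-q) ≤ Real.exp (q / δ) := by
  rw [Real.rpow_def_of_pos hδ, Real.exp_le_exp, div_eq_mul_inv]
  nlinarith [Real.one_sub_inv_le_log_of_pos hδ]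

theorem mul_rpow_neg_add_le_exp {δ a b q : ℝ} (hδ : 0 < δ) (hδ₁ : δ ≤ 1) (ha : 0 ≤ a)
    (hb : 0 ≤ b) (hq : 0 ≤ q) : a * δ ^ (-q) + b ≤ Real.exp ((a + b + q) / δ) := by
  have one_le : 1 ≤ δ ^ (-q) :=
    Real.one_le_rpow_of_pos_of_le_one_of_nonpos hδ hδ₁ (neg_nonpos.2 hq)
  have add_le : a + b ≤ Real.exp ((a + b) / δ) := by
    linarith [Real.add_one_le_exp ((a + b) / δ), le_div_self (add_nonneg ha hb) hδ hδ₁]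
  calc a * δ ^ (-q) + b ≤ (a + b) * δ ^ (-q) := by nlinarith
    _ ≤ Real.exp ((a + b) / δ) * Real.exp (q / δ) :=
        mul_le_mul add_le (rpow_neg_le_exp hδ hq) (by positivity) (Real.exp_pos _).le
    _ = Real.exp ((a + b + q) / δ) := by rw [← Real.exp_add, ← add_div]

namespace ExpCodable

variable {R R' : ℝ → Θ → Θ → Prop}

theorem mono (h : ExpCodable S R)
    (hR : ∀ δ, 0 < δ → δ ≤ 1 → ∀ θ ∈ S, ∀ θ' ∈ S, R δ θ θ' → R' δ θ θ') : ExpCodable S R' := by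
  obtain ⟨A, hA, h⟩ := h
  exact ⟨A, hA, fun δ h0 h1 => (h δ h0 h1).mono (hR δ h0 h1) le_rfl⟩

theorem comap {Θ' : Type*} {S' : Set Θ'} (h : ExpCodable S R) {φ : Θ' → Θ} (hφ : MapsTo φ S' S) :
    ExpCodable S' (fun δ θ θ' => R δ (φ θ) (φ θ')) := by
  obtain ⟨A, hA, h⟩ := h
  exact ⟨A, hA, fun δ h0 h1 => (h δ h0 h1).comap hφ⟩

theorem and (h : ExpCodable S R) (h' : ExpCodable S R') :
    ExpCodable S (fun δ θ θ' => R δ θ θ' ∧ R' δ θ θ') := by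
  obtain ⟨A, hA, h⟩ := h
  obtain ⟨A', hA', h'⟩ := h'
  refine ⟨A + A', add_nonneg hA hA', fun δ h0 h1 => ?_⟩
  rw [add_div, Real.exp_add]
  exact (h δ h0 h1).and (h' δ h0 h1)

theorem pi {κ : Type} [Finite κ] {R : κ → ℝ → Θ → Θ → Prop} (h : ∀ i, ExpCodable S (R i)) :
    ExpCodable S (fun δ θ θ' => ∀ i, R i δ θ θ') := by
  have := Fintype.ofFinite κ
  choose A hA h using h
  refine ⟨Fintype.card κ * ∑ i, A i, mul_nonneg (Nat.cast_nonneg _)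
    (Finset.sum_nonneg fun i _ => hA i), fun δ h0 h1 => ?_⟩
  rw [mul_div_assoc, Real.exp_nat_mul]
  refine Codable.pi fun i => (h i δ h0 h1).mono (fun _ _ _ _ h => h) ?_
  gcongr
  exact Finset.single_le_sum (fun i _ => hA i) (Finset.mem_univ i)

theorem of_real {v : Θ → ℝ} {V k q : ℝ} (hk : 0 < k) (hq : 0 ≤ q) (hV : 0 ≤ V)
    (hv : ∀ θ ∈ S, |v θ| ≤ V) : ExpCodable S (fun δ θ θ' => |v θ - v θ'| ≤ k * δ ^ q) := by
  refine ⟨2 * (V / k) + 3 + q, by positivity, fun δ h0 h1 => ?_⟩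
  refine (Codable.of_real (η := k * δ ^ q) (by positivity) hV hv).mono (fun _ _ _ _ h => h) ?_
  refine le_trans (le_of_eq ?_) (mul_rpow_neg_add_le_exp h0 h1 (by positivity) (by norm_num) hq)
  rw [Real.rpow_neg h0.le]
  field_simp

end ExpCodable

end Codes

section HolderEntropy

variable {s : ℕ} {γ L : ℝ} {B : ℕ → ℝ} {g g' : ℝ → ℝ}

theorem iteratedDeriv_iteratedDeriv (i k : ℕ) (g : ℝ → ℝ) :
    iteratedDeriv i (iteratedDeriv k g) = iteratedDeriv (i + k) g := by
  simp only [iteratedDeriv_eq_iterate, Function.iterate_add_apply]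

theorem abs_sub_taylor_le (hγ : 0 < γ) (hg : ContDiff ℝ s g)
    (hH : ∀ z z', |iteratedDeriv s g z - iteratedDeriv s g z'| ≤ L * |z - z'| ^ γ)
    (t : ℝ) {r : ℝ} (hr : 0 ≤ r) :
    |g (t + r) - ∑ i ∈ Finset.range (s + 1), iteratedDeriv i g t * (r ^ i / i.factorial)| ≤
      L * r ^ (s + γ) := by
  rcases hr.eq_or_lt with rfl | hr
  · have : (s : ℝ) + γ ≠ 0 := by positivity
    simp [Finset.sum_range_succ', Real.zero_rpow this]
  rcases s with _ | s
  · simpa [abs_of_pos hr] using hH (t + r) t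
  have hlt : t < t + r := lt_add_of_pos_right t hr
  obtain ⟨ξ, hξ, remainder_eq⟩ :=
    taylor_mean_remainder_lagrange_iteratedDeriv (n := s) hlt.ne hg.contDiffOn
  rw [uIoo_of_lt hlt] at hξ
  have taylor_eq : taylorWithinEval g s (uIcc t (t + r)) t (t + r) =
      ∑ i ∈ Finset.range (s + 1), iteratedDeriv i g t * (r ^ i / i.factorial) := by
    rw [taylor_within_apply]
    refine Finset.sum_congr rfl fun i hi => ?_
    rw [iteratedDerivWithin_eq_iteratedDeriv (uniqueDiffOn_uIcc hlt.ne)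
      (hg.of_le (by exact_mod_cast (Finset.mem_range.1 hi).le)).contDiffAt left_mem_uIcc,
      add_sub_cancel_left, smul_eq_mul]
    ring
  rw [taylor_eq, add_sub_cancel_left] at remainder_eq
  have error_eq : g (t + r) - ∑ i ∈ Finset.range (s + 2),
      iteratedDeriv i g t * (r ^ i / i.factorial) =
      (iteratedDeriv (s + 1) g ξ - iteratedDeriv (s + 1) g t) *
        (r ^ (s + 1) / (s + 1).factorial) := by
    rw [Finset.sum_range_succ, ← sub_sub, remainder_eq]
    ring
  rw [error_eq, abs_mul, abs_of_nonneg (a := r ^ (s + 1) / _) (by positivity)]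
  have hξ_le : |ξ - t| ^ γ ≤ r ^ γ :=
    Real.rpow_le_rpow (abs_nonneg _) (by rw [abs_of_pos] <;> linarith [hξ.1, hξ.2]) hγ.le
  have hL : 0 ≤ L := by
    simpa using (abs_nonneg _).trans (hH 1 0)
  calc |iteratedDeriv (s + 1) g ξ - iteratedDeriv (s + 1) g t| *
        (r ^ (s + 1) / (s + 1).factorial)
      ≤ L * r ^ γ * r ^ (s + 1) := by
        gcongr
        · exact (hH ξ t).trans (by gcongr)
        · exact div_le_self (by positivity) (by exact_mod_cast (s + 1).factorial_pos)
    _ = L * r ^ ((s + 1 : ℕ) + γ) := by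
        rw [Real.rpow_add hr, Real.rpow_natCast]
        ring

theorem abs_iteratedDeriv_sub_taylor_le (hγ : 0 < γ) (hg : g ∈ holderClass s γ L B) {k : ℕ}
    (hk : k ≤ s) (t : ℝ) {r : ℝ} (hr : 0 ≤ r) :
    |iteratedDeriv k g (t + r) - ∑ i ∈ Finset.range (s - k + 1),
      iteratedDeriv (i + k) g t * (r ^ i / i.factorial)| ≤ L * r ^ (s - k + γ) := by
  obtain ⟨m, rfl⟩ := Nat.exists_eq_add_of_le' hk
  have smooth : ContDiff ℝ m (iteratedDeriv k g) := by
    rw [iteratedDeriv_eq_iterate]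
    exact ContDiff.iterate_deriv' m k (by exact_mod_cast hg.1)
  have := abs_sub_taylor_le hγ smooth
    (by simpa only [iteratedDeriv_iteratedDeriv] using hg.2.1) t hr
  simpa only [iteratedDeriv_iteratedDeriv, Nat.add_sub_cancel, Nat.cast_add,
    add_sub_cancel_right] using this

theorem abs_sub_le_of_abs_iteratedDeriv_sub_le (hγ : 0 < γ) (hL : 0 ≤ L)
    (hg : g ∈ holderClass s γ L B) (hg' : g' ∈ holderClass s γ L B) {t r δ : ℝ} (hr : 0 ≤ r)
    (hrδ : r ≤ δ) (hδ : 0 < δ)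
    (hclose : ∀ i ≤ s, |iteratedDeriv i g t - iteratedDeriv i g' t| ≤ δ ^ (s + γ - i)) :
    |g (t + r) - g' (t + r)| ≤ (s + 1 + 2 * L) * δ ^ (s + γ) := by
  have remainder_le : L * r ^ (s + γ) ≤ L * δ ^ (s + γ) := by gcongr
  have taylor := abs_sub_taylor_le hγ hg.1 hg.2.1 t hr
  have taylor' := abs_sub_taylor_le hγ hg'.1 hg'.2.1 t hr
  have polynomials_close :
      |∑ i ∈ Finset.range (s + 1), iteratedDeriv i g t * (r ^ i / i.factorial) -
        ∑ i ∈ Finset.range (s + 1), iteratedDeriv i g' t * (r ^ i / i.factorial)| ≤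
      (s + 1) * δ ^ (s + γ) := by
    simp_rw [← Finset.sum_sub_distrib, ← sub_mul]
    refine (Finset.abs_sum_le_sum_abs _ _).trans
      ((Finset.sum_le_card_nsmul _ _ (δ ^ (s + γ)) fun i hi => ?_).trans_eq
        (by rw [Finset.card_range, nsmul_eq_mul, Nat.cast_succ]))
    have hi : i ≤ s := Nat.lt_succ_iff.1 (Finset.mem_range.1 hi)
    have monomial_le : r ^ i / i.factorial ≤ δ ^ i :=
      (div_le_self (by positivity) (by exact_mod_cast i.factorial_pos)).trans (by gcongr)
    rw [abs_mul, abs_of_nonneg (a := r ^ i / _) (by positivity)]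
    calc _ ≤ δ ^ (s + γ - i) * δ ^ i :=
          mul_le_mul (hclose i hi) monomial_le (by positivity) (by positivity)
      _ = δ ^ (s + γ) := by rw [← Real.rpow_natCast, ← Real.rpow_add hδ, sub_add_cancel]
  rw [abs_le] at taylor taylor' polynomials_close ⊢
  constructor <;> linarith

/-- The coefficient of the `l`-th derivative in the Taylor expansion of the `k`-th derivative at
distance `1`. -/
def taylorCoeff (k l : ℕ) : ℝ := if k ≤ l then ((l - k).factorial : ℝ)⁻¹ else 0

theorem abs_taylorCoeff_le_one (k l : ℕ) : |taylorCoeff k l| ≤ 1 := by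
  unfold taylorCoeff
  split_ifs
  · rw [abs_of_nonneg (by positivity)]
    exact inv_le_one_of_one_le₀ (by exact_mod_cast Nat.factorial_pos _)
  · simp

theorem sum_taylorCoeff_mul {k : ℕ} (hk : k ≤ s) (x : ℕ → ℝ) :
    ∑ l : Fin (s + 1), taylorCoeff k l * x l =
      ∑ i ∈ Finset.range (s - k + 1), x (i + k) / i.factorial := by
  rw [Fin.sum_univ_eq_sum_range (fun l => taylorCoeff k l * x l),
    ← Finset.sum_range_add_sum_Ico _ (hk.trans (Nat.le_succ s)),
    Finset.sum_Ico_eq_sum_range, Nat.succ_sub hk]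
  have vanish : ∑ l ∈ Finset.range k, taylorCoeff k l * x l = 0 :=
    Finset.sum_eq_zero fun l hl => by
      rw [taylorCoeff, if_neg (not_le.2 (Finset.mem_range.1 hl)), zero_mul]
  rw [vanish, zero_add]
  refine Finset.sum_congr rfl fun i _ => ?_
  rw [taylorCoeff, if_pos (Nat.le_add_right k i), Nat.add_sub_cancel_left, add_comm k i,
    inv_mul_eq_div]

/-- The `k`-th derivative at the `j`-th point of the grid of mesh `δ` that starts at `t₀`, in the
unit `δ ^ (q - k)`, for a function with `q` derivatives in the Hölder sense. -/
def gridJet (q δ t₀ : ℝ) (g : ℝ → ℝ) (j k : ℕ) : ℝ :=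
  iteratedDeriv k g (t₀ + j * δ) / δ ^ (q - k)

theorem abs_gridJet_zero_le (hg : g ∈ holderClass s γ L B) {b : ℝ} (hb₀ : 0 ≤ b) {k : ℕ}
    (hk : k ≤ s) (hb : B k ≤ b) {q δ : ℝ} (hδ : 0 < δ) (hδ₁ : δ ≤ 1) (t₀ : ℝ) :
    |gridJet q δ t₀ g 0 k| ≤ b * δ ^ (-q) := by
  rw [gridJet, abs_div, abs_of_pos (Real.rpow_pos_of_pos hδ _), div_eq_mul_inv,
    ← Real.rpow_neg hδ.le]
  have exponent_le : -q ≤ -(q - k) := by linarith [Nat.cast_nonneg (α := ℝ) k]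
  exact mul_le_mul ((hg.2.2 k hk _).trans hb)
    (Real.rpow_le_rpow_of_exponent_ge hδ hδ₁ exponent_le) (by positivity) hb₀

theorem abs_gridJet_succ_sub_le (hγ : 0 < γ) (hg : g ∈ holderClass s γ L B) {k : ℕ} (hk : k ≤ s)
    {δ : ℝ} (hδ : 0 < δ) (t₀ : ℝ) (j : ℕ) :
    |gridJet (s + γ) δ t₀ g (j + 1) k -
      ∑ l : Fin (s + 1), taylorCoeff k l * gridJet (s + γ) δ t₀ g j l| ≤ L := by
  have unit_pos : 0 < δ ^ (s + γ - k) := Real.rpow_pos_of_pos hδ _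
  have taylor := abs_iteratedDeriv_sub_taylor_le hγ hg hk (t₀ + j * δ) hδ.le
  have error_eq : gridJet (s + γ) δ t₀ g (j + 1) k -
      ∑ l : Fin (s + 1), taylorCoeff k l * gridJet (s + γ) δ t₀ g j l =
      (iteratedDeriv k g (t₀ + j * δ + δ) - ∑ i ∈ Finset.range (s - k + 1),
        iteratedDeriv (i + k) g (t₀ + j * δ) * (δ ^ i / i.factorial)) / δ ^ (s + γ - k) := by
    rw [sum_taylorCoeff_mul hk, sub_div, Finset.sum_div, gridJet, Nat.cast_succ, add_one_mul,
      add_assoc]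
    congr 1
    refine Finset.sum_congr rfl fun i _ => ?_
    have unit_eq : δ ^ (s + γ - k) = δ ^ (s + γ - (i + k : ℕ)) * δ ^ i := by
      rw [← Real.rpow_natCast, ← Real.rpow_add hδ]
      push_cast
      ring_nf
    rw [gridJet, unit_eq]
    field_simp
  rw [error_eq, abs_div, abs_of_pos unit_pos, div_le_iff₀ unit_pos]
  exact taylor.trans_eq (by ring_nf)

theorem abs_sub_le_of_floor_gridJet_eq (hγ : 0 < γ) (hL : 0 ≤ L) (hg : g ∈ holderClass s γ L B)
    (hg' : g' ∈ holderClass s γ L B) {δ t₀ T : ℝ} (hδ : 0 < δ)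
    (hfloor : ∀ j ≤ ⌈T / δ⌉₊, ∀ k : Fin (s + 1),
      ⌊gridJet (s + γ) δ t₀ g j k⌋ = ⌊gridJet (s + γ) δ t₀ g' j k⌋)
    {z : ℝ} (hz : z ∈ Icc t₀ (t₀ + T)) :
    |g z - g' z| ≤ (s + 1 + 2 * L) * δ ^ (s + γ) := by
  set j := ⌊(z - t₀) / δ⌋₊
  have hj : j ≤ ⌈T / δ⌉₊ :=
    (Nat.floor_le_floor (by gcongr; linarith [hz.2])).trans (Nat.floor_le_ceil (T / δ))
  have grid_le : j * δ ≤ z - t₀ :=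
    (le_div_iff₀ hδ).1 (Nat.floor_le (div_nonneg (sub_nonneg.2 hz.1) hδ.le))
  have le_grid : z - t₀ < (j + 1) * δ := (div_lt_iff₀ hδ).1 (Nat.lt_floor_add_one _)
  have close : ∀ i ≤ s, |iteratedDeriv i g (t₀ + j * δ) - iteratedDeriv i g' (t₀ + j * δ)| ≤
      δ ^ (s + γ - i) := by
    intro i hi
    have unit_pos : 0 < δ ^ (s + γ - i) := Real.rpow_pos_of_pos hδ _
    have := Int.abs_sub_lt_one_of_floor_eq_floor (hfloor j hj ⟨i, Nat.lt_succ_of_le hi⟩)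
    simp only [gridJet] at this
    rw [← sub_div, abs_div, abs_of_pos unit_pos, div_lt_one unit_pos] at this
    exact this.le
  have := abs_sub_le_of_abs_iteratedDeriv_sub_le hγ hL hg hg' (r := z - (t₀ + j * δ))
    (by linarith) (by linarith) hδ close
  rwa [add_sub_cancel] at this

theorem codable_holderClass (hγ : 0 < γ) (hL : 0 ≤ L) {b : ℝ} (hb₀ : 0 ≤ b)
    (hb : ∀ k ≤ s, B k ≤ b) (t₀ T : ℝ) {δ : ℝ} (hδ : 0 < δ) (hδ₁ : δ ≤ 1) :
    Codable (holderClass s γ L B)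
      (fun g g' => ∀ z ∈ Icc t₀ (t₀ + T), |g z - g' z| ≤ (s + 1 + 2 * L) * δ ^ (s + γ))
      ((2 * (b * δ ^ (-(s + γ))) + 3) ^ (s + 1) *
        ((2 * (L + (s + 1) + 1) + 1) ^ (s + 1)) ^ ⌈T / δ⌉₊) := by
  have jets := Codable.recursion (S := holderClass s γ L B) (κ := Fin (s + 1)) hL
    (u := fun g j k => gridJet (s + γ) δ t₀ g j k)
    (fun k l => abs_taylorCoeff_le_one k l)
    (fun k => Codable.floor (by positivity) fun g hg =>
      abs_gridJet_zero_le hg hb₀ (Nat.lt_succ_iff.1 k.2) (hb k (Nat.lt_succ_iff.1 k.2)) hδ hδ₁ t₀)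
    (fun g hg j k => abs_gridJet_succ_sub_le hγ hg (Nat.lt_succ_iff.1 k.2) hδ t₀ j) ⌈T / δ⌉₊
  refine jets.mono (fun g hg g' hg' hfloor z hz => ?_) ?_
  · exact abs_sub_le_of_floor_gridJet_eq hγ hL hg hg' hδ hfloor hz
  · simp only [Fintype.card_fin, Nat.cast_succ, le_refl]

theorem expCodable_holderClass (hγ : 0 < γ) (hL : 0 ≤ L) (t₀ : ℝ) {T : ℝ} (hT : 0 ≤ T) :
    ExpCodable (holderClass s γ L B) (fun δ g g' =>
      ∀ z ∈ Icc t₀ (t₀ + T), |g z - g' z| ≤ (s + 1 + 2 * L) * δ ^ (s + γ)) := by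
  set b := ∑ k ∈ Finset.range (s + 1), |B k|
  have hb : ∀ k ≤ s, B k ≤ b := fun k hk => (le_abs_self _).trans
    (Finset.single_le_sum (f := fun k => |B k|) (fun _ _ => abs_nonneg _)
      (Finset.mem_range.2 (Nat.lt_succ_of_le hk)))
  have hb₀ : 0 ≤ b := Finset.sum_nonneg fun _ _ => abs_nonneg _
  set Q : ℝ := 2 * (L + (s + 1) + 1) + 1
  have one_le_Q : 1 ≤ Q := le_add_of_nonneg_left (by positivity)
  have log_nonneg : 0 ≤ Real.log Q := Real.log_nonneg one_le_Q
  refine ⟨(s + 1 : ℕ) * (2 * b + 3 + (s + γ)) + (T + 1) * ((s + 1 : ℕ) * Real.log Q),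
    by positivity, fun δ hδ hδ₁ => (codable_holderClass hγ hL hb₀ hb t₀ T hδ hδ₁).mono
      (fun _ _ _ _ h => h) ?_⟩
  rw [add_div, Real.exp_add, mul_div_assoc, Real.exp_nat_mul, ← mul_assoc 2 b]
  gcongr
  · exact mul_rpow_neg_add_le_exp hδ hδ₁ (by positivity) (by norm_num) (by positivity)
  · have steps_le : (⌈T / δ⌉₊ : ℝ) ≤ (T + 1) / δ := by
      rw [add_div]
      linarith [Nat.ceil_lt_add_one (div_nonneg hT hδ.le), (one_le_div hδ).2 hδ₁]
    rw [← pow_mul, ← Real.rpow_natCast, Real.rpow_def_of_pos (by positivity), Real.exp_le_exp]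
    calc Real.log Q * ((s + 1) * ⌈T / δ⌉₊ : ℕ) = ⌈T / δ⌉₊ * ((s + 1 : ℕ) * Real.log Q) := by
          push_cast
          ring
      _ ≤ (T + 1) / δ * ((s + 1 : ℕ) * Real.log Q) := by gcongr
      _ = (T + 1) * ((s + 1 : ℕ) * Real.log Q) / δ := by ring

end HolderEntropy

section Models

theorem abs_sub_le_of_mem_holderClass {s : ℕ} {γ L : ℝ} {B : ℕ → ℝ} {g : ℝ → ℝ} (hγ₁ : γ ≤ 1)
    (hg : g ∈ holderClass s γ L B) {z z' : ℝ} (hz : |z - z'| ≤ 1) :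
    |g z - g z'| ≤ max L (B 1) * |z - z'| ^ γ := by
  rcases Nat.eq_zero_or_pos s with rfl | hs
  · refine le_trans ?_ (mul_le_mul_of_nonneg_right (le_max_left L (B 1))
      (Real.rpow_nonneg (abs_nonneg _) γ))
    simpa only [iteratedDeriv_zero] using hg.2.1 z z'
  · have deriv_le : ∀ x, ‖deriv g x‖ ≤ B 1 := fun x => by
      simpa only [iteratedDeriv_one, Real.norm_eq_abs] using hg.2.2 1 hs x
    have lipschitz : |g z - g z'| ≤ B 1 * |z - z'| :=
      convex_univ.norm_image_sub_le_of_norm_deriv_le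
        (fun x _ => hg.1.differentiable (by exact_mod_cast hs.ne') x)
        (fun x _ => deriv_le x) (mem_univ z') (mem_univ z)
    have le_rpow : |z - z'| ≤ |z - z'| ^ γ := by
      rcases (abs_nonneg (z - z')).eq_or_lt with h0 | h0
      · rw [← h0]
        exact Real.rpow_nonneg le_rfl _
      · simpa only [Real.rpow_one] using Real.rpow_le_rpow_of_exponent_ge h0 hz hγ₁
    exact lipschitz.trans (mul_le_mul (le_max_right _ _) le_rpow (abs_nonneg _)
      (((norm_nonneg _).trans (deriv_le 0)).trans (le_max_right _ _)))

theorem abs_sum_mul_le {d : ℕ} {b x : Fin d → ℝ} {η : ℝ} (hb : ∀ j, |b j| ≤ η)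
    (hx : x ∈ cube d) : |∑ j, b j * x j| ≤ d * η := by
  refine (Finset.abs_sum_le_sum_abs _ _).trans ?_
  calc ∑ j, |b j * x j| ≤ ∑ _j : Fin d, η := by
        refine Finset.sum_le_sum fun j _ => ?_
        rw [abs_mul, abs_of_nonneg (hx.1 j)]
        exact (mul_le_of_le_one_right (abs_nonneg _) (hx.2 j)).trans (hb j)
    _ = d * η := by rw [Finset.sum_const, Finset.card_univ, Fintype.card_fin, nsmul_eq_mul]

theorem abs_sum_mul_sub_sum_mul_le {d : ℕ} {b b' x : Fin d → ℝ} {η : ℝ} (hη : 0 ≤ η)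
    (hb : ∀ j, |b j - b' j| ≤ 1 / (d + 1) * η) (hx : x ∈ cube d) :
    |∑ j, b j * x j - ∑ j, b' j * x j| ≤ η := by
  rw [← Finset.sum_sub_distrib]
  simp_rw [← sub_mul]
  calc |∑ j, (b j - b' j) * x j| ≤ d * (1 / (d + 1) * η) := abs_sum_mul_le hb hx
    _ = d / (d + 1) * η := by ring
    _ ≤ η := mul_le_of_le_one_left hη (div_le_one_of_le₀ (by linarith) (by positivity))

theorem abs_exp_sub_exp_le {a b c : ℝ} (ha : a ≤ c) (hb : b ≤ c) :
    |Real.exp a - Real.exp b| ≤ Real.exp c * |a - b| :=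
  (convex_Iic c).norm_image_sub_le_of_norm_deriv_le (fun _ _ => Real.differentiableAt_exp)
    (fun x hx => by
      rw [Real.deriv_exp, Real.norm_eq_abs, Real.abs_exp]
      exact Real.exp_le_exp.2 hx) hb ha

/-- The parameters of a regression model: profiles and directions of the regression function, and
coefficients of the logarithm of the scale function. -/
structure ModelParam (d p : ℕ) where
  profile : Fin p → ℝ → ℝ
  direction : Fin p → EuclideanSpace ℝ (Fin d)
  logScale : Fin d → ℝ

namespace ModelParam

variable {d p : ℕ}

/-- The regression function of a model. -/
def mean (θ : ModelParam d p) (x : Fin d → ℝ) : ℝ :=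
  ∑ i, θ.profile i (∑ j, θ.direction i j * x j)

/-- The scale function of a model. -/
def scale (θ : ModelParam d p) (x : Fin d → ℝ) : ℝ := Real.exp (∑ j, θ.logScale j * x j)

end ModelParam

/-- The parameters that satisfy the constraints of the model classes, except that profiles may be
constant and directions may coincide. -/
def modelParams (d p s : ℕ) (γ L : ℝ) (B : ℕ → ℝ) (C : ℝ) : Set (ModelParam d p) :=
  {θ | (∀ i, θ.profile i ∈ holderClass s γ L B) ∧ (∀ i, ‖θ.direction i‖ = 1) ∧
    ∀ j, |θ.logScale j| ≤ C}

variable {d p s : ℕ} {γ L : ℝ} {B : ℕ → ℝ} {C : ℝ} {θ θ' : ModelParam d p}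

theorem abs_direction_le_one (hθ : θ ∈ modelParams d p s γ L B C) (i : Fin p) (j : Fin d) :
    |θ.direction i j| ≤ 1 :=
  (PiLp.norm_apply_le (θ.direction i) j).trans_eq (hθ.2.1 i)

theorem admissible_of_mem_modelParams (hθ : θ ∈ modelParams d p s γ L B C) :
    Admissible (p * B 0) (Real.exp (-(d * C))) (Real.exp (d * C)) θ.mean θ.scale where
  measurable_mean := by
    have : ∀ i, Measurable (θ.profile i) := fun i => (hθ.1 i).1.continuous.measurable
    unfold ModelParam.mean
    fun_prop
  measurable_scale := by
    unfold ModelParam.scale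
    fun_prop
  scale_pos x := Real.exp_pos _
  abs_mean_le x _ := by
    refine (Finset.abs_sum_le_sum_abs _ _).trans
      ((Finset.sum_le_card_nsmul _ _ (B 0) fun i _ => ?_).trans_eq ?_)
    · simpa only [iteratedDeriv_zero] using (hθ.1 i).2.2 0 (Nat.zero_le s) _
    · rw [Finset.card_univ, Fintype.card_fin, nsmul_eq_mul]
  scale_mem x hx := by
    have := abs_le.1 (abs_sum_mul_le hθ.2.2 hx)
    exact ⟨Real.exp_le_exp.2 this.1, Real.exp_le_exp.2 this.2⟩

theorem abs_mean_sub_le (hγ₀ : 0 ≤ γ) (hγ₁ : γ ≤ 1) (hL : 0 ≤ L)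
    (hθ : θ ∈ modelParams d p s γ L B C) (hθ' : θ' ∈ modelParams d p s γ L B C) {a η : ℝ}
    (hη : 0 ≤ η) (hη₁ : η ≤ 1)
    (hprofile : ∀ i, ∀ z ∈ Icc (-d : ℝ) (-d + 2 * d), |θ.profile i z - θ'.profile i z| ≤ a)
    (hdirection : ∀ i j, |θ.direction i j - θ'.direction i j| ≤ 1 / (d + 1) * η)
    {x : Fin d → ℝ} (hx : x ∈ cube d) :
    |θ.mean x - θ'.mean x| ≤ p * (a + max L (B 1) * η ^ γ) := by
  rw [ModelParam.mean, ModelParam.mean, ← Finset.sum_sub_distrib]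
  refine (Finset.abs_sum_le_sum_abs _ _).trans ((Finset.sum_le_card_nsmul _ _ _ fun i _ => ?_)
    |>.trans_eq (by rw [Finset.card_univ, Fintype.card_fin, nsmul_eq_mul]))
  set z := ∑ j, θ.direction i j * x j
  set z' := ∑ j, θ'.direction i j * x j
  have abs_z_le : |z| ≤ d := by
    simpa only [mul_one] using abs_sum_mul_le (abs_direction_le_one hθ i) hx
  have index_close : |z - z'| ≤ η := abs_sum_mul_sub_sum_mul_le hη (hdirection i) hx
  have modulus : |θ'.profile i z - θ'.profile i z'| ≤ max L (B 1) * η ^ γ :=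
    (abs_sub_le_of_mem_holderClass hγ₁ (hθ'.1 i) (index_close.trans hη₁)).trans
      (mul_le_mul_of_nonneg_left (Real.rpow_le_rpow (abs_nonneg _) index_close hγ₀)
        (hL.trans (le_max_left _ _)))
  calc |θ.profile i z - θ'.profile i z'|
      ≤ |θ.profile i z - θ'.profile i z| + |θ'.profile i z - θ'.profile i z'| :=
        abs_sub_le _ _ _
    _ ≤ a + max L (B 1) * η ^ γ := add_le_add
        (hprofile i z ⟨(abs_le.1 abs_z_le).1, by linarith [(abs_le.1 abs_z_le).2]⟩) modulus

theorem abs_scale_sub_le (hθ : θ ∈ modelParams d p s γ L B C)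
    (hθ' : θ' ∈ modelParams d p s γ L B C) {η : ℝ} (hη : 0 ≤ η)
    (hlogScale : ∀ j, |θ.logScale j - θ'.logScale j| ≤ 1 / (d + 1) * η)
    {x : Fin d → ℝ} (hx : x ∈ cube d) :
    |θ.scale x - θ'.scale x| ≤ Real.exp (d * C) * η :=
  (abs_exp_sub_exp_le (abs_le.1 (abs_sum_mul_le hθ.2.2 hx)).2
    (abs_le.1 (abs_sum_mul_le hθ'.2.2 hx)).2).trans
    (mul_le_mul_of_nonneg_left (abs_sum_mul_sub_sum_mul_le hη hlogScale hx) (Real.exp_pos _).le)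

theorem exists_expCodable_modelParams (hγ₀ : 0 < γ) (hγ₁ : γ ≤ 1) (hL : 0 ≤ L) (hC : 0 ≤ C) :
    ∃ A, ExpCodable (modelParams d p s γ L B C) fun δ θ θ' => ∀ x ∈ cube d,
      |θ.mean x - θ'.mean x| ≤ A * δ ^ (s + γ) ∧ |θ.scale x - θ'.scale x| ≤ A * δ ^ (s + γ) := by
  have profiles : ExpCodable (modelParams d p s γ L B C) fun δ θ θ' => ∀ i,
      ∀ z ∈ Icc (-d : ℝ) (-d + 2 * d),
        |θ.profile i z - θ'.profile i z| ≤ (s + 1 + 2 * L) * δ ^ (s + γ) :=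
    ExpCodable.pi fun i => (expCodable_holderClass hγ₀ hL (-d) (by positivity)).comap
      (φ := fun θ : ModelParam d p => θ.profile i) fun θ hθ => hθ.1 i
  have directions : ExpCodable (modelParams d p s γ L B C) fun δ θ θ' => ∀ i j,
      |θ.direction i j - θ'.direction i j| ≤ 1 / (d + 1) * δ ^ ((s + γ) / γ) :=
    ExpCodable.pi fun i => ExpCodable.pi fun j => ExpCodable.of_real (by positivity)
      (by positivity) zero_le_one fun θ hθ => abs_direction_le_one hθ i j
  have logScales : ExpCodable (modelParams d p s γ L B C) fun δ θ θ' => ∀ j,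
      |θ.logScale j - θ'.logScale j| ≤ 1 / (d + 1) * δ ^ (s + γ) :=
    ExpCodable.pi fun j => ExpCodable.of_real (by positivity) (by positivity) hC
      fun θ hθ => hθ.2.2 j
  set A₁ := p * (s + 1 + 2 * L + max L (B 1))
  refine ⟨max A₁ (Real.exp (d * C)), (profiles.and (directions.and logScales)).mono
    fun δ hδ hδ₁ θ hθ θ' hθ' ⟨hprofile, hdirection, hlogScale⟩ x hx => ⟨?_, ?_⟩⟩
  · have rpow_eq : (δ ^ ((s + γ) / γ)) ^ γ = δ ^ (s + γ) := by
      rw [← Real.rpow_mul hδ.le, div_mul_cancel₀ _ hγ₀.ne']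
    have := abs_mean_sub_le hγ₀.le hγ₁ hL hθ hθ' (by positivity)
      (Real.rpow_le_one hδ.le hδ₁ (by positivity)) hprofile hdirection hx
    rw [rpow_eq, ← add_mul, ← mul_assoc] at this
    exact this.trans (mul_le_mul_of_nonneg_right (le_max_left _ _) (by positivity))
  · exact (abs_scale_sub_le hθ hθ' (by positivity) hlogScale hx).trans
      (mul_le_mul_of_nonneg_right (le_max_right _ _) (by positivity))

end Models

section UpperBound

theorem rpow_rpow_two_mul {x : ℝ} (hx : 0 ≤ x) (α : ℝ) :
    (x ^ (-(1 / (2 * α + 1)))) ^ (2 * α) = x ^ (-(2 * α) / (2 * α + 1)) := by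
  rw [← Real.rpow_mul hx]
  congr 1
  ring

theorem mul_rpow_rpow_two_mul {x α : ℝ} (hx : 0 < x) (hα : 0 ≤ α) :
    x * (x ^ (-(1 / (2 * α + 1)))) ^ (2 * α) = 1 / x ^ (-(1 / (2 * α + 1))) := by
  have exponent_eq : -(1 / (2 * α + 1)) * (2 * α + 1) = -1 := by field_simp
  rw [eq_div_iff (Real.rpow_pos_of_pos hx _).ne', mul_assoc,
    ← Real.rpow_add_one (Real.rpow_pos_of_pos hx _).ne', ← Real.rpow_mul hx.le, exponent_eq,
    Real.rpow_neg_one, mul_inv_cancel₀ hx.ne']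

theorem mul_exp_le_rpow {N A q δ : ℝ} (hδ : 0 < δ) (hq : 0 ≤ q) (hN : N ≤ Real.exp (A / δ)) :
    N * Real.exp (-((A + q) / δ)) ≤ δ ^ q :=
  calc N * Real.exp (-((A + q) / δ)) ≤ Real.exp (A / δ) * Real.exp (-((A + q) / δ)) := by gcongr
    _ = (Real.exp (q / δ))⁻¹ := by
        rw [← Real.exp_add, ← Real.exp_neg]
        ring_nf
    _ ≤ δ ^ q := by
        have := rpow_neg_le_exp hδ hq
        rw [Real.rpow_neg hδ.le] at this
        exact inv_le_of_inv_le₀ (by positivity) this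

theorem RegularDensity.exists_risk_le_of_expCodable {f : ℝ → ℝ} (hf : RegularDensity f)
    {d : ℕ} {K M a b α A₁ : ℝ} (hK : 0 < K) (ha : 0 < a) (hb : 0 < b) (hα : 0 < α) {Θ : Type*}
    {S : Set Θ} {mean scale : Θ → (Fin d → ℝ) → ℝ}
    (hadm : ∀ θ ∈ S, Admissible M a b (mean θ) (scale θ))
    (hcode : ExpCodable S fun δ θ θ' => ∀ x ∈ cube d,
      |mean θ x - mean θ' x| ≤ A₁ * δ ^ α ∧ |scale θ x - scale θ' x| ≤ A₁ * δ ^ α) :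
    ∃ c > 0, ∀ n : ℕ, 1 ≤ n →
      ∃ est : (Fin n → (Fin d → ℝ) × ℝ) → (Fin d → ℝ) → ℝ, Measurable (Function.uncurry est) ∧
        ∀ θ ∈ S, ∀ h ∈ densityClass d K, risk f (mean θ) (scale θ) h est ≤
          ENNReal.ofReal (c * (n : ℝ) ^ (-(2 * α) / (2 * α + 1))) := by
  obtain ⟨A, hA, c, hc, hest⟩ := hf.exists_estimator_risk_le (d := d) hK M ha hb
  obtain ⟨A₂, hA₂, hcode⟩ := hcode
  -- With `D = κ δ ^ (2 α)` the exponent of the error bound is `-(A₂ + 2 α) / δ`, which absorbs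
  -- the cardinality `exp (A₂ / δ)` of the net.
  set κ := (A₂ + 2 * α + A * A₁ ^ 2) / c with hκ
  have : 0 < κ := by positivity
  refine ⟨K * (2 * (A₁ ^ 2 + κ)) + K * (2 * M) ^ 2, by positivity, fun n hn => ?_⟩
  rcases S.eq_empty_or_nonempty with rfl | hS
  · exact ⟨fun _ _ => 0, measurable_const, fun θ hθ => hθ.elim⟩
  have hn₀ : (0 : ℝ) < n := Nat.cast_pos.2 hn
  have balance := mul_rpow_rpow_two_mul hn₀ hα.le
  rw [← rpow_rpow_two_mul hn₀.le]
  set δ : ℝ := (n : ℝ) ^ (-(1 / (2 * α + 1)))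
  have hδ : 0 < δ := by positivity
  have hδ₁ : δ ≤ 1 := Real.rpow_le_one_of_one_le_of_nonpos (Nat.one_le_cast.2 hn)
    (neg_nonpos.2 (by positivity))
  have sq_eq : (A₁ * δ ^ α) ^ 2 = A₁ ^ 2 * δ ^ (2 * α) := by
    rw [mul_pow, ← Real.rpow_mul_natCast hδ.le, mul_comm α, Nat.cast_ofNat]
  obtain ⟨ι, _, _, net, card_le, net_mem, cover⟩ := (hcode δ hδ hδ₁).exists_net hS
  obtain ⟨est, est_measurable, risk_le⟩ := hest n (κ * δ ^ (2 * α)) (A₁ * δ ^ α)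
    fun i => hadm _ (net_mem i)
  refine ⟨est, est_measurable, fun θ hθ h hh =>
    (risk_le (hadm θ hθ) hh (cover θ hθ)).trans ?_⟩
  have exponent_eq : n * (A * (A₁ * δ ^ α) ^ 2 - c * (κ * δ ^ (2 * α))) =
      -((A₂ + 2 * α) / δ) := by
    calc _ = (n * δ ^ (2 * α)) * (A * A₁ ^ 2 - c * κ) := by rw [sq_eq]; ring
      _ = _ := by rw [balance, hκ, mul_div_cancel₀ _ hc.ne']; ring
  rw [exponent_eq, sq_eq, ← ENNReal.ofReal_natCast, ← ENNReal.ofReal_mul (by positivity),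
    ← ENNReal.ofReal_mul (by positivity), ← ENNReal.ofReal_add (by positivity) (by positivity)]
  refine ENNReal.ofReal_le_ofReal ?_
  calc K * (2 * (A₁ ^ 2 * δ ^ (2 * α) + κ * δ ^ (2 * α))) +
        K * (2 * M) ^ 2 * (Fintype.card ι * Real.exp (-((A₂ + 2 * α) / δ)))
      ≤ K * (2 * (A₁ ^ 2 * δ ^ (2 * α) + κ * δ ^ (2 * α))) +
        K * (2 * M) ^ 2 * δ ^ (2 * α) := by
        gcongr
        exact mul_exp_le_rpow hδ (by positivity) card_le
    _ = (K * (2 * (A₁ ^ 2 + κ)) + K * (2 * M) ^ 2) * δ ^ (2 * α) := by ring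

theorem RegularDensity.exists_minimaxRisk_le {f : ℝ → ℝ} (hf : RegularDensity f) {d p s : ℕ}
    {γ L K C : ℝ} {B : ℕ → ℝ} (hγ₀ : 0 < γ) (hγ₁ : γ ≤ 1) (hL : 0 ≤ L) (hK : 0 < K)
    (hC : 0 ≤ C) : ∃ c > 0, ∀ n : ℕ, 1 ≤ n →
      minimaxRisk n f (multipleIndexClass d p s γ L B) (scaleClass d C) (densityClass d K) ≤
        ENNReal.ofReal (c * (n : ℝ) ^ (-(2 * (s + γ)) / (2 * (s + γ) + 1))) := by
  obtain ⟨A, hcode⟩ := exists_expCodable_modelParams (d := d) (p := p) (s := s) (B := B)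
    hγ₀ hγ₁ hL hC
  obtain ⟨c, hc, hrisk⟩ := hf.exists_risk_le_of_expCodable hK (Real.exp_pos _) (Real.exp_pos _)
    (by positivity) (fun θ hθ => admissible_of_mem_modelParams hθ) hcode
  refine ⟨c, hc, fun n hn => ?_⟩
  obtain ⟨est, est_measurable, risk_le⟩ := hrisk n hn
  refine iInf₂_le_of_le est est_measurable (iSup₂_le fun μ hμ => iSup₂_le fun σ hσ =>
    iSup₂_le fun h hh => ?_)
  obtain ⟨g, β, hg, hβ, -, rfl⟩ := hμ
  obtain ⟨c', hc', rfl⟩ := hσ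
  exact risk_le ⟨g, β, c'⟩ ⟨fun i => (hg i).1, hβ, hc'⟩ h hh

end UpperBound

section Affinity

variable {d n : ℕ} {f : ℝ → ℝ} {K : ℝ} {h μ μ' σ : (Fin d → ℝ) → ℝ}

theorem sampleLaw_eq_withDensity (hf : RegularDensity f) (hK : 0 ≤ K) (hh : h ∈ densityClass d K)
    (hμ : Measurable μ) (hσ : Measurable σ) (hσ0 : ∀ x, 0 < σ x) :
    sampleLaw n f μ σ h = (Measure.pi fun _ : Fin n => (covariateLaw h).prod volume).withDensity
      fun S => ∏ k, responseDensity f μ σ (S k) := by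
  have := isProbabilityMeasure_covariateLaw hK hh
  have observation := observationLaw_eq_withDensity (h := h) hf.measurable hμ hσ hσ0
  have hprob := isProbabilityMeasure_observationLaw hf hK hh hμ hσ
  rw [observation] at hprob
  rw [sampleLaw, observation]
  have : SigmaFinite ((covariateLaw h).prod (volume : Measure ℝ)) := inferInstance
  exact pi_withDensity_eq_withDensity_prod fun _ =>
    measurable_responseDensity hf.measurable hμ hσ

theorem isProbabilityMeasure_sampleLaw (hf : RegularDensity f) (hK : 0 ≤ K)
    (hh : h ∈ densityClass d K) (hμ : Measurable μ) (hσ : Measurable σ) :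
    IsProbabilityMeasure (sampleLaw n f μ σ h) := by
  have := isProbabilityMeasure_observationLaw hf hK hh hμ hσ
  unfold sampleLaw
  infer_instance

theorem one_le_hellingerAffinity_responseDensity_add (hf : RegularDensity f) (hK : 0 ≤ K)
    (hh : h ∈ densityClass d K) (hμ : Measurable μ) (hμ' : Measurable μ') (hσ : Measurable σ)
    (hσ0 : ∀ x, 0 < σ x) {A : ℝ} (hA0 : 0 ≤ A)
    (hA : ∀ x ∈ cube d, hellingerSq volume (locScale f (μ x) (σ x)) (locScale f (μ' x) (σ x)) ≤
      A * (μ x - μ' x) ^ 2) :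
    1 ≤ hellingerAffinity ((covariateLaw h).prod volume) (responseDensity f μ σ)
        (responseDensity f μ' σ) +
      ENNReal.ofReal (A / 2) * ∫⁻ x, ENNReal.ofReal ((μ x - μ' x) ^ 2) ∂(covariateLaw h) := by
  have := isProbabilityMeasure_covariateLaw hK hh
  have hp := measurable_responseDensity hf.measurable hμ hσ
  have hq := measurable_responseDensity hf.measurable hμ' hσ
  have hpq : Measurable fun z => responseDensity f μ σ z ^ (1 / 2 : ℝ) *
      responseDensity f μ' σ z ^ (1 / 2 : ℝ) := by fun_prop
  rw [hellingerAffinity, lintegral_prod _ hpq.aemeasurable, ← lintegral_const_mul _ (by fun_prop),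
    ← lintegral_add_left hpq.lintegral_prod_right']
  refine (measure_univ (μ := covariateLaw h)).symm.trans_le ?_
  rw [← lintegral_one]
  refine lintegral_mono_ae ?_
  filter_upwards [ae_covariateLaw_mem_cube h] with x hx
  have conditional := (hf.isProbDensity_locScale (μ x) (hσ0 x)).hellingerAffinity_eq
    (hf.isProbDensity_locScale (μ' x) (hσ0 x))
  simp only [hellingerAffinity] at conditional
  simp only [responseDensity, conditional]
  rw [← ENNReal.ofReal_mul (by positivity), ← ENNReal.ofReal_one]
  refine (ENNReal.ofReal_le_ofReal ?_).trans ENNReal.ofReal_add_le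
  linarith [hA x hx]

theorem ofReal_half_le_pow_of_one_le_add (hn : 1 ≤ n) {ρ : ℝ≥0∞}
    (hρ : 1 ≤ ρ + ENNReal.ofReal (1 / (2 * n))) : ENNReal.ofReal (1 / 2) ≤ ρ ^ n := by
  have hn1 : (1 : ℝ) ≤ n := by exact_mod_cast hn
  have small : 1 / (2 * (n : ℝ)) ≤ 1 := by
    rw [div_le_one (by positivity)]
    linarith
  have bernoulli := one_add_mul_le_pow (a := -(1 / (2 * (n : ℝ)))) (by linarith) n
  have half_eq : 1 + (n : ℝ) * -(1 / (2 * n)) = 1 / 2 := by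
    field_simp
    norm_num
  calc ENNReal.ofReal (1 / 2) ≤ ENNReal.ofReal ((1 + -(1 / (2 * (n : ℝ)))) ^ n) :=
        ENNReal.ofReal_le_ofReal (half_eq.symm.trans_le bernoulli)
    _ = ENNReal.ofReal (1 - 1 / (2 * n)) ^ n := by
        rw [← sub_eq_add_neg, ENNReal.ofReal_pow (sub_nonneg.2 small)]
    _ ≤ ρ ^ n := by
        refine pow_le_pow_left' ?_ n
        rw [ENNReal.ofReal_sub _ (by positivity), ENNReal.ofReal_one]
        exact tsub_le_iff_right.2 hρ

theorem ofReal_half_le_hellingerAffinity_pow (hf : RegularDensity f) (hK : 0 ≤ K)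
    (hh : h ∈ densityClass d K) (hμ : Measurable μ) (hμ' : Measurable μ') (hσ : Measurable σ)
    (hσ0 : ∀ x, 0 < σ x) {A : ℝ} (hA0 : 0 < A)
    (hA : ∀ x ∈ cube d, hellingerSq volume (locScale f (μ x) (σ x)) (locScale f (μ' x) (σ x)) ≤
      A * (μ x - μ' x) ^ 2) (hn : 1 ≤ n)
    (hclose : ∫⁻ x, ENNReal.ofReal ((μ x - μ' x) ^ 2) ∂(covariateLaw h) ≤
      ENNReal.ofReal (1 / (A * n))) :
    ENNReal.ofReal (1 / 2) ≤ hellingerAffinity ((covariateLaw h).prod volume)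
      (responseDensity f μ σ) (responseDensity f μ' σ) ^ n := by
  refine ofReal_half_le_pow_of_one_le_add hn
    ((one_le_hellingerAffinity_responseDensity_add hf hK hh hμ hμ' hσ hσ0 hA0.le hA).trans ?_)
  gcongr
  refine (mul_le_mul_right hclose _).trans_eq ?_
  rw [← ENNReal.ofReal_mul (by positivity)]
  congr 1
  field_simp

end Affinity

section Assouad

/-- The contribution to the risk of the points of a set `T`. -/
def localRisk {d n : ℕ} (f : ℝ → ℝ) (μ σ h : (Fin d → ℝ) → ℝ)
    (est : (Fin n → (Fin d → ℝ) × ℝ) → (Fin d → ℝ) → ℝ) (T : Set (Fin d → ℝ)) : ℝ≥0∞ :=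
  ∫⁻ D, ∫⁻ x in T, ENNReal.ofReal ((μ x - est D x) ^ 2) ∂(covariateLaw h) ∂(sampleLaw n f μ σ h)

/-- Flipping one coordinate of a vertex of the hypercube. -/
def flip {m : ℕ} (j : Fin m) (ω : Fin m → Bool) : Fin m → Bool := Function.update ω j (!ω j)

theorem flip_involutive {m : ℕ} (j : Fin m) : Function.Involutive (flip j) := fun ω => by
  simp [flip]

/-- Assouad's lemma: averaging over the hypercube turns bounds on the edges in every direction
into a bound on the sum over directions. -/
theorem mul_le_of_le_add_flip {m : ℕ} {r : (Fin m → Bool) → Fin m → ℝ≥0∞} {Δ R : ℝ≥0∞}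
    (hedge : ∀ ω j, Δ ≤ r ω j + r (flip j ω) j) (hsum : ∀ ω, ∑ j, r ω j ≤ R) :
    m * Δ ≤ 2 * R := by
  have direction_le (j : Fin m) : 2 ^ m * Δ ≤ 2 * ∑ ω, r ω j := by
    calc 2 ^ m * Δ = ∑ _ω : Fin m → Bool, Δ := by simp
      _ ≤ ∑ ω, (r ω j + r (flip j ω) j) := Finset.sum_le_sum fun ω _ => hedge ω j
      _ = 2 * ∑ ω, r ω j := by
          rw [Finset.sum_add_distrib, two_mul]
          exact congrArg _ (Equiv.sum_comp (flip_involutive j).toPerm fun ω => r ω j)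
  have total : 2 ^ m * (m * Δ) ≤ 2 ^ m * (2 * R) := by
    calc (2 : ℝ≥0∞) ^ m * (m * Δ) = ∑ _j : Fin m, 2 ^ m * Δ := by simp [mul_left_comm]
      _ ≤ ∑ j, 2 * ∑ ω, r ω j := Finset.sum_le_sum fun j _ => direction_le j
      _ = 2 * ∑ ω, ∑ j, r ω j := by rw [← Finset.mul_sum, Finset.sum_comm]
      _ ≤ 2 * ∑ _ω : Fin m → Bool, R := by
          gcongr with ω _
          exact hsum ω
      _ = 2 ^ m * (2 * R) := by simp [mul_left_comm]
  rwa [ENNReal.mul_le_mul_iff_right (by simp) (by simp)] at total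

variable {d n m : ℕ} {f : ℝ → ℝ} {K : ℝ} {h μ μ' σ : (Fin d → ℝ) → ℝ}
  {est : (Fin n → (Fin d → ℝ) × ℝ) → (Fin d → ℝ) → ℝ}

theorem measurable_setLIntegral_sq_sub (hK : 0 ≤ K) (hh : h ∈ densityClass d K)
    (hμ : Measurable μ) (hest : Measurable (Function.uncurry est)) (T : Set (Fin d → ℝ)) :
    Measurable fun D => ∫⁻ x in T, ENNReal.ofReal ((μ x - est D x) ^ 2) ∂(covariateLaw h) := by
  have := isProbabilityMeasure_covariateLaw hK hh
  exact (((hμ.comp measurable_snd).sub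
    hest).pow_const 2).ennreal_ofReal.lintegral_prod_right'

theorem lintegral_sq_sub_le {X : Type*} [MeasurableSpace X] {ν : Measure X} {u v w : X → ℝ}
    (hu : Measurable u) (hw : Measurable w) :
    ∫⁻ x, ENNReal.ofReal ((u x - v x) ^ 2) ∂ν ≤
      2 * ∫⁻ x, ENNReal.ofReal ((u x - w x) ^ 2) ∂ν +
        2 * ∫⁻ x, ENNReal.ofReal ((v x - w x) ^ 2) ∂ν := by
  rw [← lintegral_const_mul' _ _ ENNReal.ofNat_ne_top,
    ← lintegral_const_mul' _ _ ENNReal.ofNat_ne_top, ← lintegral_add_left (by fun_prop)]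
  refine lintegral_mono fun x => ?_
  rw [← ENNReal.ofReal_ofNat, ← ENNReal.ofReal_mul zero_le_two, ← ENNReal.ofReal_mul zero_le_two,
    ← ENNReal.ofReal_add (by positivity) (by positivity)]
  refine ENNReal.ofReal_le_ofReal ?_
  nlinarith [sq_nonneg ((u x - w x) + (v x - w x))]

theorem le_localRisk_add_localRisk (hf : RegularDensity f) (hK : 0 ≤ K)
    (hh : h ∈ densityClass d K) (hμ : Measurable μ) (hμ' : Measurable μ') (hσ : Measurable σ)
    (hσ0 : ∀ x, 0 < σ x)
    (haffinity : ENNReal.ofReal (1 / 2) ≤ hellingerAffinity ((covariateLaw h).prod volume)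
      (responseDensity f μ σ) (responseDensity f μ' σ) ^ n)
    (hest : Measurable (Function.uncurry est)) {T : Set (Fin d → ℝ)} {Δ : ℝ≥0∞}
    (hΔ : Δ ≤ ∫⁻ x in T, ENNReal.ofReal ((μ x - μ' x) ^ 2) ∂(covariateLaw h)) :
    Δ ≤ 16 * (localRisk f μ σ h est T + localRisk f μ' σ h est T) := by
  have := isProbabilityMeasure_covariateLaw hK hh
  have density {μ : (Fin d → ℝ) → ℝ} (hμ : Measurable μ) :
      Measurable fun S : Fin n → (Fin d → ℝ) × ℝ => ∏ k, responseDensity f μ σ (S k) :=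
    Finset.measurable_prod _ fun k _ =>
      (measurable_responseDensity hf.measurable hμ hσ).comp (measurable_pi_apply k)
  have hprob := isProbabilityMeasure_sampleLaw (n := n) hf hK hh hμ hσ
  have hprob' := isProbabilityMeasure_sampleLaw (n := n) hf hK hh hμ' hσ
  rw [sampleLaw_eq_withDensity hf hK hh hμ hσ hσ0] at hprob
  rw [sampleLaw_eq_withDensity hf hK hh hμ' hσ hσ0] at hprob'
  have loss {μ : (Fin d → ℝ) → ℝ} (hμ : Measurable μ) :=
    measurable_setLIntegral_sq_sub hK hh hμ hest T
  have two_point := mul_hellingerAffinity_sq_le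
    (κ := Measure.pi fun _ : Fin n => (covariateLaw h).prod volume) (density hμ) (density hμ')
    ((loss hμ).const_mul 2) ((loss hμ').const_mul 2) fun S =>
      hΔ.trans (lintegral_sq_sub_le hμ (hest.comp measurable_prodMk_left))
  rw [hellingerAffinity_pi (measurable_responseDensity hf.measurable hμ hσ)
      (measurable_responseDensity hf.measurable hμ' hσ), lintegral_const_mul _ (loss hμ),
    lintegral_const_mul _ (loss hμ'), ← sampleLaw_eq_withDensity hf hK hh hμ hσ hσ0,
    ← sampleLaw_eq_withDensity hf hK hh hμ' hσ hσ0] at two_point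
  have half_sq : ENNReal.ofReal (1 / 2) ^ 2 * 4 = 1 := by
    rw [← ENNReal.ofReal_pow (by norm_num), ← ENNReal.ofReal_ofNat,
      ← ENNReal.ofReal_mul (by norm_num)]
    norm_num
  calc Δ = Δ * ENNReal.ofReal (1 / 2) ^ 2 * 4 := by rw [mul_assoc, half_sq, mul_one]
    _ ≤ 2 * (2 * localRisk f μ σ h est T + 2 * localRisk f μ' σ h est T) * 4 :=
        mul_le_mul_left ((mul_le_mul_right (pow_le_pow_left' haffinity 2) Δ).trans two_point) 4
    _ = 16 * (localRisk f μ σ h est T + localRisk f μ' σ h est T) := by ring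

theorem sum_localRisk_le_risk (hK : 0 ≤ K) (hh : h ∈ densityClass d K) (hμ : Measurable μ)
    (hest : Measurable (Function.uncurry est)) {T : Fin m → Set (Fin d → ℝ)}
    (hT : ∀ j, MeasurableSet (T j)) (hdisj : Pairwise (Function.onFun Disjoint T)) :
    ∑ j, localRisk f μ σ h est (T j) ≤ risk f μ σ h est := by
  simp only [localRisk]
  rw [← lintegral_finsetSum _ fun j _ => measurable_setLIntegral_sq_sub hK hh hμ hest (T j)]
  refine lintegral_mono fun D => ?_
  rw [← lintegral_biUnion_finset (fun i _ j _ hij => hdisj hij) fun j _ => hT j]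
  exact setLIntegral_le_lintegral _ _

theorem RegularDensity.exists_mul_le_minimaxRisk (hf : RegularDensity f) (hK : 0 ≤ K)
    {U S H : Set ((Fin d → ℝ) → ℝ)} (hhH : h ∈ H) (hh : h ∈ densityClass d K) (hσS : σ ∈ S)
    (M : ℝ) {a b : ℝ} (ha : 0 < a) :
    ∃ A > 0, ∀ {n m : ℕ} {μ : (Fin m → Bool) → (Fin d → ℝ) → ℝ} {T : Fin m → Set (Fin d → ℝ)}
      {Δ : ℝ≥0∞}, 1 ≤ n → (∀ ω, μ ω ∈ U) → (∀ ω, Admissible M a b (μ ω) σ) →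
      (∀ ω j, ∫⁻ x, ENNReal.ofReal ((μ ω x - μ (flip j ω) x) ^ 2) ∂(covariateLaw h) ≤
        ENNReal.ofReal (1 / (A * n))) →
      (∀ j, MeasurableSet (T j)) → Pairwise (Function.onFun Disjoint T) →
      (∀ ω j, Δ ≤ ∫⁻ x in T j, ENNReal.ofReal ((μ ω x - μ (flip j ω) x) ^ 2) ∂(covariateLaw h)) →
      m * Δ ≤ 32 * minimaxRisk n f U S H := by
  obtain ⟨A, hA0, hA⟩ := hf.hellinger M a b ha
  refine ⟨A, hA0, fun {n m μ T Δ} hn hU hμ hclose hT hdisj hΔ => ?_⟩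
  have affinity (ω : Fin m → Bool) (j : Fin m) := ofReal_half_le_hellingerAffinity_pow hf hK hh
    (hμ ω).measurable_mean (hμ (flip j ω)).measurable_mean (hμ ω).measurable_scale
    (hμ ω).scale_pos hA0 (fun x hx => by
      simpa only [sub_self, ne_eq, OfNat.ofNat_ne_zero, not_false_eq_true, zero_pow, add_zero]
        using hA _ _ _ _ ((hμ ω).abs_mean_le x hx) ((hμ _).abs_mean_le x hx)
          ((hμ ω).scale_mem x hx) ((hμ ω).scale_mem x hx)) hn (hclose ω j)
  simp only [minimaxRisk, ENNReal.mul_iInf_of_ne (a := 32) (by simp) (by simp)]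
  refine le_iInf₂ fun est hest => ?_
  have edge (ω : Fin m → Bool) (j : Fin m) := le_localRisk_add_localRisk hf hK hh
    (hμ ω).measurable_mean (hμ (flip j ω)).measurable_mean (hμ ω).measurable_scale
    (hμ ω).scale_pos (affinity ω j) hest (hΔ ω j)
  calc m * Δ ≤ 2 * (16 * ⨆ (μ ∈ U) (σ ∈ S) (h ∈ H), risk f μ σ h est) :=
        mul_le_of_le_add_flip (r := fun ω j => 16 * localRisk f (μ ω) σ h est (T j))
          (fun ω j => (edge ω j).trans_eq (mul_add _ _ _)) fun ω => by
            rw [← Finset.mul_sum]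
            gcongr
            exact (sum_localRisk_le_risk hK hh (hμ ω).measurable_mean hest hT hdisj).trans
              (le_iSup₂_of_le (μ ω) (hU ω) (le_iSup₂_of_le σ hσS (le_iSup₂_of_le h hhH le_rfl)))
    _ = 32 * ⨆ (μ ∈ U) (σ ∈ S) (h ∈ H), risk f μ σ h est := by ring

end Assouad

section Bumps

variable {φ G : ℝ → ℝ} {w : ℕ → ℝ} {s k m : ℕ} {γ L M : ℝ} {B : ℕ → ℝ}

theorem iteratedDeriv_eq_zero_of_notMem_tsupport {z : ℝ} (hz : z ∉ tsupport φ) :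
    iteratedDeriv k φ z = 0 := by
  have h : iteratedFDeriv ℝ k φ z = 0 :=
    Function.notMem_support.1 fun h => hz (support_iteratedFDeriv_subset k h)
  rw [← norm_eq_zero, ← norm_iteratedFDeriv_eq_norm_iteratedDeriv, h, norm_zero]

theorem exists_abs_iteratedDeriv_le {N : ℕ} (hφ : ContDiff ℝ N φ) (hc : HasCompactSupport φ) :
    ∃ M > 0, ∀ k ≤ N, ∀ z, |iteratedDeriv k φ z| ≤ M := by
  have hbdd : ∀ k ∈ Finset.range (N + 1), ∃ M, ∀ z, |iteratedDeriv k φ z| ≤ M := fun k hk => by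
    have hkN : (k : WithTop ℕ∞) ≤ N := by exact_mod_cast Finset.mem_range_succ_iff.1 hk
    obtain ⟨M, hM⟩ := (hφ.continuous_iteratedFDeriv hkN).bounded_above_of_compact_support
      (hc.iteratedFDeriv (𝕜 := ℝ) k)
    refine ⟨M, fun z => ?_⟩
    rw [← Real.norm_eq_abs, ← norm_iteratedFDeriv_eq_norm_iteratedDeriv]
    exact hM z
  choose! M hM using hbdd
  obtain ⟨b, hb⟩ := ((Finset.range (N + 1)).image M).exists_le
  refine ⟨max b 1, by positivity, fun k hk z => ?_⟩
  have hk' := Finset.mem_range_succ_iff.2 hk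
  exact ((hM k hk' z).trans (hb _ (Finset.mem_image_of_mem M hk'))).trans (le_max_left _ _)

/-- The superposition `∑ w_j φ(· - j)` of the first `N` integer translates of `φ`. -/
def translateSum (φ : ℝ → ℝ) (w : ℕ → ℝ) (N : ℕ) (u : ℝ) : ℝ :=
  ∑ j ∈ Finset.range N, w j * φ (u - j)

theorem eq_of_sub_mem_Ioo {i j : ℕ} {u : ℝ} (hi : u - i ∈ Ioo (0 : ℝ) 1)
    (hj : u - j ∈ Ioo (0 : ℝ) 1) : i = j := by
  have hij : (i : ℝ) < j + 1 := by linarith [hi.1, hj.2]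
  have hji : (j : ℝ) < i + 1 := by linarith [hi.2, hj.1]
  norm_cast at hij hji
  omega

theorem translateSum_eq_of_mem_Ioo (hφ : ∀ z ∉ Ioo (0 : ℝ) 1, φ z = 0) {N j : ℕ} (hj : j < N)
    {u : ℝ} (hu : u - j ∈ Ioo (0 : ℝ) 1) : translateSum φ w N u = w j * φ (u - j) :=
  Finset.sum_eq_single_of_mem j (Finset.mem_range.2 hj) fun i _ hij => by
    rw [hφ _ fun hi => hij (eq_of_sub_mem_Ioo hi hu), mul_zero]

theorem abs_translateSum_le (hM : ∀ z, |φ z| ≤ M) (hφ : ∀ z ∉ Ioo (0 : ℝ) 1, φ z = 0)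
    (hw : ∀ j, |w j| ≤ 1) (N : ℕ) (u : ℝ) : |translateSum φ w N u| ≤ M := by
  by_cases h : ∃ j < N, u - j ∈ Ioo (0 : ℝ) 1
  · obtain ⟨j, hj, hu⟩ := h
    rw [translateSum_eq_of_mem_Ioo hφ hj hu, abs_mul]
    exact (mul_le_of_le_one_left (abs_nonneg _) (hw j)).trans (hM _)
  · push Not at h
    have h0 : translateSum φ w N u = 0 := Finset.sum_eq_zero fun j hj => by
      rw [hφ _ (h j (Finset.mem_range.1 hj)), mul_zero]
    rw [h0, abs_zero]
    exact (abs_nonneg _).trans (hM 0)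

theorem contDiff_translateSum {n : WithTop ℕ∞} (hφ : ContDiff ℝ n φ) (w : ℕ → ℝ) (N : ℕ) :
    ContDiff ℝ n (translateSum φ w N) := by
  unfold translateSum
  fun_prop

theorem iteratedDeriv_translateSum (hφ : ContDiff ℝ k φ) (w : ℕ → ℝ) (N : ℕ) :
    iteratedDeriv k (translateSum φ w N) = translateSum (iteratedDeriv k φ) w N := by
  funext u
  unfold translateSum
  rw [iteratedDeriv_fun_sum fun j _ => by fun_prop]
  refine Finset.sum_congr rfl fun j _ => ?_
  rw [iteratedDeriv_const_mul_field, iteratedDeriv_comp_sub_const]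

theorem abs_sub_le_rpow_of_lipschitz {F : ℝ → ℝ} (hγ₀ : 0 ≤ γ) (hγ₁ : γ ≤ 1)
    (hM : ∀ u, |F u| ≤ M) (hLip : ∀ u v, |F u - F v| ≤ M * |u - v|) (u v : ℝ) :
    |F u - F v| ≤ 2 * M * |u - v| ^ γ := by
  have hM0 : 0 ≤ M := (abs_nonneg _).trans (hM 0)
  rcases le_or_gt |u - v| 1 with h | h
  · rcases (abs_nonneg (u - v)).eq_or_lt with h0 | h0
    · calc |F u - F v| ≤ M * |u - v| := hLip u v
        _ ≤ 2 * M * |u - v| ^ γ := by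
            rw [← h0, mul_zero]
            positivity
    · have hle : |u - v| ≤ |u - v| ^ γ := by
        simpa using Real.rpow_le_rpow_of_exponent_ge h0 h hγ₁
      calc |F u - F v| ≤ M * |u - v| := hLip u v
        _ ≤ (2 * M) * |u - v| ^ γ := by gcongr; linarith
  · have hone : 1 ≤ |u - v| ^ γ := Real.one_le_rpow h.le hγ₀
    calc |F u - F v| ≤ |F u| + |F v| := abs_sub _ _
      _ ≤ 2 * M * 1 := by linarith [hM u, hM v]
      _ ≤ 2 * M * |u - v| ^ γ := by gcongr

theorem abs_iteratedDeriv_sub_le (hG : ContDiff ℝ (s + 1 : ℕ) G)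
    (hM : ∀ k ≤ s + 1, ∀ z, |iteratedDeriv k G z| ≤ M) (hγ₀ : 0 ≤ γ) (hγ₁ : γ ≤ 1) (u v : ℝ) :
    |iteratedDeriv s G u - iteratedDeriv s G v| ≤ 2 * M * |u - v| ^ γ := by
  have hdiff : Differentiable ℝ (iteratedDeriv s G) :=
    hG.differentiable_iteratedDeriv s (by exact_mod_cast s.lt_succ_self)
  refine abs_sub_le_rpow_of_lipschitz hγ₀ hγ₁ (hM s s.le_succ) (fun u v => ?_) u v
  refine convex_univ.norm_image_sub_le_of_norm_deriv_le (fun z _ => hdiff z) (fun z _ => ?_)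
    (mem_univ v) (mem_univ u)
  rw [← iteratedDeriv_succ]
  exact hM _ le_rfl z

theorem iteratedDeriv_const_mul_comp_const_mul (hG : ContDiff ℝ k G) (c r z : ℝ) :
    iteratedDeriv k (fun z => c * G (r * z)) z = c * r ^ k * iteratedDeriv k G (r * z) := by
  rw [iteratedDeriv_const_mul_field, iteratedDeriv_comp_const_mul hG, mul_assoc]

theorem rescale_mem_holderClass (hG : ContDiff ℝ (s + 1 : ℕ) G)
    (hM : ∀ k ≤ s + 1, ∀ z, |iteratedDeriv k G z| ≤ M) (hγ₀ : 0 ≤ γ) (hγ₁ : γ ≤ 1) {a r : ℝ}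
    (hr : 1 ≤ r) (ha : 0 ≤ a) (haL : 2 * (a * M) ≤ L) (haB : ∀ k ≤ s, a * M ≤ B k) :
    (fun z => a * r ^ (-(s + γ)) * G (r * z)) ∈ holderClass s γ L B := by
  have hr0 : 0 < r := one_pos.trans_le hr
  have hGk : ∀ k ≤ s, ContDiff ℝ k G := fun k hk =>
    hG.of_le (by exact_mod_cast hk.trans s.le_succ)
  have hscale : ∀ k : ℕ, r ^ (-(s + γ)) * r ^ k = r ^ (k - s - γ) := fun k => by
    rw [← Real.rpow_natCast, ← Real.rpow_add hr0]
    ring_nf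
  refine ⟨by have := hGk s le_rfl; fun_prop, fun z₁ z₂ => ?_, fun k hk z => ?_⟩
  · rw [iteratedDeriv_const_mul_comp_const_mul (hGk s le_rfl),
      iteratedDeriv_const_mul_comp_const_mul (hGk s le_rfl), ← mul_sub, abs_mul,
      mul_assoc a, hscale, abs_of_nonneg (by positivity)]
    calc a * r ^ ((s : ℝ) - s - γ) * |iteratedDeriv s G (r * z₁) - iteratedDeriv s G (r * z₂)|
        ≤ a * r ^ ((s : ℝ) - s - γ) * (2 * M * |r * z₁ - r * z₂| ^ γ) := by
          gcongr
          exact abs_iteratedDeriv_sub_le hG hM hγ₀ hγ₁ _ _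
      _ = 2 * (a * M) * |z₁ - z₂| ^ γ := by
          rw [← mul_sub, abs_mul, abs_of_pos hr0, Real.mul_rpow hr0.le (abs_nonneg _), sub_self,
            zero_sub, Real.rpow_neg hr0.le]
          field_simp
      _ ≤ L * |z₁ - z₂| ^ γ := by gcongr
  · have hpow : r ^ ((k : ℝ) - s - γ) ≤ 1 :=
      Real.rpow_le_one_of_one_le_of_nonpos hr (by have : (k : ℝ) ≤ s := mod_cast hk; linarith)
    rw [iteratedDeriv_const_mul_comp_const_mul (hGk k hk), abs_mul, mul_assoc a, hscale,
      abs_of_nonneg (by positivity)]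
    calc a * r ^ ((k : ℝ) - s - γ) * |iteratedDeriv k G (r * z)| ≤ a * 1 * M := by
          gcongr
          exact hM k (hk.trans s.le_succ) _
      _ ≤ B k := by
          rw [mul_one]
          exact haB k hk

theorem exists_pos_forall_mul_le (hM : 0 < M) (hL : 0 < L) (hB : ∀ k ≤ s, 0 < B k) :
    ∃ a₀ > 0, ∀ a ≤ a₀, 2 * (a * M) ≤ L ∧ ∀ k ≤ s, a * M ≤ B k := by
  obtain ⟨k₀, hk₀, hmin⟩ := (Finset.range (s + 1)).exists_min_image B ⟨0, by simp⟩
  have hBk₀ : 0 < B k₀ := hB k₀ (Finset.mem_range_succ_iff.1 hk₀)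
  refine ⟨min (L / 2 / M) (B k₀ / M), by positivity, fun a ha => ⟨?_, fun k hk => ?_⟩⟩
  · have := (le_div_iff₀ hM).1 (ha.trans (min_le_left _ _))
    linarith
  · exact ((le_div_iff₀ hM).1 (ha.trans (min_le_right _ _))).trans
      (hmin k (Finset.mem_range_succ_iff.2 hk))

/-- A smooth function with values in `[0, 1]`, supported in `(0, 1)` and equal to `1` on
`[1/4, 3/4]`. -/
def plateau : ℝ → ℝ :=
  (⟨1 / 4, 3 / 8, by norm_num, by norm_num⟩ : ContDiffBump (1 / 2 : ℝ))

theorem contDiff_plateau {n : ℕ} : ContDiff ℝ n plateau := ContDiffBump.contDiff _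

theorem hasCompactSupport_plateau : HasCompactSupport plateau := ContDiffBump.hasCompactSupport _

theorem plateau_mem_Icc (z : ℝ) : plateau z ∈ Icc 0 1 :=
  ⟨ContDiffBump.nonneg _, ContDiffBump.le_one _⟩

theorem plateau_eq_one {z : ℝ} (hz : z ∈ Icc (1 / 4) (3 / 4)) : plateau z = 1 := by
  refine ContDiffBump.one_of_mem_closedBall _ ?_
  rw [Metric.mem_closedBall, Real.dist_eq, abs_le]
  constructor <;> linarith [hz.1, hz.2]

theorem tsupport_plateau_subset : tsupport plateau ⊆ Ioo 0 1 := fun z hz => by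
  rw [plateau, ContDiffBump.tsupport_eq, Metric.mem_closedBall, Real.dist_eq, abs_le] at hz
  constructor <;> linarith [hz.1, hz.2]

theorem plateau_eq_zero {z : ℝ} (hz : z ∉ Ioo 0 1) : plateau z = 0 :=
  image_eq_zero_of_notMem_tsupport fun h => hz (tsupport_plateau_subset h)

/-- The weights attached to a vertex of the hypercube. All weights beyond the first `m` are `1`,
so that the corresponding bump sum is never constant. -/
def cubeWeight (ω : Fin m → Bool) (j : ℕ) : ℝ :=
  if h : j < m then (if ω ⟨j, h⟩ then 1 else 0) else 1

theorem abs_cubeWeight_le (ω : Fin m → Bool) (j : ℕ) : |cubeWeight ω j| ≤ 1 := by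
  unfold cubeWeight
  split_ifs <;> simp

theorem cubeWeight_flip_of_ne (ω : Fin m → Bool) {j : Fin m} {i : ℕ} (hij : i ≠ j) :
    cubeWeight (flip j ω) i = cubeWeight ω i := by
  by_cases hi : i < m
  · have hne : (⟨i, hi⟩ : Fin m) ≠ j := fun h => hij (by rw [← h])
    simp [cubeWeight, hi, flip, Function.update_of_ne hne]
  · simp [cubeWeight, hi]

theorem cubeWeight_sub_flip_sq (ω : Fin m → Bool) (j : Fin m) :
    (cubeWeight ω j - cubeWeight (flip j ω) j) ^ 2 = 1 := by
  cases h : ω j <;> simp [cubeWeight, flip, h]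

/-- The profile attached to a vertex of the hypercube: bumps of height `a * m ^ (-α)` on the
intervals of length `1 / m` selected by the vertex, and one more bump on `[1, 1 + 1 / m]`. -/
def bumpSum (α a : ℝ) (ω : Fin m → Bool) (z : ℝ) : ℝ :=
  a * (m : ℝ) ^ (-α) * translateSum plateau (cubeWeight ω) (m + 1) (m * z)

theorem exists_bumpSum_mem_holderClass (hγ₀ : 0 ≤ γ) (hγ₁ : γ ≤ 1) (hL : 0 < L)
    (hB : ∀ k ≤ s, 0 < B k) :
    ∃ a₀ > 0, ∀ a, 0 ≤ a → a ≤ a₀ → ∀ m : ℕ, 1 ≤ m → ∀ ω : Fin m → Bool,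
      bumpSum (s + γ) a ω ∈ holderClass s γ L B := by
  obtain ⟨M, hM₀, hM⟩ :=
    exists_abs_iteratedDeriv_le (N := s + 1) contDiff_plateau hasCompactSupport_plateau
  obtain ⟨a₀, ha₀, ha⟩ := exists_pos_forall_mul_le hM₀ hL hB
  refine ⟨a₀, ha₀, fun a ha0 haa m hm ω => ?_⟩
  refine rescale_mem_holderClass (contDiff_translateSum contDiff_plateau _ _) (fun k hk z => ?_)
    hγ₀ hγ₁ (mod_cast hm) ha0 (ha a haa).1 (ha a haa).2
  rw [iteratedDeriv_translateSum contDiff_plateau]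
  exact abs_translateSum_le (hM k hk) (fun z hz => iteratedDeriv_eq_zero_of_notMem_tsupport
    fun h => hz (tsupport_plateau_subset h)) (abs_cubeWeight_le ω) _ _

theorem bumpSum_not_const {α a : ℝ} (ha : a ≠ 0) (hm : 1 ≤ m) (ω : Fin m → Bool) :
    ∃ z₁ z₂, bumpSum α a ω z₁ ≠ bumpSum α a ω z₂ := by
  have hm0 : (0 : ℝ) < m := by exact_mod_cast hm
  refine ⟨(m + 1 / 2) / m, -1, ?_⟩
  have hlast : translateSum plateau (cubeWeight ω) (m + 1) (m + 1 / 2) = 1 := by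
    rw [translateSum_eq_of_mem_Ioo (fun _ => plateau_eq_zero) m.lt_succ_self (by norm_num),
      plateau_eq_one (by norm_num)]
    simp [cubeWeight]
  have hleft : translateSum plateau (cubeWeight ω) (m + 1) (m * -1) = 0 :=
    Finset.sum_eq_zero fun j _ => by
      rw [plateau_eq_zero, mul_zero]
      exact fun h => by linarith [h.1, (Nat.cast_nonneg j : (0 : ℝ) ≤ j)]
  rw [bumpSum, bumpSum, mul_div_cancel₀ _ hm0.ne', hlast, hleft]
  simp only [mul_one, mul_zero]
  positivity

theorem bumpSum_sub_flip_sq (α a : ℝ) (ω : Fin m → Bool) (j : Fin m) (z : ℝ) :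
    (bumpSum α a ω z - bumpSum α a (flip j ω) z) ^ 2 =
      (a * (m : ℝ) ^ (-α)) ^ 2 * plateau (m * z - j) ^ 2 := by
  unfold bumpSum translateSum
  rw [← mul_sub, ← Finset.sum_sub_distrib, mul_pow,
    Finset.sum_eq_single_of_mem (j : ℕ) (Finset.mem_range.2 (by omega)), ← sub_mul,
    mul_pow _ (plateau _), cubeWeight_sub_flip_sq, one_mul]
  intro i _ hij
  rw [cubeWeight_flip_of_ne ω hij, sub_self]

end Bumps

section Directions

theorem exists_directions_one {q : ℕ} (hq : q ≤ 1) :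
    ∃ β : Fin (q + 1) → EuclideanSpace ℝ (Fin 1), (∀ i, ‖β i‖ = 1) ∧ Function.Injective β ∧
      β 0 = EuclideanSpace.single 0 1 := by
  refine ⟨fun i => EuclideanSpace.single 0 (if i = 0 then 1 else -1), fun i => ?_,
    fun i j hij => ?_, by simp⟩
  · by_cases hi : i = 0 <;> simp [hi]
  · have h0 : (if i = 0 then 1 else -1 : ℝ) = if j = 0 then 1 else -1 := by
      simpa using congrArg (fun v : EuclideanSpace ℝ (Fin 1) => v 0) hij
    split_ifs at h0 with hi hj hj
    · rw [hi, hj]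
    · norm_num at h0
    · norm_num at h0
    · ext
      have := Fin.val_ne_zero_iff.2 hi
      have := Fin.val_ne_zero_iff.2 hj
      omega

theorem exists_directions_add_two (e q : ℕ) :
    ∃ β : Fin (q + 1) → EuclideanSpace ℝ (Fin (e + 2)), (∀ i, ‖β i‖ = 1) ∧
      Function.Injective β ∧ β 0 = EuclideanSpace.single 0 1 := by
  set t : Fin (q + 1) → ℝ := fun i => (i : ℕ) / ((q : ℝ) + 1) with ht
  have ht_mem : ∀ i, t i ∈ Icc 0 Real.pi := fun i => by
    have h1 : t i ≤ 1 := by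
      rw [ht, div_le_one (by positivity)]
      exact_mod_cast i.2.le
    exact ⟨by positivity, by linarith [Real.pi_gt_three]⟩
  refine ⟨fun i => WithLp.toLp 2 (Fin.cons (Real.cos (t i)) (Fin.cons (Real.sin (t i)) 0)),
    fun i => ?_, fun i j hij => ?_, ?_⟩
  · simp [EuclideanSpace.norm_eq, Fin.sum_univ_succ]
  · have hcos : Real.cos (t i) = Real.cos (t j) :=
      congrArg (fun v : EuclideanSpace ℝ (Fin (e + 2)) => v 0) hij
    have htij := Real.injOn_cos (ht_mem i) (ht_mem j) hcos
    simp only [ht] at htij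
    rw [div_left_inj' (by positivity)] at htij
    exact Fin.ext (mod_cast htij)
  · ext i
    refine Fin.cases ?_ (Fin.cases ?_ fun _ => ?_) i <;> simp [ht]

theorem exists_directions {e q : ℕ} (h : e = 0 → q ≤ 1) :
    ∃ β : Fin (q + 1) → EuclideanSpace ℝ (Fin (e + 1)), (∀ i, ‖β i‖ = 1) ∧
      Function.Injective β ∧ β 0 = EuclideanSpace.single 0 1 := by
  cases e with
  | zero => exact exists_directions_one (h rfl)
  | succ e => exact exists_directions_add_two e q

end Directions

section LowerBound

theorem one_mem_densityClass (d : ℕ) {K : ℝ} (hK : 1 ≤ K) : (fun _ => 1) ∈ densityClass d K := by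
  refine ⟨measurable_const, fun x _ => ⟨?_, hK⟩, ?_⟩
  · exact (div_le_one (one_pos.trans_le hK)).2 hK
  · simp [Measure.real]

theorem covariateLaw_one (d : ℕ) :
    (covariateLaw fun _ : Fin d → ℝ => 1) = volume.restrict (cube d) := by
  simp [covariateLaw]

theorem measurePreserving_eval_restrict_cube {d : ℕ} (i : Fin d) :
    MeasurePreserving (Function.eval i) (volume.restrict (cube d))
      (volume.restrict (Icc (0 : ℝ) 1)) := by
  have : IsProbabilityMeasure (volume.restrict (Icc (0 : ℝ) 1)) := ⟨by simp⟩
  have hcube : volume.restrict (cube d) =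
      Measure.pi fun _ => (volume.restrict (Icc 0 1) : Measure ℝ) := by
    rw [← Measure.restrict_pi_pi, pi_univ_Icc]
    rfl
  rw [hcube]
  exact measurePreserving_eval _ i

variable {e q m : ℕ} {j : Fin m}

/-- The points whose first coordinate, measured in units of `1 / m` from `j / m`, lies in `I`. -/
def slab (m j : ℕ) (I : Set ℝ) : Set (Fin (e + 1) → ℝ) := {x | m * x 0 - j ∈ I}

theorem measurableSet_slab {I : Set ℝ} (hI : MeasurableSet I) (m j : ℕ) :
    MeasurableSet (slab m j I : Set (Fin (e + 1) → ℝ)) :=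
  (by fun_prop : Measurable fun x : Fin (e + 1) → ℝ => (m : ℝ) * x 0 - j) hI

theorem pairwise_disjoint_slab_Ioo (m : ℕ) : Pairwise (Function.onFun Disjoint
    fun j : Fin m => (slab m j (Ioo 0 1) : Set (Fin (e + 1) → ℝ))) := fun _ _ hij =>
  Set.disjoint_left.2 fun _ hi hj => hij (Fin.ext (eq_of_sub_mem_Ioo hi hj))

theorem covariateLaw_one_slab (j : Fin m) {u v : ℝ} (hu : 0 ≤ u) (hv : v ≤ 1) :
    (covariateLaw fun _ => 1) (slab m j (Icc u v) : Set (Fin (e + 1) → ℝ)) =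
      ENNReal.ofReal ((v - u) / m) := by
  have hjm : ((j : ℕ) : ℝ) + 1 ≤ m := by exact_mod_cast j.2
  have hm : (0 : ℝ) < m := by linarith [(Nat.cast_nonneg j : (0 : ℝ) ≤ (j : ℕ))]
  have hslab : (slab m j (Icc u v) : Set (Fin (e + 1) → ℝ)) =
      Function.eval 0 ⁻¹' Icc ((u + j) / m) ((v + j) / m) := by
    ext x
    simp only [slab, mem_ofPred_eq, mem_preimage, Function.eval, mem_Icc, div_le_iff₀ hm,
      le_div_iff₀ hm, le_sub_iff_add_le, sub_le_iff_le_add, mul_comm (m : ℝ)]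
  rw [covariateLaw_one, hslab, (measurePreserving_eval_restrict_cube 0).measure_preimage
    measurableSet_Icc.nullMeasurableSet, Measure.restrict_eq_self, Real.volume_Icc]
  · congr 1
    ring
  · exact Icc_subset_Icc (by positivity) (by rw [div_le_one hm]; linarith)

theorem lintegral_plateau_le (j : Fin m) {b : ℝ} (hb : 0 ≤ b) :
    ∫⁻ x : Fin (e + 1) → ℝ, ENNReal.ofReal (b * plateau (m * x 0 - j) ^ 2)
      ∂(covariateLaw fun _ => 1) ≤ ENNReal.ofReal (b / m) := by
  calc _ ≤ ∫⁻ x : Fin (e + 1) → ℝ, (slab m j (Icc 0 1)).indicator (fun _ => ENNReal.ofReal b) x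
        ∂(covariateLaw fun _ => 1) := by
        refine lintegral_mono fun x => ?_
        by_cases hx : x ∈ slab m j (Icc 0 1)
        · rw [indicator_of_mem hx]
          exact ENNReal.ofReal_le_ofReal (mul_le_of_le_one_right hb
            (pow_le_one₀ (plateau_mem_Icc _).1 (plateau_mem_Icc _).2))
        · simp [plateau_eq_zero fun h => hx (Ioo_subset_Icc_self h)]
    _ = ENNReal.ofReal (b / m) := by
        rw [lintegral_indicator_const (measurableSet_slab measurableSet_Icc _ _),
          covariateLaw_one_slab j le_rfl le_rfl, ← ENNReal.ofReal_mul hb, sub_zero, mul_one_div]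

theorem le_setLIntegral_plateau (j : Fin m) {b : ℝ} (hb : 0 ≤ b) :
    ENNReal.ofReal (b / (2 * m)) ≤ ∫⁻ x : Fin (e + 1) → ℝ in slab m j (Ioo 0 1),
      ENNReal.ofReal (b * plateau (m * x 0 - j) ^ 2) ∂(covariateLaw fun _ => 1) := by
  calc ENNReal.ofReal (b / (2 * m))
      = ∫⁻ _ : Fin (e + 1) → ℝ in slab m j (Icc (1 / 4) (3 / 4)), ENNReal.ofReal b
          ∂(covariateLaw fun _ => 1) := by
        rw [setLIntegral_const, covariateLaw_one_slab j (by norm_num) (by norm_num),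
          ← ENNReal.ofReal_mul hb]
        congr 1
        ring
    _ = ∫⁻ x : Fin (e + 1) → ℝ in slab m j (Icc (1 / 4) (3 / 4)),
          ENNReal.ofReal (b * plateau (m * x 0 - j) ^ 2) ∂(covariateLaw fun _ => 1) :=
        setLIntegral_congr_fun (measurableSet_slab measurableSet_Icc _ _) fun x hx => by
          simp only [plateau_eq_one hx, one_pow, mul_one]
    _ ≤ _ := lintegral_mono_set (preimage_mono (f := fun x : Fin (e + 1) → ℝ => m * x 0 - j)
        (Icc_subset_Ioo (by norm_num) (by norm_num)))

/-- The model attached to a vertex of the hypercube: the vertex is encoded in the profile of the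
first direction, all the other profiles and the scale being fixed. -/
def cubeModel (β : Fin (q + 1) → EuclideanSpace ℝ (Fin (e + 1))) (α a : ℝ) (ω : Fin m → Bool) :
    ModelParam (e + 1) (q + 1) where
  profile := Fin.cons (bumpSum α a ω) fun _ => bumpSum α a fun _ : Fin m => false
  direction := β
  logScale := 0

variable {β : Fin (q + 1) → EuclideanSpace ℝ (Fin (e + 1))} {s : ℕ} {γ L α a : ℝ} {B : ℕ → ℝ}

theorem cubeModel_profile_induction {P : (ℝ → ℝ) → Prop}
    (hP : ∀ ω : Fin m → Bool, P (bumpSum α a ω)) (ω : Fin m → Bool) (i : Fin (q + 1)) :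
    P ((cubeModel β α a ω).profile i) :=
  Fin.cases (hP ω) (fun _ => hP _) i

theorem cubeModel_mem_modelParams (hβ : ∀ i, ‖β i‖ = 1)
    (hmem : ∀ ω : Fin m → Bool, bumpSum α a ω ∈ holderClass s γ L B) (ω : Fin m → Bool) :
    cubeModel β α a ω ∈ modelParams (e + 1) (q + 1) s γ L B 0 :=
  ⟨cubeModel_profile_induction (P := (· ∈ holderClass s γ L B)) hmem ω, hβ,
    fun _ => abs_zero.le⟩

theorem mean_cubeModel_mem_multipleIndexClass (hβ : ∀ i, ‖β i‖ = 1) (hβ' : Function.Injective β)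
    (hmem : ∀ ω : Fin m → Bool, bumpSum α a ω ∈ holderClass s γ L B) (ha : a ≠ 0) (hm : 1 ≤ m)
    (ω : Fin m → Bool) :
    (cubeModel β α a ω).mean ∈ multipleIndexClass (e + 1) (q + 1) s γ L B :=
  ⟨_, β, cubeModel_profile_induction (P := fun g => g ∈ holderClass s γ L B ∧ ∃ z₁ z₂, g z₁ ≠ g z₂)
    (fun ω => ⟨hmem ω, bumpSum_not_const ha hm ω⟩) ω, hβ, hβ', rfl⟩

theorem mean_cubeModel_sub_flip_sq (hβ : β 0 = EuclideanSpace.single 0 1) (ω : Fin m → Bool)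
    (j : Fin m) (x : Fin (e + 1) → ℝ) :
    ((cubeModel β α a ω).mean x - (cubeModel β α a (flip j ω)).mean x) ^ 2 =
      (a * (m : ℝ) ^ (-α)) ^ 2 * plateau (m * x 0 - j) ^ 2 := by
  rw [← bumpSum_sub_flip_sq α a ω]
  simp [ModelParam.mean, cubeModel, Fin.sum_univ_succ (n := q), hβ]

theorem mul_rpow_neg_sq {r : ℝ} (hr : 0 ≤ r) (a α : ℝ) :
    (a * r ^ (-α)) ^ 2 = a ^ 2 * r ^ (-(2 * α)) := by
  rw [mul_pow, ← Real.rpow_mul_natCast hr]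
  congr 2
  push_cast
  ring

theorem mul_rpow_neg_sq_div_le {A r t : ℝ} (hr : 0 < r) (ht : 0 < t) (hA : 0 < A)
    (haA : a ^ 2 * A ≤ 1) (htr : t ≤ r ^ (2 * α + 1)) :
    (a * r ^ (-α)) ^ 2 / r ≤ 1 / (A * t) :=
  calc (a * r ^ (-α)) ^ 2 / r = a ^ 2 / r ^ (2 * α + 1) := by
        rw [mul_rpow_neg_sq hr.le, Real.rpow_neg hr.le, Real.rpow_add_one hr.ne']
        field_simp
    _ ≤ a ^ 2 / t := by gcongr
    _ ≤ 1 / A / t := by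
        gcongr
        rwa [le_div_iff₀ hA]
    _ = 1 / (A * t) := div_div _ _ _

theorem exists_nat_le_rpow_and_le_rpow_neg {n : ℕ} (hα : 0 ≤ α) (hn : 1 ≤ n) :
    ∃ m : ℕ, 1 ≤ m ∧ (n : ℝ) ≤ (m : ℝ) ^ (2 * α + 1) ∧
      2 ^ (-(2 * α)) * (n : ℝ) ^ (-(2 * α) / (2 * α + 1)) ≤ (m : ℝ) ^ (-(2 * α)) := by
  have hn1 : (1 : ℝ) ≤ n := by exact_mod_cast hn
  set t : ℝ := (n : ℝ) ^ (1 / (2 * α + 1)) with ht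
  have ht1 : 1 ≤ t := Real.one_le_rpow hn1 (by positivity)
  have htm : t ≤ ⌈t⌉₊ := Nat.le_ceil t
  have hmt : (⌈t⌉₊ : ℝ) ≤ 2 * t := by linarith [Nat.ceil_lt_add_one (zero_le_one.trans ht1)]
  refine ⟨⌈t⌉₊, Nat.one_le_ceil_iff.2 (one_pos.trans_le ht1), ?_, ?_⟩
  · calc (n : ℝ) = t ^ (2 * α + 1) := by
          rw [ht, ← Real.rpow_mul (by positivity), one_div_mul_cancel (by positivity),
            Real.rpow_one]
      _ ≤ _ := by gcongr
  · calc 2 ^ (-(2 * α)) * (n : ℝ) ^ (-(2 * α) / (2 * α + 1)) = (2 * t) ^ (-(2 * α)) := by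
          rw [Real.mul_rpow zero_le_two (by positivity), ht, ← Real.rpow_mul (by positivity)]
          ring_nf
      _ ≤ _ := Real.rpow_le_rpow_of_nonpos (by linarith) hmt (by linarith)

theorem exists_pos_le_and_sq_mul_le_one {a₀ A : ℝ} (ha₀ : 0 < a₀) (hA : 0 < A) :
    ∃ a > 0, a ≤ a₀ ∧ a ^ 2 * A ≤ 1 := by
  refine ⟨min a₀ (1 / √A), by positivity, min_le_left _ _, ?_⟩
  calc min a₀ (1 / √A) ^ 2 * A ≤ (1 / √A) ^ 2 * A := by
        gcongr
        exact min_le_right _ _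
    _ = 1 := by
        rw [div_pow, one_pow, Real.sq_sqrt hA.le, one_div_mul_cancel hA.ne']

theorem RegularDensity.exists_sq_mul_rpow_le_minimaxRisk {f : ℝ → ℝ} (hf : RegularDensity f)
    (h : e = 0 → q ≤ 1) (hγ₀ : 0 ≤ γ) (hγ₁ : γ ≤ 1) (hL : 0 < L) (hB : ∀ k ≤ s, 0 < B k)
    {K C : ℝ} (hK : 1 ≤ K) (hC : 0 ≤ C) :
    ∃ a > 0, ∀ {n m : ℕ}, 1 ≤ n → 1 ≤ m → (n : ℝ) ≤ (m : ℝ) ^ (2 * (s + γ) + 1) →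
      ENNReal.ofReal (a ^ 2 * (m : ℝ) ^ (-(2 * (s + γ))) / 64) ≤
        minimaxRisk n f (multipleIndexClass (e + 1) (q + 1) s γ L B) (scaleClass (e + 1) C)
          (densityClass (e + 1) K) := by
  obtain ⟨β, hβ, hβ_inj, hβ_zero⟩ := exists_directions h
  obtain ⟨a₀, ha₀, hmem⟩ := exists_bumpSum_mem_holderClass hγ₀ hγ₁ hL hB
  have hone := one_mem_densityClass (e + 1) hK
  have hscale : (fun x => Real.exp (∑ j, (0 : Fin (e + 1) → ℝ) j * x j)) ∈ scaleClass (e + 1) C :=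
    ⟨0, fun _ => abs_zero.trans_le hC, rfl⟩
  obtain ⟨A, hA, hassouad⟩ := hf.exists_mul_le_minimaxRisk (zero_le_one.trans hK) hone hone hscale
    ((q + 1 : ℕ) * B 0) (b := Real.exp ((e + 1 : ℕ) * 0)) (Real.exp_pos _)
  obtain ⟨a, ha, haa₀, haA⟩ := exists_pos_le_and_sq_mul_le_one ha₀ hA
  refine ⟨a, ha, fun {n m} hn hm hnm => ?_⟩
  have hm₀ : (0 : ℝ) < m := Nat.cast_pos.2 hm
  have hmem' := hmem a ha.le haa₀ m hm
  rw [← mul_rpow_neg_sq hm₀.le]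
  have key := hassouad (μ := fun ω => (cubeModel β (s + γ) a ω).mean)
    (T := fun j => slab m j (Ioo 0 1))
    (Δ := ENNReal.ofReal ((a * (m : ℝ) ^ (-(s + γ))) ^ 2 / (2 * m))) hn
    (mean_cubeModel_mem_multipleIndexClass hβ hβ_inj hmem' ha.ne' hm)
    (fun ω => admissible_of_mem_modelParams (cubeModel_mem_modelParams hβ hmem' ω))
    (fun ω j => by
      simp only [mean_cubeModel_sub_flip_sq hβ_zero]
      exact (lintegral_plateau_le j (sq_nonneg _)).trans (ENNReal.ofReal_le_ofReal
        (mul_rpow_neg_sq_div_le hm₀ (Nat.cast_pos.2 hn) hA haA hnm)))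
    (fun j => measurableSet_slab measurableSet_Ioo m j) (pairwise_disjoint_slab_Ioo m)
    (fun ω j => by
      simp only [mean_cubeModel_sub_flip_sq hβ_zero]
      exact le_setLIntegral_plateau j (sq_nonneg _))
  refine (ENNReal.mul_le_mul_iff_right (a := 32) (by simp) (by simp)).1 (le_trans ?_ key)
  rw [← ENNReal.ofReal_ofNat, ← ENNReal.ofReal_natCast, ← ENNReal.ofReal_mul (by positivity),
    ← ENNReal.ofReal_mul (by positivity)]
  refine ENNReal.ofReal_le_ofReal (le_of_eq ?_)
  field_simp
  norm_num

theorem RegularDensity.exists_le_minimaxRisk {f : ℝ → ℝ} (hf : RegularDensity f) {d p : ℕ}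
    (hd : 1 ≤ d) (hp : 1 ≤ p) (hdp : d = 1 → p ≤ 2) (hγ₀ : 0 ≤ γ) (hγ₁ : γ ≤ 1) (hL : 0 < L)
    (hB : ∀ k ≤ s, 0 < B k) {K C : ℝ} (hK : 1 ≤ K) (hC : 0 ≤ C) :
    ∃ c > 0, ∀ n : ℕ, 1 ≤ n →
      ENNReal.ofReal (c * (n : ℝ) ^ (-(2 * (s + γ)) / (2 * (s + γ) + 1))) ≤
        minimaxRisk n f (multipleIndexClass d p s γ L B) (scaleClass d C) (densityClass d K) := by
  obtain ⟨e, rfl⟩ := Nat.exists_eq_add_of_le' hd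
  obtain ⟨q, rfl⟩ := Nat.exists_eq_add_of_le' hp
  obtain ⟨a, ha, hrisk⟩ := hf.exists_sq_mul_rpow_le_minimaxRisk (e := e) (q := q) (by omega)
    hγ₀ hγ₁ hL hB hK hC
  refine ⟨a ^ 2 * 2 ^ (-(2 * (s + γ))) / 64, by positivity, fun n hn => ?_⟩
  obtain ⟨m, hm, hnm, hmn⟩ := exists_nat_le_rpow_and_le_rpow_neg (α := s + γ) (by positivity) hn
  refine le_trans (ENNReal.ofReal_le_ofReal ?_) (hrisk hn hm hnm)
  calc _ = a ^ 2 * (2 ^ (-(2 * (s + γ))) *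
        (n : ℝ) ^ (-(2 * (s + γ)) / (2 * (s + γ) + 1))) / 64 := by ring
    _ ≤ a ^ 2 * (m : ℝ) ^ (-(2 * (s + γ))) / 64 := by gcongr

end LowerBound

end LocationScale

end

theorem corollary4_general
    (d p : ℕ) (hd : 1 ≤ d) (hp : 1 ≤ p) (hdp : d = 1 → p ≤ 2)
    (s : ℕ) (γ : ℝ) (hγ₀ : 0 < γ) (hγ₁ : γ ≤ 1) (α : ℝ) (hα : α = s + γ)
    (L : ℝ) (hL : 0 < L) (B : ℕ → ℝ) (hB : ∀ k ≤ s, 0 < B k)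
    (K : ℝ) (hK : 1 ≤ K) (C : ℝ) (hC : 0 ≤ C)
    (f : ℝ → ℝ) (hf : LocationScale.RegularDensity f) :
    ∃ c₁ c₂ : ℝ, 0 < c₁ ∧ 0 < c₂ ∧ ∀ n : ℕ, 1 ≤ n →
      ENNReal.ofReal (c₁ * (n : ℝ) ^ (-(2 * α) / (2 * α + 1))) ≤
          LocationScale.minimaxRisk n f (LocationScale.multipleIndexClass d p s γ L B)
            (LocationScale.scaleClass d C) (LocationScale.densityClass d K) ∧
        LocationScale.minimaxRisk n f (LocationScale.multipleIndexClass d p s γ L B)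
            (LocationScale.scaleClass d C) (LocationScale.densityClass d K) ≤
          ENNReal.ofReal (c₂ * (n : ℝ) ^ (-(2 * α) / (2 * α + 1))) := by
  subst hα
  obtain ⟨c₁, hc₁, lower⟩ := hf.exists_le_minimaxRisk hd hp hdp hγ₀.le hγ₁ hL hB hK hC
  obtain ⟨c₂, hc₂, upper⟩ :=
    hf.exists_minimaxRisk_le (d := d) (p := p) (B := B) hγ₀ hγ₁ hL.le (one_pos.trans_le hK) hC
  exact ⟨c₁, c₂, hc₁, hc₂, fun n hn => ⟨lower n hn, upper n hn⟩⟩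

theorem corollary4
    (d p : ℕ) (hd : 1 ≤ d) (hp : 1 ≤ p) (hdp : d = 1 → p ≤ 2)
    (s : ℕ) (γ : ℝ) (hγ₀ : 0 < γ) (hγ₁ : γ ≤ 1) (α : ℝ) (hα : α = s + γ)
    (L : ℝ) (hL : 0 < L) (B : ℕ → ℝ) (hB : ∀ k ≤ s, 0 < B k)
    (K : ℝ) (hK : 1 < K) (C : ℝ) (hC : 0 < C)
    (f₀ : ℝ → ℝ) (hf₀ : LocationScale.IsStandardErrorDensity f₀)
    (η₀ σ₀ : ℝ) (hσ₀ : 0 < σ₀) :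
    ∃ c₁ c₂ : ℝ, 0 < c₁ ∧ 0 < c₂ ∧ ∀ n : ℕ, 1 ≤ n →
      ENNReal.ofReal (c₁ * (n : ℝ) ^ (-(2 * α) / (2 * α + 1))) ≤
          LocationScale.minimaxRisk n (LocationScale.locScale f₀ η₀ σ₀)
            (LocationScale.multipleIndexClass d p s γ L B)
            (LocationScale.scaleClass d C) (LocationScale.densityClass d K) ∧
        LocationScale.minimaxRisk n (LocationScale.locScale f₀ η₀ σ₀)
            (LocationScale.multipleIndexClass d p s γ L B)
            (LocationScale.scaleClass d C) (LocationScale.densityClass d K) ≤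
          ENNReal.ofReal (c₂ * (n : ℝ) ^ (-(2 * α) / (2 * α + 1))) :=
  corollary4_general d p hd hp hdp s γ hγ₀ hγ₁ α hα L hL B hB K hK.le C hC.le _
    (hf₀.regularDensity.locScale η₀ hσ₀)
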